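/- Let $\alpha>0$, $\beta\neq0$, $\mathcal Q=\{(x,y,z):\beta y^2+z^2-\alpha^2\le 0\}$ and $\mathcal S=\{\beta y^2+z^2-\alpha^2=0\}$. A polyhedron $\mathcal P$ is a compact set, equal to the closure of its interior, whose boundary is a finite union of planar polygonal faces $\mathcal F_i$ with outward normals $\mathbf n_i$ which overlap only along finitely many straight segments (it need not be convex or connected). Write $\mathcal M^{\mathcal P\cap\mathcal Q}=\int_{\mathcal P\cap\mathcal Q}(1,x,y,z)^{\mathsf T}\,d\mathbf x\in\mathbb R^4$. **Edges.** For each $i$ let the boundary of the clipped face $\mathcal F_i\cap\mathcal Q$ (the closure of its interior in the plane of $\mathcal F_i$) be divided into finitely many edges, oriented counterclockwise about $\mathbf n_i$ and parametrized by $\mathbf x_{i,j}:[0,1]\to\mathbb R^3$ from $\mathbf x_{i,j,0}$ to $\mathbf x_{i,j,1}$. Let $\mathbb 1_{i,j}=1$ if the edge is contained in the boundary, relative to $\mathcal S$, of $\mathcal S\cap\mathcal P$, and $\mathbb 1_{i,j}=0$ otherwise. If $\mathbb 1_{i,j}=0$, then $\mathbf x_{i,j}$ is the linear parametrization $\bar{\mathbf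 x}_{i,j}(t)=(1-t)\mathbf x_{i,j,0}+t\,\mathbf x_{i,j,1}$; if $\mathbb 1_{i,j}=1$, it is a rational Bézier curve $$\mathbf x_{i,j}(t)=\frac{(1-t)^2\mathbf x_{i,j,0}+2w_{i,j}t(1-t)\mathbf x^\star_{i,j}+t^2\mathbf x_{i,j,1}}{(1-t)^2+2w_{i,j}t(1-t)+t^2}$$ with weight $w_{i,j}>0$ and control point $\mathbf x^\star_{i,j}$. Let $\mathbf x_{i,\mathrm{ref}}$ be any point of the plane of $\mathcal F_i$ (for instance a vertex of the clipped face). **Operators.** Let $\mathcal A(\mathbf x_a,\mathbf x_b,\mathbf x_c)=\frac12\big(x_a(y_b-y_c)+x_b(y_c-y_a)+x_c(y_a-y_b)\big)$, $\mathcal A^\dagger(\mathbf x_a,\mathbf x_b,\mathbf x_c)=\frac12\big(y_a(z_b-z_c)+y_b(z_c-z_a)+y_c(z_a-z_b)\big)$, $$\mathcal B^{(1)}(\mathbf x_a,\mathbf x_b,\mathbf x_c)=\tfrac1{12}\begin{bmatrix}4(z_a+z_b+z_c)\\(z_a+z_b+z_c)(x_a+x_b+x_c)+x_az_a+x_bz_b+x_cz_c\\(z_a+z_b+z_c)(y_a+y_b+y_c)+y_az_a+y_bz_b+y_cz_c\\z_a^2+z_b^2+z_c^2+z_bz_c+z_az_b+z_az_c\end{bmatrix},$$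 $$\mathcal B^{(2)}(\mathbf x_a,\mathbf x_b)=\tfrac1{24}\begin{bmatrix}4\big(x_a(2z_a+z_b)+x_b(z_a+2z_b)\big)\\(z_a+z_b)(x_a+x_b)^2+2x_a^2z_a+2x_b^2z_b\\2\big((x_a+x_b)(y_a+y_b)(z_a+z_b)+2x_ay_az_a+2x_by_bz_b\big)\\(z_a+z_b)^2(x_a+x_b)+2x_az_a^2+2x_bz_b^2\end{bmatrix},$$ and $\mathcal B^{(3)}(w,\mathbf x_a,\mathbf x_b,\mathbf x_c)=\mathrm{diag}(\Lambda^2,\Lambda^3,\Lambda^3,\Lambda^3)\,\mathcal C\,\mathcal K\,\mathcal D$, where $\Lambda=\frac1{(w-1)(w+1)}$, $\mathcal D=(\Theta w,\,w^2,\,\Theta w^3,\,w^4,\,\Theta w^5,\,w^6)^{\mathsf T}$, $$\Theta=\begin{cases}\arctan\!\Big(\frac{1-w}{\sqrt{1-w^2}}\Big)\frac1{\sqrt{1-w^2}},&0<w<1,\\ \operatorname{arctanh}\!\Big(\frac{w-1}{\sqrt{w^2-1}}\Big)\frac1{\sqrt{w^2-1}},&w>1,\end{cases}$$ $$\mathcal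 K=\begin{bmatrix}1&-\frac56&0&\frac13&0&0\\0&\frac23&-2&\frac13&0&0\\-\frac3{16}&\frac{23}{96}&-\frac18&-\frac18&0&\frac1{24}\\-\frac18&\frac5{48}&\frac18&-\frac7{48}&0&\frac1{24}\\0&-\frac13&\frac54&-\frac38&0&\frac1{12}\\0&0&-\frac14&\frac{13}{24}&-1&\frac1{12}\end{bmatrix},$$ and $\mathcal C$ is the $4\times6$ matrix whose non-zero entries are $\mathcal C_{1,1}=x_a+x_b$, $\mathcal C_{1,2}=x_c$; $(\mathcal C_{2,3},\dots,\mathcal C_{2,6})=\big((x_a+x_b)^2,\,x_a^2+x_b^2,\,(x_a+x_b)x_c,\,x_c^2\big)$; $(\mathcal C_{3,3},\dots,\mathcal C_{3,6})=\big(2(x_a+x_b)(y_a+y_b),\,2(x_ay_a+x_by_b),\,(x_a+x_b)y_c+(y_a+y_b)x_c,\,2x_cy_c\big)$; and row 4 is row 3 with $z$ in place of $y$. (When $w=1$ the factor $\mathcal A^\dagger$ below vanishes, and the product $\mathcal A^\dagger\mathcal B^{(3)}$ is read as $0$.) Put $$\mathcal M^1_i=\sum_j\mathcal A(\mathbf x_{i,j,0},\mathbf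 x_{i,j,1},\mathbf x_{i,\mathrm{ref}})\,\mathcal B^{(1)}(\mathbf x_{i,j,0},\mathbf x_{i,j,1},\mathbf x_{i,\mathrm{ref}}),\qquad \mathcal M^2_i=\sum_j\mathbb 1_{i,j}(y_{i,j,0}-y_{i,j,1})\,\mathcal B^{(2)}(\mathbf x_{i,j,0},\mathbf x_{i,j,1}),$$ $$\mathcal M^3_i=\sum_j-\mathbb 1_{i,j}\,\mathcal A^\dagger(\mathbf x_{i,j,0},\mathbf x_{i,j,1},\mathbf x^\star_{i,j})\,\mathcal B^{(3)}(w_{i,j},\mathbf x_{i,j,0},\mathbf x_{i,j,1},\mathbf x^\star_{i,j}).$$ **Theorem.** (a) If $\mathcal P\subset\{z\ge0\}$, then for every such division of the boundaries of the clipped faces, $$\mathcal M^{\mathcal P\cap\mathcal Q}=\sum_i\big(\mathcal M^1_i+\mathcal M^2_i+\mathcal M^3_i\big).$$ Moreover, let $\Phi(x,y,z)=\int_0^z(1,x,y,s)^{\mathsf T}ds$ and, for a function $g$ of $(x,y)$, let $\Psi_g(x,y)=\int_0^x\Phi(s,y,g(s,y))\,ds$. Let $\Psi_{\mathcal S}=\Psi_g$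 for $g=\sqrt{\alpha^2-\beta y^2}$, and, if $\mathbf n_i\cdot\mathbf e_z\ne0$, let $\Psi_{\mathcal F_i}=\Psi_g$ for $g$ the height of the plane of $\mathcal F_i$. Let $\Psi^{\mathcal R}(x,y,z)=(xz,\frac12x^2z,xyz,\frac12xz^2)^{\mathsf T}$. Then for every $i$ $$\mathcal M^2_i=\sum_j-\mathbb 1_{i,j}\int_0^1\Psi^{\mathcal R}(\bar{\mathbf x}_{i,j})\,\bar y_{i,j}'\,dt,$$ and, for every $i$ with $\mathbf n_i\cdot\mathbf e_z\ne0$, $$\mathcal M^1_i=\sum_j\int_0^1\Psi_{\mathcal F_i}(\bar x_{i,j},\bar y_{i,j})\,\bar y_{i,j}'\,dt,$$ $$\mathcal M^3_i=\sum_j-\mathbb 1_{i,j}\int_0^1\Big[\big(\Psi_{\mathcal F_i}(\bar x_{i,j},\bar y_{i,j})-\Psi^{\mathcal R}(\bar{\mathbf x}_{i,j})\big)\bar y_{i,j}'+\big(\Psi_{\mathcal S}(x_{i,j},y_{i,j})-\Psi_{\mathcal F_i}(x_{i,j},y_{i,j})\big)y_{i,j}'\Big]dt .$$ (b) Conic arcs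 are represented exactly by rational Bézier curves: if $H$ is a plane whose normal has a non-zero $x$-component and $\mathbf a,\mathbf b\in H\cap\mathcal S\cap\{z\ge0\}$ do not both lie in $\{z=0\}$, then the arc of $H\cap\mathcal S\cap\{z\ge0\}$ on which $y$ lies between $y_a$ and $y_b$ is the image of $[0,1]$ under a rational Bézier curve as above from $\mathbf a$ to $\mathbf b$, with some control point and some weight $w>0$. (c) Let $\mathcal P$ be an arbitrary polyhedron. Let $\mathcal P^+$ be its part in $\{z\ge0\}$ and $\mathcal P^-$ the image of its part in $\{z\le0\}$ under the rotation $(x,y,z)\mapsto(x,-y,-z)$ (each part being replaced by the closure of its interior), both described as polyhedra with their faces and edges of clipped faces as above. Then $$\mathcal M^{\mathcal P\cap\mathcal Q}=\mathcal M^++\mathrm{diag}(1,1,-1,-1)\,\mathcal M^-,$$ where $\mathcal M^\pm$ is the sum $\sum_i(\mathcal M^1_i+\mathcal M^2_i+\mathcal M^3_i)$ for $\mathcal P^\pm$. -/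

import Mathlib

open scoped Matrix Topology
open MeasureTheory

namespace CylinderClip

noncomputable section

/-- Points of `ℝ³`; the coordinates `x, y, z` of `p` are `p 0, p 1, p 2`. -/
abbrev Point := Fin 3 → ℝ

/-! ### Polyhedra -/

/-- A (not necessarily convex or connected) polyhedron: a compact regular closed set whose
boundary is covered by finitely many planar faces `face i ⊆ {q | normal i ⬝ᵥ q = offset i}`.
Away from the finitely many segments of the skeleton, the faces do not meet each other, and the
solid coincides near a point of `face i` with the half-space that `normal i` points out of.
(Hence near such a point `face i` fills its plane, so that the relative boundary of a face
consists of skeleton segments: the faces are polygonal.) -/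
structure Polyhedron where
  carrier : Set Point
  numFaces : ℕ
  face : Fin numFaces → Set Point
  normal : Fin numFaces → Point
  offset : Fin numFaces → ℝ
  /-- The straight edges of the polyhedron, each given by its two end-points. -/
  skeletonEdges : Finset (Point × Point)
  isCompact_carrier : IsCompact carrier
  closure_interior_carrier : closure (interior carrier) = carrier
  isClosed_face : ∀ i, IsClosed (face i)
  normal_ne_zero : ∀ i, normal i ≠ 0
  face_subset_plane : ∀ i, face i ⊆ {q | normal i ⬝ᵥ q = offset i}
  frontier_eq : frontier carrier = ⋃ i, face i
  face_inter_face : ∀ i j, i ≠ j →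
    face i ∩ face j ⊆ ⋃ e ∈ skeletonEdges, segment ℝ e.1 e.2
  outward : ∀ i, ∀ p ∈ face i, p ∉ (⋃ e ∈ skeletonEdges, segment ℝ e.1 e.2) →
    ∀ᶠ q in 𝓝 p, (q ∈ carrier ↔ normal i ⬝ᵥ q ≤ offset i)

/-- The plane carrying the `i`-th face. -/
def Polyhedron.plane (P : Polyhedron) (i : Fin P.numFaces) : Set Point :=
  {q | P.normal i ⬝ᵥ q = P.offset i}

/-! ### The quadratic cylinder -/

/-- The level function `φ(x, y, z) = β y² + z² - α²`. -/
def phi (α β : ℝ) (p : Point) : ℝ := β * p 1 ^ 2 + p 2 ^ 2 - α ^ 2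

/-- The clipping region `𝒬 = {φ ≤ 0}`. -/
def region (α β : ℝ) : Set Point := {p | phi α β p ≤ 0}

/-- The cylinder `𝒮 = {φ = 0}`. -/
def surface (α β : ℝ) : Set Point := {p | phi α β p = 0}

/-- The boundary (relative to `𝒮`) of the clipped surface `𝒮 ∩ 𝒫`. -/
def surfaceBoundary (α β : ℝ) (P : Polyhedron) : Set Point :=
  (surface α β ∩ P.carrier) ∩ closure (surface α β \ P.carrier)

/-- The height `z = √(α² - β y²)` of the upper sheet of the cylinder. -/
def zSurface (α β _x y : ℝ) : ℝ := √(α ^ 2 - β * y ^ 2)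

/-! ### Moments -/

/-- `Υ(x, y, z) = (1, x, y, z)`. -/
def upsilon (p : Point) : Fin 4 → ℝ := ![1, p 0, p 1, p 2]

/-- The volume and the first moments of a region, `∫ (1, x, y, z)`. -/
def moments (s : Set Point) : Fin 4 → ℝ := ∫ p in s, upsilon p

/-- `Φ(x, y, z) = ∫₀ᶻ Υ(x, y, s) ds`. -/
def bigPhi (p : Point) : Fin 4 → ℝ := ∫ s in (0 : ℝ)..(p 2), upsilon ![p 0, p 1, s]

/-- `Ψ(x, y) = ∫₀ˣ Φ(s, y, g(s, y)) ds` for the graph `z = g(x, y)`. -/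
def bigPsi (g : ℝ → ℝ → ℝ) (x y : ℝ) : Fin 4 → ℝ :=
  ∫ s in (0 : ℝ)..x, bigPhi ![s, y, g s y]

/-- The height of the plane of the `i`-th face as a function of `x` and `y`; meaningful if the
`z`-component of the normal does not vanish. -/
def Polyhedron.zFace (P : Polyhedron) (i : Fin P.numFaces) (x y : ℝ) : ℝ :=
  (P.offset i - P.normal i 0 * x - P.normal i 1 * y) / P.normal i 2

/-- The surface integrand expressed through all three coordinates of a point. -/
def psiR (p : Point) : Fin 4 → ℝ :=
  ![p 0 * p 2, 1 / 2 * p 0 ^ 2 * p 2, p 0 * p 1 * p 2, 1 / 2 * p 0 * p 2 ^ 2]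

/-! ### Edges -/

/-- The linear parametrization from `a` to `b`. -/
def linearCurve (a b : Point) (t : ℝ) : Point := (1 - t) • a + t • b

/-- The rational quadratic Bézier curve with end-points `a`, `b`, control point `c` and weight
`w`. -/
def bezier (w : ℝ) (a b c : Point) (t : ℝ) : Point :=
  ((1 - t) ^ 2 + 2 * w * t * (1 - t) + t ^ 2)⁻¹ •
    ((1 - t) ^ 2 • a + (2 * w * t * (1 - t)) • c + t ^ 2 • b)

/-- An oriented edge of a clipped face. The control point and the weight are used only if the
edge is marked as an edge of the clipped surface. -/
structure Edge where
  source : Point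
  target : Point
  onSurface : Bool
  control : Point
  weight : ℝ

namespace Edge

/-- The exact parametrization of an edge over `[0, 1]`. -/
def curve (e : Edge) : ℝ → Point :=
  if e.onSurface then bezier e.weight e.source e.target e.control else linearCurve e.source e.target

/-- The chord of an edge. -/
def chord (e : Edge) : ℝ → Point := linearCurve e.source e.target

/-- The coefficient which is `1` on the edges of the clipped surface and `0` on the others. -/
def indicator (e : Edge) : ℝ := if e.onSurface then 1 else 0

end Edge

/-- The interior of `s` relative to the plane `H`. -/
def relInterior (H s : Set Point) : Set Point := {p ∈ H | s ∈ 𝓝[H] p}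

/-- The edges `e` form the boundary, oriented counterclockwise about `n`, of the region `R`
contained in a plane with normal vector `n`: they fill up the relative boundary of `R`, they meet
(themselves or each other) in finitely many points only, and with finitely many exceptions `R`
lies, at each point of an edge, to the left of the edge and not to its right. -/
structure IsOrientedBoundary (n : Point) (R : Set Point) {k : ℕ} (e : Fin k → Edge) : Prop where
  image_eq : closure R \ R = ⋃ j, (e j).curve '' Set.Icc 0 1
  finite_meet : {p : Point | ∃ a b : Fin k × ℝ, a.2 ∈ Set.Icc 0 1 ∧ b.2 ∈ Set.Icc 0 1 ∧ a ≠ b ∧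
    (e a.1).curve a.2 = p ∧ (e b.1).curve b.2 = p}.Finite
  left : ∀ j, {t : ℝ | t ∈ Set.Icc 0 1 ∧ ¬ ∀ᶠ s in 𝓝[>] (0 : ℝ),
    (e j).curve t + s • (n ⨯₃ deriv (e j).curve t) ∈ R ∧
    (e j).curve t - s • (n ⨯₃ deriv (e j).curve t) ∉ R}.Finite

/-- The edges of the clipped faces `face i ∩ 𝒬` of a polyhedron, with a reference point in the
plane of each face. Clipped faces enter through their interiors relative to the planes of the
faces, so that isolated points or hanging segments, which carry no area, bear no edges. -/
structure ClippedEdges (α β : ℝ) (P : Polyhedron) where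
  numEdges : Fin P.numFaces → ℕ
  edge : ∀ i, Fin (numEdges i) → Edge
  refPoint : Fin P.numFaces → Point
  refPoint_mem : ∀ i, refPoint i ∈ P.plane i
  onSurface_iff : ∀ i j, (edge i j).onSurface = true ↔
    ∀ t ∈ Set.Icc (0 : ℝ) 1, (edge i j).curve t ∈ surfaceBoundary α β P
  weight_pos : ∀ i j, (edge i j).onSurface = true → 0 < (edge i j).weight
  isOrientedBoundary : ∀ i, IsOrientedBoundary (P.normal i)
    (relInterior (P.plane i) (P.face i ∩ region α β)) (edge i)

/-! ### The closed-form operators -/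

/-- The signed area of the projection of a triangle onto the `xy`-plane. -/
def areaXY (a b c : Point) : ℝ :=
  1 / 2 * (a 0 * (b 1 - c 1) + b 0 * (c 1 - a 1) + c 0 * (a 1 - b 1))

/-- The signed area of the projection of a triangle onto the `yz`-plane. -/
def areaYZ (a b c : Point) : ℝ :=
  1 / 2 * (a 1 * (b 2 - c 2) + b 1 * (c 2 - a 2) + c 1 * (a 2 - b 2))

def B1 (a b c : Point) : Fin 4 → ℝ :=
  (1 / 12 : ℝ) •
    ![4 * (a 2 + b 2 + c 2),
      (a 2 + b 2 + c 2) * (a 0 + b 0 + c 0) + a 0 * a 2 + b 0 * b 2 + c 0 * c 2,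
      (a 2 + b 2 + c 2) * (a 1 + b 1 + c 1) + a 1 * a 2 + b 1 * b 2 + c 1 * c 2,
      a 2 ^ 2 + b 2 ^ 2 + c 2 ^ 2 + b 2 * c 2 + a 2 * b 2 + a 2 * c 2]

def B2 (a b : Point) : Fin 4 → ℝ :=
  (1 / 24 : ℝ) •
    ![4 * (a 0 * (2 * a 2 + b 2) + b 0 * (a 2 + 2 * b 2)),
      (a 2 + b 2) * (a 0 + b 0) ^ 2 + 2 * a 0 ^ 2 * a 2 + 2 * b 0 ^ 2 * b 2,
      2 * ((a 0 + b 0) * (a 1 + b 1) * (a 2 + b 2) + 2 * a 0 * a 1 * a 2 + 2 * b 0 * b 1 * b 2),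
      (a 2 + b 2) ^ 2 * (a 0 + b 0) + 2 * a 0 * a 2 ^ 2 + 2 * b 0 * b 2 ^ 2]

def theta (w : ℝ) : ℝ :=
  if w < 1 then Real.arctan ((1 - w) / √(1 - w ^ 2)) * (1 / √(1 - w ^ 2))
  else Real.artanh ((w - 1) / √(w ^ 2 - 1)) * (1 / √(w ^ 2 - 1))

def lambda (w : ℝ) : ℝ := 1 / ((w - 1) * (w + 1))

def matC (a b c : Point) : Matrix (Fin 4) (Fin 6) ℝ :=
  !![a 0 + b 0, c 0, 0, 0, 0, 0;
     0, 0, (a 0 + b 0) ^ 2, a 0 ^ 2 + b 0 ^ 2, (a 0 + b 0) * c 0, c 0 ^ 2;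
     0, 0, 2 * (a 0 + b 0) * (a 1 + b 1), 2 * (a 0 * a 1 + b 0 * b 1),
       (a 0 + b 0) * c 1 + (a 1 + b 1) * c 0, 2 * c 0 * c 1;
     0, 0, 2 * (a 0 + b 0) * (a 2 + b 2), 2 * (a 0 * a 2 + b 0 * b 2),
       (a 0 + b 0) * c 2 + (a 2 + b 2) * c 0, 2 * c 0 * c 2]

def matK : Matrix (Fin 6) (Fin 6) ℝ :=
  !![1, -5 / 6, 0, 1 / 3, 0, 0;
     0, 2 / 3, -2, 1 / 3, 0, 0;
     -3 / 16, 23 / 96, -1 / 8, -1 / 8, 0, 1 / 24;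
     -1 / 8, 5 / 48, 1 / 8, -7 / 48, 0, 1 / 24;
     0, -1 / 3, 5 / 4, -3 / 8, 0, 1 / 12;
     0, 0, -1 / 4, 13 / 24, -1, 1 / 12]

def vecD (w : ℝ) : Fin 6 → ℝ :=
  ![0, w ^ 2, 0, w ^ 4, 0, w ^ 6] + theta w • ![w, 0, w ^ 3, 0, w ^ 5, 0]

def vecE (w : ℝ) : Fin 4 → ℝ := ![lambda w ^ 2, lambda w ^ 3, lambda w ^ 3, lambda w ^ 3]

def B3 (w : ℝ) (a b c : Point) : Fin 4 → ℝ :=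
  Matrix.diagonal (vecE w) *ᵥ ((matC a b c * matK) *ᵥ vecD w)

/-! ### The three contributions -/

namespace ClippedEdges

variable {α β : ℝ} {P : Polyhedron}

/-- The first contribution of the `i`-th face. -/
def M1 (E : ClippedEdges α β P) (i : Fin P.numFaces) : Fin 4 → ℝ :=
  ∑ j, areaXY (E.edge i j).source (E.edge i j).target (E.refPoint i) •
    B1 (E.edge i j).source (E.edge i j).target (E.refPoint i)

/-- The second contribution of the `i`-th face. -/
def M2 (E : ClippedEdges α β P) (i : Fin P.numFaces) : Fin 4 → ℝ :=
  ∑ j, ((E.edge i j).indicator * ((E.edge i j).source 1 - (E.edge i j).target 1)) •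
    B2 (E.edge i j).source (E.edge i j).target

/-- The third contribution of the `i`-th face. -/
def M3 (E : ClippedEdges α β P) (i : Fin P.numFaces) : Fin 4 → ℝ :=
  ∑ j, (-(E.edge i j).indicator *
      areaYZ (E.edge i j).source (E.edge i j).target (E.edge i j).control) •
    B3 (E.edge i j).weight (E.edge i j).source (E.edge i j).target (E.edge i j).control

/-- The sum over all faces of the three contributions. -/
def total (E : ClippedEdges α β P) : Fin 4 → ℝ := ∑ i, (E.M1 i + E.M2 i + E.M3 i)

end ClippedEdges

/-! ### Splitting by the `xy`-plane -/

/-- The rotation by 180 degrees about the `x`-axis. -/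
def rotX (p : Point) : Point := ![p 0, -p 1, -p 2]

/-- The effect of the inverse rotation on a vector of volume and first moments. -/
def rotMoments (m : Fin 4 → ℝ) : Fin 4 → ℝ := ![m 0, m 1, -m 2, -m 3]

/-- The part of a solid above the `xy`-plane (without lower-dimensional remnants). -/
def topHalf (s : Set Point) : Set Point := closure (interior (s ∩ {p | 0 ≤ p 2}))

/-- The part of a solid below the `xy`-plane (without lower-dimensional remnants). -/
def bottomHalf (s : Set Point) : Set Point := closure (interior (s ∩ {p | p 2 ≤ 0}))

end

end CylinderClip

open CylinderClip

namespace CylinderClip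

open Filter Set

/-! ### Step functions on the line -/

/-! Integrate first in `z`, then in `x`, and end with line integrals in `dy`. On almost every
vertical line the indicator of the solid is a step function that jumps at faces, and the sign of the
`z`-component of the normal tells exit from entry. Since the solid lies in `z ≥ 0`, clipping by the
cylinder truncates the line at the height of the upper sheet. So the moments are signed integrals of
a `z`-primitive over the shadows of the clipped faces, plus one integral over the shadow of the
clipped surface (`integral_vertical`, `moments_eq`).

The shadow of a non-vertical face is treated by Green's theorem (`IsPlanarBoundary.green`). Its
boundary is only known as a finite family of curves with finitely many bad points, so Green's
theorem is proved by slicing: for all but finitely many heights the slice of the region is a step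
function whose jumps are the level points of the curves, and the area formula
(`integrable_levelSum_and_integral`) turns the integral over the heights into a line integral.
Applied to both orders of a mixed second derivative, it also shows that the edges form closed chains
(`sum_endpoints`), which makes the reference point drop out of the first contribution.

The clipped surface is treated by the same slicing. The rulings of the cylinder are parallel to the
`x`-axis, so at a fixed `y` the shadow is the trace of the solid on a single line. The faces crossed
by this line are crossed exactly at the points of the marked edges at that level, with a sign forced
by the orientation of the edges (`sign_deriv_curve`, `surfaceLevelSum_eq`,
`integral_surfaceShadow`).

Each face is thus left with the integral of `psiF` over all its edges minus the integral of `psiR`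
over the marked ones. Along chords the integrands are cubic, which gives the first two
contributions. The rest lives on the lens between an arc and its chord. In barycentric coordinates
of source, target and control point all three coordinates are affine, so Green's theorem on the lens
(`IsLensSide.integral_bary`) leaves six moments; these are integrals of rational functions with
powers of one quadratic as denominators, and Hermite reduction (`integral_div_bezierDen`) makes
`theta` the only transcendental term. `B3_eq` and `M_eq` collect the result. On a vertical face `x`
and `y` are affinely dependent, and the same lens formula results.

For conic arcs the control point is the pole of the chord, and the weight is fixed by the equation
of the cylinder. For general polyhedra, planes are null sets and the rotation preserves volume. -/

/-- The step function with jump `-σ j` at `b j`, vanishing near `+∞`. -/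
noncomputable def stepSum {ι : Type*} (J : Finset ι) (b σ : ι → ℝ) (x : ℝ) : ℝ :=
  ∑ j ∈ J, if x < b j then σ j else 0

/-- The strict inequality in `stepSum` makes it right continuous, so the left limit also collects
the jumps sitting exactly at `x`. -/
theorem stepSum_left {ι : Type*} (J : Finset ι) (b σ : ι → ℝ) (x : ℝ) :
    ∀ᶠ y in 𝓝[<] x, stepSum J b σ y = ∑ j ∈ J, if x ≤ b j then σ j else 0 := by
  have h : ∀ j ∈ J, ∀ᶠ y in 𝓝[<] x, (y < b j ↔ x ≤ b j) := by
    intro j _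
    rcases le_or_gt x (b j) with hx | hx
    · filter_upwards [self_mem_nhdsWithin] with y hy
      exact ⟨fun _ => hx, fun _ => lt_of_lt_of_le hy hx⟩
    · filter_upwards [mem_nhdsWithin_of_mem_nhds (Ioi_mem_nhds hx)] with y hy
      exact ⟨fun h => absurd h (not_lt.2 (le_of_lt hy)), fun h => absurd h (not_le.2 hx)⟩
  filter_upwards [(Filter.eventually_all_finset J).2 h] with y hy
  exact Finset.sum_congr rfl fun j hj => by simp only [hy j hj]

theorem stepSum_right {ι : Type*} (J : Finset ι) (b σ : ι → ℝ) (x : ℝ) :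
    ∀ᶠ y in 𝓝[>] x, stepSum J b σ y = stepSum J b σ x := by
  have h : ∀ j ∈ J, ∀ᶠ y in 𝓝[>] x, (y < b j ↔ x < b j) := by
    intro j _
    rcases lt_or_ge x (b j) with hx | hx
    · filter_upwards [mem_nhdsWithin_of_mem_nhds (Iio_mem_nhds hx)] with y hy
      exact ⟨fun _ => hx, fun _ => hy⟩
    · filter_upwards [self_mem_nhdsWithin] with y hy
      exact ⟨fun h => absurd h (not_lt.2 (hx.trans (le_of_lt hy))), fun h => absurd h (not_lt.2 hx)⟩
  filter_upwards [(Filter.eventually_all_finset J).2 h] with y hy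
  exact Finset.sum_congr rfl fun j hj => by simp only [hy j hj]

/-- A function with finitely many jumps which vanishes near `+∞` is a sum of step functions. -/
theorem eq_stepSum {ι : Type*} (J : Finset ι) (b σ : ι → ℝ) (χ : ℝ → ℝ)
    (hinj : Set.InjOn b J) (htop : ∀ᶠ x in atTop, χ x = 0)
    (hloc : ∀ x, x ∉ b '' J → ∀ᶠ y in 𝓝 x, χ y = χ x)
    (hjump : ∀ j ∈ J, ∃ l r, (∀ᶠ y in 𝓝[<] b j, χ y = l) ∧ (∀ᶠ y in 𝓝[>] b j, χ y = r) ∧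
      σ j = l - r) {x : ℝ} (hx : x ∉ b '' J) :
    χ x = stepSum J b σ x := by
  classical
  have hsplit : ∀ x, (∑ j ∈ J, if x ≤ b j then σ j else 0) =
      stepSum J b σ x + ∑ j ∈ J, if b j = x then σ j else 0 := by
    intro x
    rw [stepSum, ← Finset.sum_add_distrib]
    refine Finset.sum_congr rfl fun j _ => ?_
    rcases lt_trichotomy x (b j) with h | h | h
    · simp [h, h.le, h.ne']
    · simp [h]
    · simp [h.not_ge, h.not_gt, h.ne]
  have hloc' : ∀ x, x ∉ b '' J → ∀ᶠ y in 𝓝[≠] x, χ y - stepSum J b σ y = χ x - stepSum J b σ x := by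
    intro x hx
    rw [← nhdsLT_sup_nhdsGT, eventually_sup]
    have h0 : ∑ j ∈ J, (if b j = x then σ j else 0) = 0 :=
      Finset.sum_eq_zero fun j hj => if_neg fun h => hx ⟨j, hj, h⟩
    constructor
    · filter_upwards [stepSum_left J b σ x, mem_nhdsWithin_of_mem_nhds (hloc x hx)] with y h1 h2
      rw [h1, h2, hsplit, h0, add_zero]
    · filter_upwards [stepSum_right J b σ x, mem_nhdsWithin_of_mem_nhds (hloc x hx)] with y h1 h2
      rw [h1, h2]
  -- The difference of `χ` and the step sum has a punctured limit everywhere: at `b j` the two jumps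
  -- cancel. These limits form a locally constant, hence constant, function on the line, and near
  -- `+∞` they vanish.
  have hc : ∀ x, ∃ c, ∀ᶠ y in 𝓝[≠] x, χ y - stepSum J b σ y = c := by
    intro x
    by_cases hx : x ∈ b '' J
    · obtain ⟨j, hj, rfl⟩ := hx
      obtain ⟨l, r, hl, hr, hσ⟩ := hjump j hj
      refine ⟨r - stepSum J b σ (b j), ?_⟩
      rw [← nhdsLT_sup_nhdsGT, eventually_sup]
      -- Injectivity of `b` ensures that `σ j` is the whole jump at this point.
      have h0 : ∑ k ∈ J, (if b k = b j then σ k else 0) = σ j := by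
        rw [Finset.sum_eq_single j]
        · simp
        · intro k hk hkj
          exact if_neg fun h => hkj (hinj hk hj h)
        · exact fun h => absurd hj h
      constructor
      · filter_upwards [stepSum_left J b σ (b j), hl] with y h1 h2
        rw [h1, h2, hsplit, h0, hσ]; ring
      · filter_upwards [stepSum_right J b σ (b j), hr] with y h1 h2
        rw [h1, h2]
    · exact ⟨_, hloc' x hx⟩
  choose c hc using hc
  have hlc : IsLocallyConstant c := by
    rw [IsLocallyConstant.iff_eventually_eq]
    intro x
    obtain ⟨U, hU, hxU, hUc⟩ := mem_nhds_iff.1 (eventually_nhdsWithin_iff.1 (hc x))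
    filter_upwards [hxU.mem_nhds hUc] with y hy
    by_cases hyx : y = x
    · rw [hyx]
    · have h1 : ∀ᶠ z in 𝓝[≠] y, χ z - stepSum J b σ z = c x := by
        refine mem_nhdsWithin_of_mem_nhds ?_
        filter_upwards [hxU.mem_nhds hy, isOpen_ne.mem_nhds hyx] with z hz hzx
        exact hU hz hzx
      obtain ⟨z, hz1, hz2⟩ := ((hc y).and h1).exists
      exact hz1.symm.trans hz2
  have hzero : ∃ x, c x = 0 := by
    obtain ⟨M, hM⟩ := eventually_atTop.1 htop
    have hJ : ∀ᶠ x in atTop, ∀ j ∈ J, ¬ x < b j :=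
      (Filter.eventually_all_finset J).2 fun j _ =>
        (eventually_ge_atTop (b j)).mono fun x hx => not_lt.2 hx
    obtain ⟨N, hN⟩ := eventually_atTop.1 hJ
    refine ⟨max M N + 1, ?_⟩
    have h1 : ∀ᶠ z in 𝓝[≠] (max M N + 1), χ z - stepSum J b σ z = 0 := by
      refine mem_nhdsWithin_of_mem_nhds ?_
      filter_upwards [Ioi_mem_nhds (show max M N < max M N + 1 by linarith)] with z hz
      have hz' : max M N ≤ z := le_of_lt hz
      rw [hM z ((le_max_left _ _).trans hz'), stepSum, Finset.sum_eq_zero, sub_zero]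
      exact fun j hj => if_neg (hN z ((le_max_right _ _).trans hz') j hj)
    obtain ⟨z, hz1, hz2⟩ := ((hc _).and h1).exists
    exact hz1.symm.trans hz2
  obtain ⟨x₀, hx₀⟩ := hzero
  have hcx : c x = 0 := (hlc.apply_eq_of_preconnectedSpace x x₀).trans hx₀
  obtain ⟨z, hz1, hz2⟩ := ((hc x).and (hloc' x hx)).exists
  have := hz2.symm.trans (hz1.trans hcx)
  linarith

/-- Far to the left every condition `x < b j` holds, so the step sum there is the total of the
jumps, while `χ` is zero. -/
theorem sum_jumps_eq_zero {ι : Type*} (J : Finset ι) (b σ : ι → ℝ) (χ : ℝ → ℝ)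
    (hbot : ∀ᶠ x in atBot, χ x = 0)
    (h : ∀ x, x ∉ b '' J → χ x = stepSum J b σ x) : ∑ j ∈ J, σ j = 0 := by
  have hJ : ∀ᶠ x in atBot, ∀ j ∈ J, x < b j :=
    (Filter.eventually_all_finset J).2 fun j _ => eventually_lt_atBot (b j)
  obtain ⟨x, hx, hxJ⟩ := (hbot.and hJ).exists
  rw [h x (by rintro ⟨j, hj, hjx⟩; exact absurd hjx (hxJ j hj).ne'), stepSum] at hx
  rw [← hx]
  exact Finset.sum_congr rfl fun j hj => (if_pos (hxJ j hj)).symm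

variable {E : Type*} [NormedAddCommGroup E] [NormedSpace ℝ E] [CompleteSpace E]

/-- Integration of a derivative against a function with finitely many jumps. -/
theorem integral_smul_of_eq_stepSum {ι : Type*} (J : Finset ι) (b σ : ι → ℝ) (χ : ℝ → ℝ)
    (hσ : ∑ j ∈ J, σ j = 0) (h : ∀ x, x ∉ b '' J → χ x = stepSum J b σ x)
    {a c : ℝ} (hb : ∀ j ∈ J, b j ∈ Icc a c) (hac : a ≤ c) {F f : ℝ → E}
    (hF : ∀ x ∈ Icc a c, HasDerivAt F (f x) x) (hf : ContinuousOn f (Icc a c)) :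
    ∫ x in a..c, χ x • f x = ∑ j ∈ J, σ j • F (b j) := by
  -- Each step is handled by the fundamental theorem of calculus on `[a, b j]`; the terms with `F a`
  -- disappear later because the jumps sum to zero.
  have hint : ∀ j ∈ J, ∫ x in a..c, (if x < b j then σ j else 0) • f x =
      σ j • (F (b j) - F a) := by
    intro j hj
    have hsub : Icc a (b j) ⊆ Icc a c := Icc_subset_Icc_right (hb j hj).2
    rw [← intervalIntegral.integral_eq_sub_of_hasDerivAt (f := F) (f' := f),
      ← intervalIntegral.integral_smul, intervalIntegral.integral_of_le hac,
      intervalIntegral.integral_of_le (hb j hj).1]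
    · have : ∀ x, (if x < b j then σ j else 0) • f x = (Iio (b j)).indicator (σ j • f) x := by
        intro x
        by_cases hx : x < b j <;> simp [hx]
      simp only [this]
      have hset : Ioc a c ∩ Iio (b j) = Ioo a (b j) := by
        ext x
        simp only [mem_inter_iff, mem_Ioc, mem_Iio, mem_Ioo]
        exact ⟨fun hx => ⟨hx.1.1, hx.2⟩, fun hx => ⟨⟨hx.1, hx.2.le.trans (hb j hj).2⟩, hx.2⟩⟩
      rw [setIntegral_indicator measurableSet_Iio, hset, integral_Ioc_eq_integral_Ioo]; rfl
    · rw [uIcc_of_le (hb j hj).1]; exact fun x hx => hF x (hsub hx)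
    · exact (hf.mono (by rw [uIcc_of_le (hb j hj).1]; exact hsub)).intervalIntegrable
  have hfi : IntervalIntegrable f volume a c :=
    (hf.mono (by rw [uIcc_of_le hac])).intervalIntegrable
  calc ∫ x in a..c, χ x • f x
      = ∫ x in a..c, ∑ j ∈ J, (if x < b j then σ j else 0) • f x := by
        refine intervalIntegral.integral_congr_ae ?_
        have hfin : (b '' (J : Set ι)).Finite := J.finite_toSet.image b
        filter_upwards [hfin.countable.ae_notMem volume] with x hx _
        rw [h x hx, stepSum, Finset.sum_smul]
    _ = ∑ j ∈ J, ∫ x in a..c, (if x < b j then σ j else 0) • f x := by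
        refine intervalIntegral.integral_finsetSum fun j _ => ?_
        have : ∀ x, (if x < b j then σ j else 0) • f x = (Iio (b j)).indicator (σ j • f) x := by
          intro x
          by_cases hx : x < b j <;> simp [hx]
        simp only [this]
        rw [intervalIntegrable_iff_integrableOn_Ioc_of_le hac] at hfi ⊢
        exact (hfi.smul (σ j)).indicator measurableSet_Iio
    _ = ∑ j ∈ J, σ j • (F (b j) - F a) := Finset.sum_congr rfl hint
    _ = _ := by
        simp only [smul_sub, Finset.sum_sub_distrib, ← Finset.sum_smul, hσ, zero_smul, sub_zero]

/-- Zero total jump makes `χ` vanish outside any interval containing all jump points, so the bounded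
version applies. -/
theorem integral_univ_smul_of_eq_stepSum {ι : Type*} (J : Finset ι) (b σ : ι → ℝ) (χ : ℝ → ℝ)
    (hσ : ∑ j ∈ J, σ j = 0) (h : ∀ x, x ∉ b '' J → χ x = stepSum J b σ x) {F f : ℝ → E}
    (hF : ∀ x, HasDerivAt F (f x) x) (hf : Continuous f) :
    ∫ x, χ x • f x = ∑ j ∈ J, σ j • F (b j) := by
  obtain ⟨N, hN⟩ := (J.finite_toSet.image b).isBounded.exists_norm_le
  have hN' : ∀ j ∈ J, -N ≤ b j ∧ b j ≤ N := fun j hj => abs_le.1 (hN _ ⟨j, hj, rfl⟩)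
  -- For empty `J` the bound `N` may be negative; the maximum keeps the interval `[-A, A]`
  -- legitimate.
  set A := max N 0 with hA
  have hNA : N ≤ A := le_max_left _ _
  have hA0 : 0 ≤ A := le_max_right _ _
  rw [← integral_smul_of_eq_stepSum J b σ χ hσ h (a := -A) (c := A)
    (fun j hj => ⟨by linarith [(hN' j hj).1], by linarith [(hN' j hj).2]⟩) (by linarith)
    (fun x _ => hF x) hf.continuousOn, intervalIntegral.integral_of_le (by linarith),
    integral_Ioc_eq_integral_Ioo, ← integral_Icc_eq_integral_Ioo]
  refine (setIntegral_eq_integral_of_forall_compl_eq_zero fun x hx => ?_).symm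
  have hx' : x < -A ∨ A < x := by
    by_contra hcon
    rw [not_or, not_lt, not_lt] at hcon
    exact hx hcon
  have hxb : x ∉ b '' (J : Set ι) := by
    rintro ⟨j, hj, rfl⟩
    have := hN' j hj
    rcases hx' with h' | h' <;> linarith
  rw [h x hxb, stepSum]
  rcases hx' with h' | h'
  · rw [Finset.sum_congr rfl fun j hj => if_pos (show x < b j by linarith [(hN' j hj).1]), hσ,
      zero_smul]
  · rw [Finset.sum_eq_zero fun j hj => if_neg (show ¬ x < b j by
      rw [not_lt]; linarith [(hN' j hj).2]), zero_smul]

end CylinderClip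

namespace CylinderClip

open Filter Set

variable {E : Type*} [NormedAddCommGroup E] [NormedSpace ℝ E] [CompleteSpace E]

/-! ### The area formula for a function of one variable -/

/-- A `C¹` function on `[0, 1]` almost all of whose level sets are finite and regular. -/
structure Tame (u : ℝ → ℝ) : Prop where
  hasDerivAt : ∀ t ∈ Icc (0 : ℝ) 1, HasDerivAt u (deriv u t) t
  continuousOn_deriv : ContinuousOn (deriv u) (Icc 0 1)
  regular : ∀ᶠ v in cofinite, {t | t ∈ Icc (0 : ℝ) 1 ∧ u t = v}.Finite ∧
    ∀ t ∈ Icc (0 : ℝ) 1, u t = v → deriv u t ≠ 0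

/-- The signed sum of `G` over a level set of `u`. -/
noncomputable def levelSum (u : ℝ → ℝ) (G : ℝ → E) (v : ℝ) : E :=
  ∑ᶠ t ∈ {t | t ∈ Icc (0 : ℝ) 1 ∧ u t = v}, Real.sign (deriv u t) • G t

theorem eventually_lt_of_deriv_pos {u : ℝ → ℝ} {t : ℝ} (h : 0 < deriv u t) :
    (∀ᶠ s in 𝓝[<] t, u s < u t) ∧ ∀ᶠ s in 𝓝[>] t, u t < u s := by
  have hd : deriv (fun s => u s - u t) t = deriv u t := by simp
  have key := eventually_nhdsWithin_sign_eq_of_deriv_pos (f := fun s => u s - u t) (x₀ := t)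
    (by rw [hd]; exact h) (sub_self _)
  constructor
  · filter_upwards [mem_nhdsWithin_of_mem_nhds key, self_mem_nhdsWithin] with s hs hst
    have hst' : s - t < 0 := sub_neg.2 hst
    rw [sign_neg hst'] at hs
    exact sub_neg.1 (sign_eq_neg_one_iff.1 hs)
  · filter_upwards [mem_nhdsWithin_of_mem_nhds key, self_mem_nhdsWithin] with s hs hst
    have hst' : 0 < s - t := sub_pos.2 hst
    rw [sign_pos hst'] at hs
    exact sub_pos.1 (sign_eq_one_iff.1 hs)

theorem eventually_lt_of_deriv_neg {u : ℝ → ℝ} {t : ℝ} (h : deriv u t < 0) :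
    (∀ᶠ s in 𝓝[<] t, u t < u s) ∧ ∀ᶠ s in 𝓝[>] t, u s < u t := by
  have := eventually_lt_of_deriv_pos (u := fun s => -u s) (t := t) (by simpa using h)
  simpa using this

/-- The indicator of `{u > v}` on `[0, 1]` is a step function whose interior jumps are the level
points, with direction the sign of `u'`. Integrating it against `G'` gives minus the level sum,
corrected by the jumps at the end-points. -/
theorem levelSum_eq {u : ℝ → ℝ} (hu : Tame u) {G G' : ℝ → E}
    (hG : ∀ t ∈ Icc (0 : ℝ) 1, HasDerivAt G (G' t) t) (hG' : ContinuousOn G' (Icc 0 1)) {v : ℝ}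
    (hfin : {t | t ∈ Icc (0 : ℝ) 1 ∧ u t = v}.Finite)
    (hreg : ∀ t ∈ Icc (0 : ℝ) 1, u t = v → deriv u t ≠ 0) (h0 : u 0 ≠ v) (h1 : u 1 ≠ v) :
    levelSum u G v = (if v < u 1 then G 1 else 0) - (if v < u 0 then G 0 else 0) -
      ∫ t in (0 : ℝ)..1, (if v < u t then (1 : ℝ) else 0) • G' t := by
  classical
  set L := hfin.toFinset with hL
  have hmem : ∀ t, t ∈ L ↔ t ∈ Icc (0 : ℝ) 1 ∧ u t = v := fun t => by simp [hL]
  set J : Finset ℝ := insert 0 (insert 1 L) with hJ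
  have h0L : (0 : ℝ) ∉ L := fun h => h0 ((hmem 0).1 h).2
  have h1L : (1 : ℝ) ∉ L := fun h => h1 ((hmem 1).1 h).2
  have h01 : (0 : ℝ) ∉ insert 1 L := by simp [h0L]
  set χ : ℝ → ℝ := fun t => if t ∈ Icc (0 : ℝ) 1 ∧ v < u t then 1 else 0 with hχ
  -- The convention is left value minus right value, hence the sign at `0` and the minus before the
  -- sign of the derivative.
  set σ : ℝ → ℝ := fun t => if t = 0 then -(if v < u 0 then 1 else 0)
    else if t = 1 then (if v < u 1 then 1 else 0) else -Real.sign (deriv u t) with hσ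
  have hcont : ∀ t ∈ Icc (0 : ℝ) 1, ContinuousAt u t := fun t ht =>
    (hu.hasDerivAt t ht).continuousAt
  have hlt : ∀ t ∈ Icc (0 : ℝ) 1, u t ≠ v → ∀ᶠ s in 𝓝 t, (v < u s ↔ v < u t) := by
    intro t ht hne
    rcases lt_or_gt_of_ne hne with h | h
    · filter_upwards [(hcont t ht).eventually_lt continuousAt_const h] with s hs
      exact ⟨fun h' => absurd hs h'.not_gt, fun h' => absurd h h'.not_gt⟩
    · filter_upwards [continuousAt_const.eventually_lt (hcont t ht) h] with s hs
      exact ⟨fun _ => h, fun _ => hs⟩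
  have m0 : (0 : ℝ) ∈ Icc (0 : ℝ) 1 := ⟨le_rfl, zero_le_one⟩
  have m1 : (1 : ℝ) ∈ Icc (0 : ℝ) 1 := ⟨zero_le_one, le_rfl⟩
  have hIoo : ∀ t ∈ Ioo (0 : ℝ) 1, ∀ᶠ s in 𝓝 t, s ∈ Icc (0 : ℝ) 1 := fun t ht =>
    Icc_mem_nhds ht.1 ht.2
  have hstep : ∀ x, x ∉ id '' (J : Set ℝ) → χ x = stepSum J id σ x := by
    intro x hx
    refine eq_stepSum J id σ χ Function.injective_id.injOn ?_ ?_ ?_ hx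
    · filter_upwards [eventually_gt_atTop 1] with t ht
      exact if_neg fun h => absurd ht h.1.2.not_gt
    · intro t ht
      simp only [image_id, Finset.mem_coe, hJ, Finset.mem_insert, not_or] at ht
      rcases lt_or_gt_of_ne ht.1 with h | h
      · filter_upwards [Iio_mem_nhds h] with s hs
        rw [hχ]; simp only
        rw [if_neg fun h' => absurd hs h'.1.1.not_gt, if_neg fun h' => absurd h h'.1.1.not_gt]
      · rcases lt_or_gt_of_ne ht.2.1 with h' | h'
        · have hI : t ∈ Icc (0 : ℝ) 1 := ⟨h.le, h'.le⟩
          have hne : u t ≠ v := fun e => ht.2.2 ((hmem t).2 ⟨hI, e⟩)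
          filter_upwards [hlt t hI hne, hIoo t ⟨h, h'⟩] with s hs1 hs2
          simp only [hχ, hs1, hs2, hI, true_and]
        · filter_upwards [Ioi_mem_nhds h'] with s hs
          rw [hχ]; simp only
          rw [if_neg fun h'' => absurd hs h''.1.2.not_gt,
            if_neg fun h'' => absurd h' h''.1.2.not_gt]
    · intro t ht
      simp only [hJ, Finset.mem_insert] at ht
      simp only [id]
      rcases ht with rfl | rfl | ht
      · refine ⟨0, if v < u 0 then 1 else 0, ?_, ?_, by simp [hσ]⟩
        · filter_upwards [self_mem_nhdsWithin] with s hs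
          exact if_neg fun h => absurd hs h.1.1.not_gt
        · filter_upwards [self_mem_nhdsWithin, mem_nhdsWithin_of_mem_nhds (hlt 0 m0 h0),
            mem_nhdsWithin_of_mem_nhds (Iio_mem_nhds zero_lt_one)] with s hs1 hs2 hs3
          have : s ∈ Icc (0 : ℝ) 1 := ⟨le_of_lt hs1, le_of_lt hs3⟩
          simp only [hχ, this, hs2, true_and]
      · refine ⟨if v < u 1 then 1 else 0, 0, ?_, ?_, by simp [hσ]⟩
        · filter_upwards [self_mem_nhdsWithin, mem_nhdsWithin_of_mem_nhds (hlt 1 m1 h1),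
            mem_nhdsWithin_of_mem_nhds (Ioi_mem_nhds zero_lt_one)] with s hs1 hs2 hs3
          have : s ∈ Icc (0 : ℝ) 1 := ⟨le_of_lt hs3, le_of_lt hs1⟩
          simp only [hχ, this, hs2, true_and]
        · filter_upwards [self_mem_nhdsWithin] with s hs
          exact if_neg fun h => absurd hs h.1.2.not_gt
      · have ht0 : t ≠ 0 := fun h => h0L (h ▸ ht)
        have ht1 : t ≠ 1 := fun h => h1L (h ▸ ht)
        obtain ⟨htI, htv⟩ := (hmem t).1 ht
        have htO : t ∈ Ioo (0 : ℝ) 1 := ⟨lt_of_le_of_ne htI.1 ht0.symm, lt_of_le_of_ne htI.2 ht1⟩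
        have hσt : σ t = -Real.sign (deriv u t) := by simp [hσ, ht0, ht1]
        rcases lt_or_gt_of_ne (hreg t htI htv) with hd | hd
        · obtain ⟨hl, hr⟩ := eventually_lt_of_deriv_neg hd
          refine ⟨1, 0, ?_, ?_, by rw [hσt, Real.sign_of_neg hd]; norm_num⟩
          · filter_upwards [hl, mem_nhdsWithin_of_mem_nhds (hIoo t htO)] with s hs1 hs2
            exact if_pos ⟨hs2, htv ▸ hs1⟩
          · filter_upwards [hr] with s hs1
            exact if_neg fun h => absurd h.2 (htv ▸ hs1.le).not_gt
        · obtain ⟨hl, hr⟩ := eventually_lt_of_deriv_pos hd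
          refine ⟨0, 1, ?_, ?_, by rw [hσt, Real.sign_of_pos hd]; norm_num⟩
          · filter_upwards [hl] with s hs1
            exact if_neg fun h => absurd h.2 (htv ▸ hs1.le).not_gt
          · filter_upwards [hr, mem_nhdsWithin_of_mem_nhds (hIoo t htO)] with s hs1 hs2
            exact if_pos ⟨hs2, htv ▸ hs1⟩
  have hsum := sum_jumps_eq_zero J id σ χ (by
    filter_upwards [eventually_lt_atBot 0] with t ht
    exact if_neg fun h => absurd ht h.1.1.not_gt) hstep
  have key := integral_smul_of_eq_stepSum J id σ χ hsum hstep (a := 0) (c := 1) (by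
    intro t ht
    simp only [hJ, Finset.mem_insert] at ht
    rcases ht with rfl | rfl | ht
    · exact m0
    · exact m1
    · exact ((hmem t).1 ht).1) zero_le_one hG hG'
  have hLσ : ∑ t ∈ L, σ t • G t = -levelSum u G v := by
    rw [levelSum, finsum_mem_eq_finite_toFinset_sum _ hfin, ← Finset.sum_neg_distrib]
    refine Finset.sum_congr rfl fun t ht => ?_
    have ht0 : t ≠ 0 := fun h => h0L (h ▸ ht)
    have ht1 : t ≠ 1 := fun h => h1L (h ▸ ht)
    simp [hσ, ht0, ht1]
  have hI : ∫ t in (0 : ℝ)..1, χ t • G' t =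
      ∫ t in (0 : ℝ)..1, (if v < u t then (1 : ℝ) else 0) • G' t := by
    refine intervalIntegral.integral_congr fun t ht => ?_
    rw [uIcc_of_le zero_le_one] at ht
    simp only [hχ, ht, true_and]
  rw [hI, hJ, Finset.sum_insert h01, Finset.sum_insert h1L] at key
  simp only [id] at key
  rw [hLσ] at key
  have e0 : σ 0 • G 0 = -(if v < u 0 then G 0 else 0) := by
    by_cases h : v < u 0 <;> simp [hσ, h]
  have e1 : σ 1 • G 1 = (if v < u 1 then G 1 else 0) := by
    by_cases h : v < u 1 <;> simp [hσ, h]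
  rw [key, e0, e1]
  abel

/-- The area formula. -/
theorem integrable_levelSum_and_integral {u : ℝ → ℝ} (hu : Tame u) {G G' : ℝ → E}
    (hG : ∀ t ∈ Icc (0 : ℝ) 1, HasDerivAt G (G' t) t) (hG' : ContinuousOn G' (Icc 0 1)) :
    Integrable (levelSum u G) ∧
      ∫ v, levelSum u G v = ∫ t in (0 : ℝ)..1, deriv u t • G t := by
  classical
  have m0 : (0 : ℝ) ∈ Icc (0 : ℝ) 1 := ⟨le_rfl, zero_le_one⟩
  have m1 : (1 : ℝ) ∈ Icc (0 : ℝ) 1 := ⟨zero_le_one, le_rfl⟩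
  have hucont : ContinuousOn u (Icc 0 1) := fun t ht =>
    (hu.hasDerivAt t ht).continuousAt.continuousWithinAt
  have hGcont : ContinuousOn G (Icc 0 1) := fun t ht => (hG t ht).continuousAt.continuousWithinAt
  -- Constant extensions of `u` and `G'` are continuous on the whole line, which gives measurability
  -- on the product.
  set uc : ℝ → ℝ := IccExtend zero_le_one ((Icc (0 : ℝ) 1).domRestrict u) with huc
  set Gc : ℝ → E := IccExtend zero_le_one ((Icc (0 : ℝ) 1).domRestrict G') with hGc
  have hucc : Continuous uc := hucont.domRestrict.Icc_extend'
  have hGcc : Continuous Gc := hG'.domRestrict.Icc_extend'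
  have eu : ∀ t ∈ Icc (0 : ℝ) 1, uc t = u t := fun t ht => by
    rw [huc, IccExtend_of_mem _ _ ht]; rfl
  have eG : ∀ t ∈ Icc (0 : ℝ) 1, Gc t = G' t := fun t ht => by
    rw [hGc, IccExtend_of_mem _ _ ht]; rfl
  obtain ⟨B, hB⟩ := isCompact_Icc.exists_bound_of_continuousOn hucont
  obtain ⟨C, hC⟩ := isCompact_Icc.exists_bound_of_continuousOn hG'
  have hub : ∀ t ∈ Icc (0 : ℝ) 1, -(B + 1) < u t ∧ u t < B + 1 := fun t ht => by
    have := abs_le.1 (hB t ht)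
    constructor <;> linarith [this.1, this.2]
  set m := -(B + 1) with hm
  set M := B + 1 with hM
  have hmM : m ≤ M := ((hub 0 m0).1.trans (hub 0 m0).2).le
  set K : ℝ → E := fun v => ∫ t in (0 : ℝ)..1, (if v < u t then (1 : ℝ) else 0) • G' t with hK
  set D : ℝ → E := fun v => (if v < u 1 then G 1 else 0) - (if v < u 0 then G 0 else 0) - K v
    with hD
  have hae : ∀ᵐ v, levelSum u G v = (Ioc m M).indicator D v := by
    have hcof : ∀ᶠ v in cofinite, levelSum u G v = (Ioc m M).indicator D v := by
      filter_upwards [hu.regular, (finite_singleton (u 0)).compl_mem_cofinite,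
        (finite_singleton (u 1)).compl_mem_cofinite] with v hv h0 h1
      by_cases hvm : v ∈ Ioc m M
      · rw [indicator_of_mem hvm]
        exact levelSum_eq hu hG hG' hv.1 hv.2 (fun h => h0 h.symm) (fun h => h1 h.symm)
      · rw [indicator_of_notMem hvm, levelSum]
        have : {t | t ∈ Icc (0 : ℝ) 1 ∧ u t = v} = ∅ := by
          ext t
          simp only [mem_ofPred_eq, mem_empty_iff_false, iff_false]
          rintro ⟨ht, rfl⟩
          exact hvm ⟨(hub t ht).1, (hub t ht).2.le⟩
        rw [this, finsum_mem_empty]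
    exact (measure_mono_null (fun v hv => hv) (Set.Finite.measure_zero hcof volume) : _)
  set f : ℝ × ℝ → E := fun p => (if p.1 < uc p.2 then (1 : ℝ) else 0) • Gc p.2 with hf
  have hfint : Integrable f ((volume.restrict (Ioc m M)).prod (volume.restrict (Ioc 0 1))) := by
    have hfm : Measurable fun p : ℝ × ℝ => if p.1 < uc p.2 then (1 : ℝ) else 0 :=
      Measurable.ite (measurableSet_lt measurable_fst (hucc.measurable.comp measurable_snd))
        measurable_const measurable_const
    refine Integrable.of_bound (C := C) ?_ ?_
    · exact hfm.aestronglyMeasurable.smul (hGcc.comp continuous_snd).aestronglyMeasurable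
    · refine Eventually.of_forall fun p => ?_
      have : ‖Gc p.2‖ ≤ C := by
        rw [hGc]
        exact hC _ (projIcc (0 : ℝ) 1 zero_le_one p.2).2
      rw [hf]; simp only
      split_ifs
      · simpa using this
      · simpa using (norm_nonneg _).trans this
  have hKf : ∀ v, K v = ∫ t in Ioc (0 : ℝ) 1, f (v, t) := by
    intro v
    rw [hK]; simp only
    rw [intervalIntegral.integral_of_le zero_le_one]
    refine setIntegral_congr_fun measurableSet_Ioc fun t ht => ?_
    have ht' := Ioc_subset_Icc_self ht
    simp only [hf, eu t ht', eG t ht']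
  have hKint : IntegrableOn K (Ioc m M) := by
    have := hfint.integral_prod_left
    exact this.congr (Eventually.of_forall fun v => (hKf v).symm)
  have hstepint : ∀ (c : ℝ) (g : E), IntegrableOn (fun v => if v < c then g else 0) (Ioc m M) := by
    intro c g
    have : (fun v => if v < c then g else 0) = (Iio c).indicator fun _ => g := by
      ext v; simp [indicator_apply]
    rw [this]
    exact (integrable_const g).indicator measurableSet_Iio
  have hstepval : ∀ (c : ℝ) (g : E), m < c → c < M →
      ∫ v in Ioc m M, (if v < c then g else 0) = (c - m) • g := by
    intro c g h1 h2
    have : (fun v => if v < c then g else 0) = (Iio c).indicator fun _ => g := by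
      ext v; simp [indicator_apply]
    have hset : Ioc m M ∩ Iio c = Ioo m c := by
      ext x
      simp only [mem_inter_iff, mem_Ioc, mem_Iio, mem_Ioo]
      exact ⟨fun hx => ⟨hx.1.1, hx.2⟩, fun hx => ⟨⟨hx.1, hx.2.le.trans h2.le⟩, hx.2⟩⟩
    rw [this, setIntegral_indicator measurableSet_Iio, hset, setIntegral_const]
    simp [Measure.real, h1.le]
  have hDint : IntegrableOn D (Ioc m M) := ((hstepint _ _).sub (hstepint _ _)).sub hKint
  refine ⟨((integrable_indicator_iff measurableSet_Ioc).2 hDint).congr (by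
    filter_upwards [hae] with v hv using hv.symm), ?_⟩
  -- Fubini: for fixed `t` the heights `v` with `m < v < u t` form an interval of length `u t - m`.
  have hKval : ∫ v in Ioc m M, K v = ∫ t in (0 : ℝ)..1, (u t - m) • G' t := by
    calc ∫ v in Ioc m M, K v = ∫ v in Ioc m M, ∫ t in Ioc (0 : ℝ) 1, f (v, t) := by
          simp only [hKf]
      _ = ∫ t in Ioc (0 : ℝ) 1, ∫ v in Ioc m M, f (v, t) :=
          integral_integral_swap (f := fun v t => f (v, t)) hfint
      _ = ∫ t in Ioc (0 : ℝ) 1, (u t - m) • G' t := by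
          refine setIntegral_congr_fun measurableSet_Ioc fun t ht => ?_
          have ht' := Ioc_subset_Icc_self ht
          have : ∀ v, f (v, t) = if v < u t then G' t else 0 := fun v => by
            simp [hf, eu t ht', eG t ht']
          simp only [this]
          exact hstepval _ _ (hub t ht').1 (hub t ht').2
      _ = _ := (intervalIntegral.integral_of_le zero_le_one).symm
  -- Integration by parts; its boundary terms are the integrals of the two step terms in `D`.
  have hparts : ∫ t in (0 : ℝ)..1, (deriv u t • G t + (u t - m) • G' t) =
      (u 1 - m) • G 1 - (u 0 - m) • G 0 := by
    refine intervalIntegral.integral_eq_sub_of_hasDerivAt (f := fun t => (u t - m) • G t) ?_ ?_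
    · intro t ht
      rw [uIcc_of_le zero_le_one] at ht
      have := ((hu.hasDerivAt t ht).sub_const m).smul (hG t ht)
      rwa [add_comm] at this
    · refine ContinuousOn.intervalIntegrable ?_
      rw [uIcc_of_le zero_le_one]
      exact (hu.continuousOn_deriv.smul hGcont).add ((hucont.sub continuousOn_const).smul hG')
  rw [intervalIntegral.integral_add] at hparts
  rotate_left
  · refine ContinuousOn.intervalIntegrable ?_
    rw [uIcc_of_le zero_le_one]
    exact hu.continuousOn_deriv.smul hGcont
  · refine ContinuousOn.intervalIntegrable ?_
    rw [uIcc_of_le zero_le_one]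
    exact (hucont.sub continuousOn_const).smul hG'
  have h2 : IntegrableOn (fun v => (if v < u 1 then G 1 else 0) - (if v < u 0 then G 0 else 0))
    (Ioc m M) := (hstepint _ _).sub (hstepint _ _)
  have e1 := integral_sub (hstepint (u 1) (G 1)) (hstepint (u 0) (G 0))
  have e2 := integral_sub h2 hKint
  rw [integral_congr_ae hae, integral_indicator measurableSet_Ioc, hD, e2, e1,
    hstepval _ _ (hub 1 m1).1 (hub 1 m1).2, hstepval _ _ (hub 0 m0).1 (hub 0 m0).2, hKval,
    ← hparts]
  abel

end CylinderClip

namespace CylinderClip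

open Filter Set

variable {E : Type*} [NormedAddCommGroup E] [NormedSpace ℝ E] [CompleteSpace E]

/-! ### Green's theorem in the plane -/

/-- A set avoiding the frontier of `R` is covered by the disjoint open sets `R` and `(closure R)ᶜ`,
and a preconnected set lies in one of them. -/
theorem mem_iff_mem_of_preconnected {X : Type*} [TopologicalSpace X] {S R : Set X}
    (hS : IsPreconnected S) (hR : IsOpen R) (hd : Disjoint S (frontier R)) {x y : X} (hx : x ∈ S)
    (hy : y ∈ S) : x ∈ R ↔ y ∈ R := by
  have hsub : S ⊆ R ∪ (closure R)ᶜ := by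
    intro z hz
    by_cases h : z ∈ R
    · exact Or.inl h
    · refine Or.inr fun hc => (Set.disjoint_left.1 hd) hz ?_
      rw [hR.frontier_eq]; exact ⟨hc, h⟩
  have hdis : Disjoint R (closure R)ᶜ :=
    disjoint_compl_right.mono_left subset_closure
  constructor
  · exact fun h => hS.subset_left_of_subset_union hR isClosed_closure.isOpen_compl hdis hsub
      ⟨x, hx, h⟩ hy
  · exact fun h => hS.subset_left_of_subset_union hR isClosed_closure.isOpen_compl hdis hsub
      ⟨y, hy, h⟩ hx

/-- The curves `γ j` bound the open set `R` of the plane, which lies to their left if `ε = 1` and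
to their right if `ε = -1`. -/
structure IsPlanarBoundary (ε : ℝ) (R : Set (ℝ × ℝ)) {k : ℕ} (γ : Fin k → ℝ → ℝ × ℝ) : Prop where
  orientation : ε = 1 ∨ ε = -1
  isOpen : IsOpen R
  isBounded : Bornology.IsBounded R
  tame_fst : ∀ j, Tame fun t => (γ j t).1
  tame_snd : ∀ j, Tame fun t => (γ j t).2
  frontier_subset : frontier R ⊆ ⋃ j, γ j '' Icc 0 1
  finite_meet : {p | ∃ a b : Fin k × ℝ, a.2 ∈ Icc (0 : ℝ) 1 ∧ b.2 ∈ Icc (0 : ℝ) 1 ∧ a ≠ b ∧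
    γ a.1 a.2 = p ∧ γ b.1 b.2 = p}.Finite
  side : ∀ j, {t | t ∈ Icc (0 : ℝ) 1 ∧ ¬ ∃ u : ℝ × ℝ,
    0 < ε * (deriv (fun t => (γ j t).1) t * u.2 - deriv (fun t => (γ j t).2) t * u.1) ∧
    ∀ᶠ s in 𝓝[>] (0 : ℝ), γ j t + s • u ∈ R ∧ γ j t - s • u ∉ R}.Finite

namespace IsPlanarBoundary

variable {ε : ℝ} {R : Set (ℝ × ℝ)} {k : ℕ} {γ : Fin k → ℝ → ℝ × ℝ}

theorem hasDerivAt (h : IsPlanarBoundary ε R γ) (j : Fin k) {t : ℝ} (ht : t ∈ Icc (0 : ℝ) 1) :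
    HasDerivAt (γ j) (deriv (fun t => (γ j t).1) t, deriv (fun t => (γ j t).2) t) t :=
  ((h.tame_fst j).hasDerivAt t ht).prodMk ((h.tame_snd j).hasDerivAt t ht)

theorem continuousOn (h : IsPlanarBoundary ε R γ) (j : Fin k) : ContinuousOn (γ j) (Icc 0 1) :=
  fun _ ht => (h.hasDerivAt j ht).continuousAt.continuousWithinAt

/-- Close to a regular point, a cone transversal to the curve does not meet the curves. -/
theorem eventually_cone_avoids (h : IsPlanarBoundary ε R γ) {j : Fin k} {t₀ : ℝ}
    (ht₀ : t₀ ∈ Icc (0 : ℝ) 1)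
    (huniq : ∀ j' t', t' ∈ Icc (0 : ℝ) 1 → γ j' t' = γ j t₀ → j' = j ∧ t' = t₀)
    {η : ℝ} {u₀ u₁ : ℝ × ℝ}
    (hu₀ : 0 < η * (deriv (fun t => (γ j t).1) t₀ * u₀.2 - deriv (fun t => (γ j t).2) t₀ * u₀.1))
    (hu₁ : 0 < η * (deriv (fun t => (γ j t).1) t₀ * u₁.2 - deriv (fun t => (γ j t).2) t₀ * u₁.1)) :
    ∀ᶠ s in 𝓝[>] (0 : ℝ), ∀ θ ∈ Icc (0 : ℝ) 1,
      γ j t₀ + s • ((1 - θ) • u₀ + θ • u₁) ∉ ⋃ j, γ j '' Icc 0 1 := by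
  have hder := h.hasDerivAt j ht₀
  set dx := deriv (fun t => (γ j t).1) t₀
  set dy := deriv (fun t => (γ j t).2) t₀
  set p := γ j t₀
  -- A linear functional that vanishes on the tangent `d` and is at least `c > 0` on the whole cone
  -- spanned by `u₀` and `u₁`.
  set l : ℝ × ℝ → ℝ := fun v => η * (dx * v.2 - dy * v.1) with hl
  set d : ℝ × ℝ := (dx, dy) with hd
  have hd0 : 0 < ‖d‖ := by
    rw [norm_pos_iff]
    intro h0
    have h1 : dx = 0 := congrArg Prod.fst h0
    have h2 : dy = 0 := congrArg Prod.snd h0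
    rw [h1, h2] at hu₀
    simp at hu₀
  set L := |η| * (|dx| + |dy|) with hL
  have hLb : ∀ v, |l v| ≤ L * ‖v‖ := by
    intro v
    rw [hl, hL]; simp only
    rw [abs_mul, mul_assoc]
    refine mul_le_mul_of_nonneg_left ?_ (abs_nonneg _)
    calc |dx * v.2 - dy * v.1| ≤ |dx * v.2| + |dy * v.1| := abs_sub _ _
      _ = |dx| * ‖v.2‖ + |dy| * ‖v.1‖ := by rw [abs_mul, abs_mul]; rfl
      _ ≤ |dx| * ‖v‖ + |dy| * ‖v‖ := by
        gcongr
        · exact norm_snd_le v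
        · exact norm_fst_le v
      _ = _ := by ring
  have hL0 : 0 ≤ L := by positivity
  set c := min (l u₀) (l u₁) with hc
  have hc0 : 0 < c := lt_min hu₀ hu₁
  set U := ‖u₀‖ + ‖u₁‖ + 1 with hU
  have hU0 : 0 < U := by positivity
  -- The first bound controls the parameter shift by the distance from `p`; the second makes the
  -- final inequality strict.
  set κ := min (‖d‖ / 2) (c * ‖d‖ / (2 * (L * (2 * U) + 1))) with hκ
  have hκ0 : 0 < κ := lt_min (by positivity) (by positivity)
  have hκc : L * (2 * U) * κ < c * ‖d‖ := by
    have h1 : κ ≤ c * ‖d‖ / (2 * (L * (2 * U) + 1)) := min_le_right _ _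
    have h2 : 0 < c * ‖d‖ := by positivity
    have h3 : 0 ≤ L * (2 * U) := by positivity
    rw [le_div_iff₀ (by positivity)] at h1
    nlinarith
  obtain ⟨V, hV, hVo, hVt⟩ := mem_nhds_iff.1 (hder.isLittleO.def hκ0)
  -- All of the curves except the piece of `γ j` near `t₀`. It is compact and, by uniqueness, misses
  -- `p`, so only the near piece can meet the cone close to `p`.
  set K : Set (ℝ × ℝ) := ⋃ j', γ j' '' (Icc 0 1 ∩ (if j' = j then Vᶜ else univ)) with hK
  have hKc : IsCompact K := by
    refine isCompact_iUnion fun j' => ?_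
    have hcl : IsClosed (if j' = j then Vᶜ else univ) := by
      split_ifs
      · exact hVo.isClosed_compl
      · exact isClosed_univ
    exact (isCompact_Icc.inter_right hcl).image_of_continuousOn
      ((h.continuousOn j').mono inter_subset_left)
  have hpK : p ∉ K := by
    rintro hp
    obtain ⟨j', t', ⟨ht', hif⟩, he⟩ := mem_iUnion.1 hp
    obtain ⟨rfl, rfl⟩ := huniq j' t' ht' he
    simp only [if_true] at hif
    exact hif hVt
  obtain ⟨ρ, hρ, hρK⟩ := Metric.mem_nhds_iff.1 (hKc.isClosed.isOpen_compl.mem_nhds hpK)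
  filter_upwards [self_mem_nhdsWithin,
    mem_nhdsWithin_of_mem_nhds (Iio_mem_nhds (show 0 < ρ / U by positivity))] with s hs0 hsρ
  intro θ hθ hmem
  set w := (1 - θ) • u₀ + θ • u₁ with hw
  have hs0' : 0 < s := hs0
  have hwU : ‖w‖ ≤ U := by
    calc ‖w‖ ≤ ‖(1 - θ) • u₀‖ + ‖θ • u₁‖ := norm_add_le _ _
      _ = (1 - θ) * ‖u₀‖ + θ * ‖u₁‖ := by
        rw [norm_smul, norm_smul, Real.norm_of_nonneg (by linarith [hθ.2]),
          Real.norm_of_nonneg hθ.1]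
      _ ≤ 1 * ‖u₀‖ + 1 * ‖u₁‖ := by
        gcongr
        · linarith [hθ.1]
        · exact hθ.2
      _ ≤ U := by rw [hU]; linarith
  have hlw : c ≤ l w := by
    have : l w = (1 - θ) * l u₀ + θ * l u₁ := by
      simp only [hl, hw, Prod.fst_add, Prod.snd_add, Prod.smul_fst, Prod.smul_snd, smul_eq_mul]
      ring
    rw [this]
    have h1 : c ≤ l u₀ := min_le_left _ _
    have h2 : c ≤ l u₁ := min_le_right _ _
    nlinarith [hθ.1, hθ.2]
  have hsU : s * U < ρ := (lt_div_iff₀ hU0).1 hsρ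
  have hnK : p + s • w ∉ K := by
    apply hρK
    rw [Metric.mem_ball, dist_eq_norm, add_sub_cancel_left, norm_smul, Real.norm_of_nonneg hs0'.le]
    exact lt_of_le_of_lt (mul_le_mul_of_nonneg_left hwU hs0'.le) hsU
  obtain ⟨j', t', ht', he⟩ := mem_iUnion.1 hmem
  have hj' : j' = j ∧ t' ∈ V := by
    by_contra hcon
    refine hnK (mem_iUnion.2 ⟨j', t', ⟨ht', ?_⟩, he⟩)
    split_ifs with hj
    · exact fun hV' => hcon ⟨hj, hV'⟩
    · trivial
  obtain ⟨rfl, htV⟩ := hj'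
  have hb : ‖γ j' t' - p - (t' - t₀) • d‖ ≤ κ * ‖t' - t₀‖ := hV htV
  rw [he, add_sub_cancel_left] at hb
  set τ := t' - t₀
  have h1 : ‖τ‖ * ‖d‖ ≤ s * U + κ * ‖τ‖ := by
    calc ‖τ‖ * ‖d‖ = ‖τ • d‖ := (norm_smul _ _).symm
      _ = ‖s • w - (s • w - τ • d)‖ := by rw [sub_sub_cancel]
      _ ≤ ‖s • w‖ + ‖s • w - τ • d‖ := norm_sub_le _ _
      _ ≤ s * U + κ * ‖τ‖ := by
        refine add_le_add ?_ hb
        rw [norm_smul, Real.norm_of_nonneg hs0'.le]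
        exact mul_le_mul_of_nonneg_left hwU hs0'.le
  have h2 : κ ≤ ‖d‖ / 2 := min_le_left _ _
  have h3 : ‖τ‖ * ‖d‖ ≤ 2 * (s * U) := by nlinarith [norm_nonneg τ]
  -- As `l` kills the tangent, `l (s • w)` only sees the linearization error, which is too small
  -- compared with `s * c`.
  have h4 : s * c ≤ L * (κ * ‖τ‖) := by
    calc s * c ≤ s * l w := mul_le_mul_of_nonneg_left hlw hs0'.le
      _ = l (s • w - τ • d) := by
        simp only [hl, hd, Prod.fst_sub, Prod.snd_sub, Prod.smul_fst, Prod.smul_snd, smul_eq_mul]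
        ring
      _ ≤ L * ‖s • w - τ • d‖ := (le_abs_self _).trans (hLb _)
      _ ≤ L * (κ * ‖τ‖) := mul_le_mul_of_nonneg_left hb hL0
  have h5 : s * (c * ‖d‖) ≤ s * (L * (2 * U) * κ) := by
    calc s * (c * ‖d‖) = (s * c) * ‖d‖ := by ring
      _ ≤ L * (κ * ‖τ‖) * ‖d‖ := mul_le_mul_of_nonneg_right h4 hd0.le
      _ = L * κ * (‖τ‖ * ‖d‖) := by ring
      _ ≤ L * κ * (2 * (s * U)) := mul_le_mul_of_nonneg_left h3 (by positivity)
      _ = _ := by ring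
  have := mul_lt_mul_of_pos_left hκc hs0'
  linarith

/-- The segment joining the two test points stays in the cone that avoids the curves, hence does not
cross the frontier of `R`. -/
theorem eventually_mem_iff (h : IsPlanarBoundary ε R γ) {j : Fin k} {t₀ : ℝ}
    (ht₀ : t₀ ∈ Icc (0 : ℝ) 1)
    (huniq : ∀ j' t', t' ∈ Icc (0 : ℝ) 1 → γ j' t' = γ j t₀ → j' = j ∧ t' = t₀)
    {η : ℝ} {u₀ u₁ : ℝ × ℝ}
    (hu₀ : 0 < η * (deriv (fun t => (γ j t).1) t₀ * u₀.2 - deriv (fun t => (γ j t).2) t₀ * u₀.1))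
    (hu₁ : 0 < η * (deriv (fun t => (γ j t).1) t₀ * u₁.2 - deriv (fun t => (γ j t).2) t₀ * u₁.1)) :
    ∀ᶠ s in 𝓝[>] (0 : ℝ), (γ j t₀ + s • u₀ ∈ R ↔ γ j t₀ + s • u₁ ∈ R) := by
  filter_upwards [h.eventually_cone_avoids ht₀ huniq hu₀ hu₁] with s hs
  have hpre : IsPreconnected ((fun θ : ℝ => γ j t₀ + s • ((1 - θ) • u₀ + θ • u₁)) '' Icc 0 1) :=
    isPreconnected_Icc.image _ (by fun_prop)
  refine mem_iff_mem_of_preconnected hpre h.isOpen ?_ ⟨0, ⟨le_rfl, zero_le_one⟩, by simp⟩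
    ⟨1, ⟨zero_le_one, le_rfl⟩, by simp⟩
  rw [Set.disjoint_left]
  rintro _ ⟨θ, hθ, rfl⟩ hf
  exact hs θ hθ (h.frontier_subset hf)

/-- At a regular point the region lies on one side along a horizontal line. -/
theorem eventually_horizontal (h : IsPlanarBoundary ε R γ) {j : Fin k} {t₀ : ℝ}
    (ht₀ : t₀ ∈ Icc (0 : ℝ) 1)
    (huniq : ∀ j' t', t' ∈ Icc (0 : ℝ) 1 → γ j' t' = γ j t₀ → j' = j ∧ t' = t₀)
    (hside : ∃ u : ℝ × ℝ,
      0 < ε * (deriv (fun t => (γ j t).1) t₀ * u.2 - deriv (fun t => (γ j t).2) t₀ * u.1) ∧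
      ∀ᶠ s in 𝓝[>] (0 : ℝ), γ j t₀ + s • u ∈ R ∧ γ j t₀ - s • u ∉ R) {κ : ℝ}
    (hκ : 0 < ε * κ * deriv (fun t => (γ j t).2) t₀) :
    ∀ᶠ s in 𝓝[>] (0 : ℝ), ((γ j t₀).1 - s * κ, (γ j t₀).2) ∈ R ∧
      ((γ j t₀).1 + s * κ, (γ j t₀).2) ∉ R := by
  obtain ⟨u, hu, hs⟩ := hside
  -- On the inner side `u` is rotated to `(-κ, 0)`, on the outer side `-u` to `(κ, 0)`, without
  -- crossing the tangent.
  have h1 := h.eventually_mem_iff ht₀ huniq (η := ε) (u₀ := u) (u₁ := (-κ, 0)) hu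
    (by simp only; nlinarith)
  have h2 := h.eventually_mem_iff ht₀ huniq (η := -ε) (u₀ := -u) (u₁ := (κ, 0))
    (by simp only [Prod.fst_neg, Prod.snd_neg]; nlinarith) (by simp only; nlinarith)
  filter_upwards [hs, h1, h2] with s hs h1 h2
  have e1 : γ j t₀ + s • ((-κ, 0) : ℝ × ℝ) = ((γ j t₀).1 - s * κ, (γ j t₀).2) := by
    ext <;> simp [sub_eq_add_neg]
  have e2 : γ j t₀ + s • ((κ, 0) : ℝ × ℝ) = ((γ j t₀).1 + s * κ, (γ j t₀).2) := by
    ext <;> simp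
  have e3 : γ j t₀ + s • (-u) = γ j t₀ - s • u := by rw [smul_neg, sub_eq_add_neg]
  rw [e1] at h1
  rw [e2, e3] at h2
  exact ⟨h1.1 hs.1, fun hh => hs.2 (h2.2 hh)⟩

end IsPlanarBoundary

end CylinderClip

namespace CylinderClip

open Filter Set

variable {E : Type*} [NormedAddCommGroup E] [NormedSpace ℝ E] [CompleteSpace E]

/-! ### Horizontal slices of a planar region and Green's formula. -/

theorem eventually_nhdsLT_of_sub {p : ℝ → Prop} {b : ℝ} (h : ∀ᶠ s in 𝓝[>] (0 : ℝ), p (b - s)) :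
    ∀ᶠ y in 𝓝[<] b, p y := by
  have ht : Tendsto (fun y => b - y) (𝓝[<] b) (𝓝[>] 0) := by
    refine tendsto_nhdsWithin_iff.2 ⟨?_, ?_⟩
    · exact ((continuous_const.sub continuous_id).tendsto' b 0 (sub_self b)).mono_left
        nhdsWithin_le_nhds
    · filter_upwards [self_mem_nhdsWithin] with y hy using sub_pos.2 (mem_Iio.1 hy)
  simpa using ht.eventually h

theorem eventually_nhdsGT_of_add {p : ℝ → Prop} {b : ℝ} (h : ∀ᶠ s in 𝓝[>] (0 : ℝ), p (b + s)) :
    ∀ᶠ y in 𝓝[>] b, p y := by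
  have ht : Tendsto (fun y => y - b) (𝓝[>] b) (𝓝[>] 0) := by
    refine tendsto_nhdsWithin_iff.2 ⟨?_, ?_⟩
    · exact ((continuous_id.sub continuous_const).tendsto' b 0 (sub_self b)).mono_left
        nhdsWithin_le_nhds
    · filter_upwards [self_mem_nhdsWithin] with y hy using sub_pos.2 (mem_Ioi.1 hy)
  simpa using ht.eventually h

/-- The membership of a set is locally constant away from its frontier. -/
theorem eventually_mem_iff_of_notMem_frontier {X : Type*} [TopologicalSpace X] {S : Set X} {x : X}
    (hx : x ∉ frontier S) : ∀ᶠ y in 𝓝 x, (y ∈ S ↔ x ∈ S) := by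
  by_cases h : x ∈ interior S
  · filter_upwards [mem_interior_iff_mem_nhds.1 h] with y hy
    exact ⟨fun _ => interior_subset h, fun _ => hy⟩
  · have hc : x ∉ closure S := fun hc => hx ⟨hc, h⟩
    filter_upwards [isClosed_closure.isOpen_compl.mem_nhds hc] with y hy
    exact ⟨fun hh => absurd (subset_closure hh) hy, fun hh => absurd (subset_closure hh) hc⟩

namespace IsPlanarBoundary

variable {ε : ℝ} {R : Set (ℝ × ℝ)} {k : ℕ} {γ : Fin k → ℝ → ℝ × ℝ}

/-- All but finitely many horizontal lines meet the curves in finitely many simple points, each with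
non-horizontal tangent and with the region on the prescribed side. The slice of `R` is then a step
function that jumps exactly there, with jumps `ε` times the sign of `y'`. -/
theorem integral_slice (h : IsPlanarBoundary ε R γ) :
    ∀ᶠ v in cofinite, ∀ F f : ℝ → E, (∀ x, HasDerivAt F (f x) x) → Continuous f →
      ∫ x, {x | (x, v) ∈ R}.indicator f x =
        ε • ∑ j, levelSum (fun t => (γ j t).2) (fun t => F (γ j t).1) v := by
  classical
  have hreg : ∀ᶠ v in cofinite, ∀ j, {t | t ∈ Icc (0 : ℝ) 1 ∧ (γ j t).2 = v}.Finite ∧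
      ∀ t ∈ Icc (0 : ℝ) 1, (γ j t).2 = v → deriv (fun t => (γ j t).2) t ≠ 0 :=
    eventually_all.2 fun j => (h.tame_snd j).regular
  have hside : ∀ᶠ v in cofinite, ∀ j, v ∉ (fun t => (γ j t).2) '' {t | t ∈ Icc (0 : ℝ) 1 ∧
      ¬ ∃ u : ℝ × ℝ,
      0 < ε * (deriv (fun t => (γ j t).1) t * u.2 - deriv (fun t => (γ j t).2) t * u.1) ∧
      ∀ᶠ s in 𝓝[>] (0 : ℝ), γ j t + s • u ∈ R ∧ γ j t - s • u ∉ R} :=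
    eventually_all.2 fun j => ((h.side j).image _).compl_mem_cofinite
  filter_upwards [hreg, hside, (h.finite_meet.image Prod.snd).compl_mem_cofinite]
    with v hreg hside hmeet F f hF hf
  have huniq : ∀ j t, t ∈ Icc (0 : ℝ) 1 → (γ j t).2 = v → ∀ j' t', t' ∈ Icc (0 : ℝ) 1 →
      γ j' t' = γ j t → j' = j ∧ t' = t := by
    intro j t ht hv j' t' ht' he
    by_contra hne
    refine hmeet ⟨γ j t, ⟨(j, t), (j', t'), ht, ht', ?_, rfl, he⟩, hv⟩
    rintro hh
    rw [Prod.mk.injEq] at hh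
    exact hne ⟨hh.1.symm, hh.2.symm⟩
  set L : Fin k → Finset ℝ := fun j => (hreg j).1.toFinset with hL
  have hmem : ∀ j t, t ∈ L j ↔ t ∈ Icc (0 : ℝ) 1 ∧ (γ j t).2 = v := fun j t => by simp [hL]
  set J : Finset (Σ _ : Fin k, ℝ) := Finset.univ.sigma L with hJ
  have hmemJ : ∀ a, a ∈ J ↔ a.2 ∈ Icc (0 : ℝ) 1 ∧ (γ a.1 a.2).2 = v := fun a => by
    simp [hJ, hmem]
  set b : (Σ _ : Fin k, ℝ) → ℝ := fun a => (γ a.1 a.2).1 with hb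
  set σ : (Σ _ : Fin k, ℝ) → ℝ := fun a => ε * Real.sign (deriv (fun t => (γ a.1 t).2) a.2) with hσ
  set χ : ℝ → ℝ := fun x => if (x, v) ∈ R then 1 else 0 with hχ
  have hbv : ∀ a ∈ J, γ a.1 a.2 = (b a, v) := fun a ha => by
    rw [← ((hmemJ a).1 ha).2]
  obtain ⟨M, hM⟩ := h.isBounded.exists_norm_le
  have hMx : ∀ x, (x, v) ∈ R → -M ≤ x ∧ x ≤ M := fun x hx =>
    abs_le.1 ((norm_fst_le (x, v)).trans (hM _ hx))
  have hinj : InjOn b J := by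
    intro a ha a' ha' he
    have h1 := hbv a ha
    have h2 := hbv a' ha'
    rw [← he, ← h1] at h2
    obtain ⟨e1, e2⟩ := huniq a.1 a.2 ((hmemJ a).1 ha).1 ((hmemJ a).1 ha).2 a'.1 a'.2
      ((hmemJ a').1 ha').1 h2
    cases a; cases a'
    simp only at e1 e2
    subst e1; subst e2; rfl
  have hstep : ∀ x, x ∉ b '' (J : Set (Σ _ : Fin k, ℝ)) → χ x = stepSum J b σ x := by
    intro x hx
    refine eq_stepSum J b σ χ hinj ?_ ?_ ?_ hx
    · filter_upwards [eventually_gt_atTop M] with x hx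
      exact if_neg fun hR => absurd (hMx x hR).2 hx.not_ge
    · intro x hx
      have hfr : (x, v) ∉ frontier R := by
        intro hfr
        obtain ⟨j, t, ht, he⟩ := mem_iUnion.1 (h.frontier_subset hfr)
        refine hx ⟨⟨j, t⟩, (hmemJ _).2 ⟨ht, ?_⟩, ?_⟩
        · simp [he]
        · simp [hb, he]
      have hc : Continuous fun x : ℝ => (x, v) := by fun_prop
      filter_upwards [hc.continuousAt.eventually (eventually_mem_iff_of_notMem_frontier hfr)]
        with y hy
      simp only [hχ, hy]
    · intro a ha
      obtain ⟨haI, hav⟩ := (hmemJ a).1 ha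
      have hs : ∃ u : ℝ × ℝ, 0 < ε * (deriv (fun t => (γ a.1 t).1) a.2 * u.2 -
          deriv (fun t => (γ a.1 t).2) a.2 * u.1) ∧
          ∀ᶠ s in 𝓝[>] (0 : ℝ), γ a.1 a.2 + s • u ∈ R ∧ γ a.1 a.2 - s • u ∉ R := by
        by_contra hcon
        exact hside a.1 ⟨a.2, ⟨haI, hcon⟩, hav⟩
      have hhor := fun κ hκ => h.eventually_horizontal haI (huniq a.1 a.2 haI hav) hs (κ := κ) hκ
      have hd := (hreg a.1).2 a.2 haI hav
      set d := deriv (fun t => (γ a.1 t).2) a.2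
      have hpv : (γ a.1 a.2).2 = v := hav
      have hσa : σ a = Real.sign (ε * d) := by
        rcases h.orientation with rfl | rfl <;> simp [hσ, Real.sign_neg, d]
      have hεd : ε * d ≠ 0 := mul_ne_zero (by rcases h.orientation with rfl | rfl <;> norm_num) hd
      -- The sign of `ε * d` decides whether the region begins or ends at this point when `x`
      -- increases; the horizontal direction is chosen as `κ = -1` or `κ = 1` accordingly.
      rcases lt_or_gt_of_ne hεd with hlt | hgt
      · have := hhor (-1) (by linarith)
        simp only [hpv, mul_neg, mul_one, sub_neg_eq_add, ← sub_eq_add_neg] at this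
        refine ⟨0, 1, ?_, ?_, by rw [hσa, Real.sign_of_neg hlt]; norm_num⟩
        · exact eventually_nhdsLT_of_sub (this.mono fun s hs => if_neg hs.2)
        · exact eventually_nhdsGT_of_add (this.mono fun s hs => if_pos hs.1)
      · have := hhor 1 (by linarith)
        simp only [hpv, mul_one] at this
        refine ⟨1, 0, ?_, ?_, by rw [hσa, Real.sign_of_pos hgt]; norm_num⟩
        · exact eventually_nhdsLT_of_sub (this.mono fun s hs => if_pos hs.1)
        · exact eventually_nhdsGT_of_add (this.mono fun s hs => if_neg hs.2)
  have hsum := sum_jumps_eq_zero J b σ χ (by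
    filter_upwards [eventually_lt_atBot (-M)] with x hx
    exact if_neg fun hR => absurd (hMx x hR).1 hx.not_ge) hstep
  calc ∫ x, {x | (x, v) ∈ R}.indicator f x = ∫ x, χ x • f x := by
        congr 1
        ext x
        by_cases hx : (x, v) ∈ R <;> simp [hχ, hx]
    _ = ∑ a ∈ J, σ a • F (b a) := integral_univ_smul_of_eq_stepSum J b σ χ hsum hstep hF hf
    _ = _ := by
        rw [hJ, Finset.sum_sigma, Finset.smul_sum]
        refine Finset.sum_congr rfl fun j _ => ?_
        rw [levelSum, finsum_mem_eq_finite_toFinset_sum _ (hreg j).1, Finset.smul_sum]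
        refine Finset.sum_congr rfl fun t _ => ?_
        rw [smul_smul]

/-- Green's theorem. -/
theorem green (h : IsPlanarBoundary ε R γ) {f : ℝ × ℝ → E} (hf : ContDiff ℝ 1 f) :
    ε • ∫ p in R, fderiv ℝ f p (1, 0) =
      ∑ j, ∫ t in (0 : ℝ)..1, deriv (fun t => (γ j t).2) t • f (γ j t) := by
  have hg : Continuous fun p => fderiv ℝ f p (1, 0) :=
    (hf.continuous_fderiv one_ne_zero).clm_apply continuous_const
  have hRm : MeasurableSet R := h.isOpen.measurableSet
  have hint : IntegrableOn (fun p => fderiv ℝ f p (1, 0)) R := by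
    have hcpt : IsCompact (closure R) := h.isBounded.isCompact_closure
    exact (hg.continuousOn.integrableOn_compact hcpt).mono_set subset_closure
  have hderG : ∀ j, ∀ t ∈ Icc (0 : ℝ) 1, HasDerivAt (fun t => f (γ j t))
      (fderiv ℝ f (γ j t) (deriv (fun t => (γ j t).1) t, deriv (fun t => (γ j t).2) t)) t :=
    fun j t ht => ((hf.differentiable one_ne_zero).differentiableAt.hasFDerivAt).comp_hasDerivAt t
      (h.hasDerivAt j ht)
  have hderGc : ∀ j, ContinuousOn (fun t => fderiv ℝ f (γ j t)
      (deriv (fun t => (γ j t).1) t, deriv (fun t => (γ j t).2) t)) (Icc 0 1) := fun j =>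
    ((hf.continuous_fderiv one_ne_zero).comp_continuousOn (h.continuousOn j)).clm_apply
      ((h.tame_fst j).continuousOn_deriv.prodMk (h.tame_snd j).continuousOn_deriv)
  have harea := fun j => integrable_levelSum_and_integral (h.tame_snd j) (hderG j) (hderGc j)
  have hε : ε * ε = 1 := by rcases h.orientation with rfl | rfl <;> norm_num
  have hslice : ∀ᵐ v, ∫ x, R.indicator (fun p => fderiv ℝ f p (1, 0)) (x, v) =
      ε • ∑ j, levelSum (fun t => (γ j t).2) (fun t => f (γ j t)) v := by
    have hcof : ∀ᶠ v in cofinite, ∫ x, R.indicator (fun p => fderiv ℝ f p (1, 0)) (x, v) =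
        ε • ∑ j, levelSum (fun t => (γ j t).2) (fun t => f (γ j t)) v := by
      filter_upwards [h.integral_slice (E := E)] with v hv
      have := hv (fun x => f (x, v)) (fun x => fderiv ℝ f (x, v) (1, 0)) (fun x => ?_)
        (hg.comp (by fun_prop))
      · calc _ = _ := this
          _ = _ := by
            congr 1
            refine Finset.sum_congr rfl fun j _ => ?_
            rw [levelSum, levelSum]
            refine finsum_mem_congr rfl fun t ht => ?_
            rw [← ht.2]
      · exact ((hf.differentiable one_ne_zero).differentiableAt.hasFDerivAt).comp_hasDerivAt x
          ((hasDerivAt_id x).prodMk (hasDerivAt_const x v))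
    exact (measure_mono_null (fun v hv => hv) (Set.Finite.measure_zero hcof volume) : _)
  -- Fubini with the `x`-integration inside; the slice formula and then the area formula do the
  -- rest, and `ε * ε = 1` removes the orientation.
  rw [← integral_indicator hRm, Measure.volume_eq_prod,
    integral_prod_symm _
      (by rw [← Measure.volume_eq_prod]; exact (integrable_indicator_iff hRm).2 hint),
    integral_congr_ae hslice, integral_smul, smul_smul, hε, one_smul,
    integral_finsetSum _ fun j _ => (harea j).1]
  exact Finset.sum_congr rfl fun j _ => (harea j).2

/-- Reflection in the diagonal exchanges left and right, hence `-ε`. It converts Green's formula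
with `dy` into the one with `dx`. -/
theorem swap (h : IsPlanarBoundary ε R γ) :
    IsPlanarBoundary (-ε) (Prod.swap ⁻¹' R) fun j t => (γ j t).swap where
  orientation := by rcases h.orientation with rfl | rfl <;> simp
  isOpen := h.isOpen.preimage continuous_swap
  isBounded := by
    obtain ⟨M, hM⟩ := h.isBounded.exists_norm_le
    refine (Metric.isBounded_closedBall (x := (0 : ℝ × ℝ)) (r := M)).subset fun p hp => ?_
    rw [mem_closedBall_zero_iff]
    have := hM _ hp
    rwa [Prod.norm_def, Prod.fst_swap, Prod.snd_swap, max_comm] at this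
  tame_fst := h.tame_snd
  tame_snd := h.tame_fst
  frontier_subset := by
    intro p hp
    have hp' : p.swap ∈ frontier R := by
      have := (Homeomorph.prodComm ℝ ℝ).preimage_frontier R
      have hp2 : p ∈ (Homeomorph.prodComm ℝ ℝ) ⁻¹' frontier R := by rw [this]; exact hp
      exact hp2
    obtain ⟨j, t, ht, he⟩ := mem_iUnion.1 (h.frontier_subset hp')
    exact mem_iUnion.2 ⟨j, t, ht, by simp [he]⟩
  finite_meet := by
    refine (h.finite_meet.image Prod.swap).subset ?_
    rintro p ⟨a, b, ha, hb, hab, h1, h2⟩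
    exact ⟨p.swap, ⟨a, b, ha, hb, hab, by rw [← h1, Prod.swap_swap], by rw [← h2, Prod.swap_swap]⟩,
      p.swap_swap⟩
  side := by
    intro j
    refine (h.side j).subset ?_
    rintro t ⟨ht, hn⟩
    refine ⟨ht, fun ⟨u, hu, hs⟩ => hn ⟨u.swap, ?_, ?_⟩⟩
    · simp only [Prod.fst_swap, Prod.snd_swap]
      linarith
    · filter_upwards [hs] with s hs
      exact hs

/-- The boundary curves form closed chains. -/
theorem sum_endpoints (h : IsPlanarBoundary ε R γ) {f : ℝ × ℝ → E} (hf : ContDiff ℝ 2 f) :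
    ∑ j, f (γ j 1) = ∑ j, f (γ j 0) := by
  have hf' : ContDiff ℝ 1 (fderiv ℝ f) := hf.fderiv_right (by norm_num)
  have hfy : ContDiff ℝ 1 fun p => fderiv ℝ f p (0, 1) := hf'.clm_apply contDiff_const
  have hfx : ContDiff ℝ 1 fun p : ℝ × ℝ => fderiv ℝ f p.swap (1, 0) :=
    (hf'.comp (contDiff_snd.prodMk contDiff_fst)).clm_apply contDiff_const
  -- With `∂x ∂y f` as common area integrand, `∮ f_y dy` and `∮ f_x dx` are opposite, so `∮ df = 0`;
  -- edge by edge this is the difference of end-point values.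
  have g1 := h.green hfy
  have g2 := h.swap.green hfx
  have hmix : ∫ p in Prod.swap ⁻¹' R,
      fderiv ℝ (fun p : ℝ × ℝ => fderiv ℝ f p.swap (1, 0)) p (1, 0) =
      ∫ p in R, fderiv ℝ (fun p => fderiv ℝ f p (0, 1)) p (1, 0) := by
    have hmp : MeasurePreserving (Prod.swap : ℝ × ℝ → ℝ × ℝ) := by
      rw [Measure.volume_eq_prod]; exact Measure.measurePreserving_swap
    rw [← hmp.setIntegral_preimage_emb MeasurableEquiv.prodComm.measurableEmbedding _ R]
    refine setIntegral_congr_fun (h.isOpen.preimage continuous_swap).measurableSet fun p _ => ?_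
    have hsym : IsSymmSndFDerivAt ℝ f p.swap :=
      hf.contDiffAt.isSymmSndFDerivAt (by simp)
    have d1 : ∀ q, HasFDerivAt (fderiv ℝ f) (fderiv ℝ (fderiv ℝ f) q) q := fun q =>
      ((hf'.differentiable one_ne_zero) q).hasFDerivAt
    have e1 : fderiv ℝ (fun p : ℝ × ℝ => fderiv ℝ f p.swap (1, 0)) p (1, 0) =
        fderiv ℝ (fderiv ℝ f) p.swap (0, 1) (1, 0) := by
      have hs : HasFDerivAt (Prod.swap : ℝ × ℝ → ℝ × ℝ)
          ((ContinuousLinearMap.snd ℝ ℝ ℝ).prod (ContinuousLinearMap.fst ℝ ℝ ℝ)) p :=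
        ((ContinuousLinearMap.snd ℝ ℝ ℝ).prod (ContinuousLinearMap.fst ℝ ℝ ℝ)).hasFDerivAt
      have := ((d1 p.swap).comp p hs).clm_apply (hasFDerivAt_const ((1, 0) : ℝ × ℝ) p)
      have e := this.fderiv
      simp only [Function.comp_def] at e
      rw [e]
      simp
    have e2 : fderiv ℝ (fun p : ℝ × ℝ => fderiv ℝ f p (0, 1)) p.swap (1, 0) =
        fderiv ℝ (fderiv ℝ f) p.swap (1, 0) (0, 1) := by
      have := (d1 p.swap).clm_apply (hasFDerivAt_const ((0, 1) : ℝ × ℝ) p.swap)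
      rw [this.fderiv]
      simp
    rw [e1, e2]
    exact hsym.eq _ _
  rw [hmix] at g2
  have hftc : ∀ j, ∫ t in (0 : ℝ)..1, (deriv (fun t => (γ j t).2) t • fderiv ℝ f (γ j t) (0, 1) +
      deriv (fun t => (γ j t).1) t • fderiv ℝ f (γ j t) (1, 0)) = f (γ j 1) - f (γ j 0) := by
    intro j
    refine intervalIntegral.integral_eq_sub_of_hasDerivAt (f := fun t => f (γ j t)) ?_ ?_
    · intro t ht
      rw [uIcc_of_le zero_le_one] at ht
      have := ((hf.differentiable two_ne_zero).differentiableAt.hasFDerivAt).comp_hasDerivAt t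
        (h.hasDerivAt j ht)
      have e : ((deriv (fun t => (γ j t).1) t, deriv (fun t => (γ j t).2) t) : ℝ × ℝ) =
          deriv (fun t => (γ j t).2) t • (0, 1) + deriv (fun t => (γ j t).1) t • (1, 0) := by
        ext <;> simp
      rw [e, map_add, map_smul, map_smul] at this
      exact this
    · refine ContinuousOn.intervalIntegrable ?_
      rw [uIcc_of_le zero_le_one]
      exact ((h.tame_snd j).continuousOn_deriv.smul (hfy.continuous.comp_continuousOn
        (h.continuousOn j))).add ((h.tame_fst j).continuousOn_deriv.smul
        ((hf'.continuous.clm_apply continuous_const).comp_continuousOn (h.continuousOn j)))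
  have hadd : ∀ j, ∫ t in (0 : ℝ)..1, (deriv (fun t => (γ j t).2) t • fderiv ℝ f (γ j t) (0, 1) +
      deriv (fun t => (γ j t).1) t • fderiv ℝ f (γ j t) (1, 0)) =
      (∫ t in (0 : ℝ)..1, deriv (fun t => (γ j t).2) t • fderiv ℝ f (γ j t) (0, 1)) +
      ∫ t in (0 : ℝ)..1, deriv (fun t => (γ j t).1) t • fderiv ℝ f (γ j t) (1, 0) := by
    intro j
    refine intervalIntegral.integral_add ?_ ?_ <;> refine ContinuousOn.intervalIntegrable ?_ <;>
      rw [uIcc_of_le zero_le_one]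
    · exact (h.tame_snd j).continuousOn_deriv.smul (hfy.continuous.comp_continuousOn
        (h.continuousOn j))
    · exact (h.tame_fst j).continuousOn_deriv.smul
        ((hf'.continuous.clm_apply continuous_const).comp_continuousOn (h.continuousOn j))
  have : ∑ j, (f (γ j 1) - f (γ j 0)) = 0 := by
    calc ∑ j, (f (γ j 1) - f (γ j 0)) = _ :=
          Finset.sum_congr rfl fun j _ => (hftc j).symm.trans (hadd j)
      _ = _ := Finset.sum_add_distrib
      _ = 0 := by
        have g2' := g2
        simp only [Prod.snd_swap, Prod.swap_swap] at g2'
        rw [← g1, ← g2', ← add_smul, add_neg_cancel, zero_smul]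
  rw [Finset.sum_sub_distrib] at this
  exact sub_eq_zero.1 this

end IsPlanarBoundary

end CylinderClip

namespace CylinderClip

open Filter Set

/-! ### Parametrizations of the edges -/

/-- Rational functions are tame. -/
theorem tame_div {N D : Polynomial ℝ} (hD : ∀ t ∈ Icc (0 : ℝ) 1, 0 < D.eval t) :
    Tame fun t => N.eval t / D.eval t := by
  set W := N.derivative * D - N * D.derivative with hW
  have hder : ∀ t ∈ Icc (0 : ℝ) 1,
      HasDerivAt (fun t => N.eval t / D.eval t) (W.eval t / D.eval t ^ 2) t := by
    intro t ht
    have := (N.hasDerivAt t).div (D.hasDerivAt t) (hD t ht).ne'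
    simp only [hW, Polynomial.eval_sub, Polynomial.eval_mul]
    exact this
  have hderiv : ∀ t ∈ Icc (0 : ℝ) 1,
      deriv (fun t => N.eval t / D.eval t) t = W.eval t / D.eval t ^ 2 :=
    fun t ht => (hder t ht).deriv
  refine ⟨fun t ht => by rw [hderiv t ht]; exact hder t ht, ?_, ?_⟩
  · refine ContinuousOn.congr (f := fun t => W.eval t / D.eval t ^ 2) ?_ hderiv
    exact W.continuous.continuousOn.div (D.continuous.pow 2).continuousOn
      fun t ht => pow_ne_zero 2 (hD t ht).ne'
  -- If the derivative vanishes identically the function is constant, and every other value has an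
  -- empty level set.
  · by_cases hW0 : W = 0
    · have hconst : ∀ t ∈ Icc (0 : ℝ) 1, N.eval t / D.eval t = N.eval 0 / D.eval 0 := by
        intro t ht
        refine constant_of_has_deriv_right_zero (a := 0) (b := 1)
          (f := fun t => N.eval t / D.eval t) ?_ ?_ t ht
        · exact fun s hs => (hder s hs).continuousAt.continuousWithinAt
        · intro s hs
          have := hder s (Ico_subset_Icc_self hs)
          rw [hW0, Polynomial.eval_zero, zero_div] at this
          exact this.hasDerivWithinAt
      filter_upwards [(finite_singleton (N.eval 0 / D.eval 0)).compl_mem_cofinite] with v hv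
      have hne : ∀ t ∈ Icc (0 : ℝ) 1, N.eval t / D.eval t ≠ v := fun t ht he =>
        hv (by rw [← he, hconst t ht]; rfl)
      refine ⟨?_, fun t ht he => absurd he (hne t ht)⟩
      convert finite_empty (α := ℝ)
      ext t
      simp only [mem_ofPred_eq, mem_empty_iff_false, iff_false, not_and]
      exact hne t
    · have hfin : {t | W.IsRoot t}.Finite := Polynomial.finite_setOfPred_isRoot hW0
      filter_upwards [(hfin.image fun t => N.eval t / D.eval t).compl_mem_cofinite] with v hv
      constructor
      -- A level set is the zero set of `N - v D`; if this polynomial were zero, the Wronskian `W`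
      -- would be zero too.
      · have hp : N - Polynomial.C v * D ≠ 0 := by
          intro h0
          have hN : N = Polynomial.C v * D := sub_eq_zero.1 h0
          apply hW0
          rw [hW, hN, Polynomial.derivative_C_mul]
          ring
        refine (Polynomial.finite_setOfPred_isRoot hp).subset ?_
        rintro t ⟨ht, he⟩
        have hDt := (hD t ht).ne'
        simp only [mem_ofPred_eq, Polynomial.IsRoot, Polynomial.eval_sub, Polynomial.eval_mul,
          Polynomial.eval_C]
        rw [← he, div_mul_cancel₀ _ hDt, sub_self]
      · intro t ht he h0
        rw [hderiv t ht, div_eq_zero_iff] at h0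
        rcases h0 with h0 | h0
        · exact hv ⟨t, h0, he⟩
        · exact absurd h0 (pow_ne_zero 2 (hD t ht).ne')

/-- The denominator of a rational Bézier curve. -/
def bezierDen (w t : ℝ) : ℝ := (1 - t) ^ 2 + 2 * w * t * (1 - t) + t ^ 2

theorem bezierDen_pos {w : ℝ} (hw : 0 < w) {t : ℝ} (ht : t ∈ Icc (0 : ℝ) 1) :
    0 < bezierDen w t := by
  have h1 : 0 ≤ 2 * w * t * (1 - t) := by
    have := ht.1; have : 0 ≤ 1 - t := by linarith [ht.2]
    positivity
  have h2 : 0 < (1 - t) ^ 2 + t ^ 2 := by nlinarith [sq_nonneg (1 - 2 * t)]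
  unfold bezierDen; linarith

theorem bezier_apply (w : ℝ) (a b c : Point) (t : ℝ) (i : Fin 3) :
    bezier w a b c t i =
      ((1 - t) ^ 2 * a i + 2 * w * t * (1 - t) * c i + t ^ 2 * b i) / bezierDen w t := by
  simp only [bezier, bezierDen, Pi.smul_apply, Pi.add_apply, smul_eq_mul]
  rw [div_eq_inv_mul]

theorem tame_bezier {w : ℝ} (hw : 0 < w) (a b c : Point) (i : Fin 3) :
    Tame fun t => bezier w a b c t i := by
  have := tame_div (N := (1 - Polynomial.X) ^ 2 * Polynomial.C (a i) +
      Polynomial.C (2 * w) * Polynomial.X * (1 - Polynomial.X) * Polynomial.C (c i) +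
      Polynomial.X ^ 2 * Polynomial.C (b i))
    (D := (1 - Polynomial.X) ^ 2 + Polynomial.C (2 * w) * Polynomial.X * (1 - Polynomial.X) +
      Polynomial.X ^ 2) (by
    intro t ht
    have := bezierDen_pos hw ht
    simpa [bezierDen] using this)
  simp only [bezier_apply, bezierDen, fun t : ℝ => mul_comm (t ^ 2) (b i)]
  simpa using this

/-- With weight one the denominator is identically one, and the midpoint as control point makes the
numerator linear. Segments thereby inherit what is proved for Bézier curves. -/
theorem linearCurve_eq_bezier (a b : Point) :
    linearCurve a b = bezier 1 a b ((1 / 2 : ℝ) • (a + b)) := by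
  ext t i
  rw [bezier_apply]
  have : bezierDen 1 t = 1 := by unfold bezierDen; ring
  rw [this]
  simp only [linearCurve, Pi.add_apply, Pi.smul_apply, smul_eq_mul]
  ring

theorem linearCurve_apply (a b : Point) (t : ℝ) (i : Fin 3) :
    linearCurve a b t i = (1 - t) * a i + t * b i := by
  simp [linearCurve]

theorem tame_linearCurve (a b : Point) (i : Fin 3) : Tame fun t => linearCurve a b t i := by
  rw [linearCurve_eq_bezier]; exact tame_bezier one_pos _ _ _ _

theorem bezier_zero (w : ℝ) (a b c : Point) : bezier w a b c 0 = a := by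
  ext i; simp [bezier_apply, bezierDen]

theorem bezier_one (w : ℝ) (a b c : Point) : bezier w a b c 1 = b := by
  ext i; simp [bezier_apply, bezierDen]

namespace Edge

theorem tame_curve {e : Edge} (hw : e.onSurface = true → 0 < e.weight) (i : Fin 3) :
    Tame fun t => e.curve t i := by
  unfold curve
  split_ifs with h
  · exact tame_bezier (hw h) _ _ _ _
  · exact tame_linearCurve _ _ _

theorem curve_zero (e : Edge) : e.curve 0 = e.source := by
  unfold curve
  split_ifs
  · exact bezier_zero _ _ _ _
  · simp [linearCurve]

theorem curve_one (e : Edge) : e.curve 1 = e.target := by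
  unfold curve
  split_ifs
  · exact bezier_one _ _ _ _
  · simp [linearCurve]

theorem hasDerivAt_curve {e : Edge} (hw : e.onSurface = true → 0 < e.weight) {t : ℝ}
    (ht : t ∈ Icc (0 : ℝ) 1) : HasDerivAt e.curve (deriv e.curve t) t := by
  have h : HasDerivAt e.curve (fun i => deriv (fun s => e.curve s i) t) t :=
    hasDerivAt_pi.2 fun i => (tame_curve hw i).hasDerivAt t ht
  rw [h.deriv]; exact h

theorem deriv_curve_apply {e : Edge} (hw : e.onSurface = true → 0 < e.weight) {t : ℝ}
    (ht : t ∈ Icc (0 : ℝ) 1) (i : Fin 3) :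
    deriv (fun s => e.curve s i) t = deriv e.curve t i :=
  (hasDerivAt_pi.1 (hasDerivAt_curve hw ht) i).deriv

end Edge

/-! ### Clipped faces as planar regions -/

/-- The height of the plane `n ⬝ᵥ q = d` above a point of the `xy`-plane. -/
noncomputable def planeHeight (n : Point) (d x y : ℝ) : ℝ := (d - n 0 * x - n 1 * y) / n 2

/-- The point of the plane `n ⬝ᵥ q = d` above a point of the `xy`-plane. -/
noncomputable def planeLift (n : Point) (d : ℝ) (q : ℝ × ℝ) : Point :=
  ![q.1, q.2, planeHeight n d q.1 q.2]

theorem dotProduct_three (n p : Point) : n ⬝ᵥ p = n 0 * p 0 + n 1 * p 1 + n 2 * p 2 := by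
  simp [dotProduct, Fin.sum_univ_three]

theorem continuous_planeLift (n : Point) (d : ℝ) : Continuous (planeLift n d) := by
  unfold planeLift planeHeight
  refine continuous_pi fun i => ?_
  fin_cases i <;> simp <;> fun_prop

theorem planeLift_mem {n : Point} (hn : n 2 ≠ 0) (d : ℝ) (q : ℝ × ℝ) :
    n ⬝ᵥ planeLift n d q = d := by
  rw [dotProduct_three]
  simp only [planeLift, planeHeight, Matrix.cons_val]
  field_simp
  ring

theorem planeLift_proj {n : Point} (hn : n 2 ≠ 0) {d : ℝ} {p : Point} (hp : n ⬝ᵥ p = d) :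
    planeLift n d (p 0, p 1) = p := by
  rw [dotProduct_three] at hp
  ext i
  fin_cases i
  · rfl
  · rfl
  · simp only [planeLift, planeHeight, Fin.reduceFinMk, Matrix.cons_val]
    rw [← hp]; field_simp; ring

theorem isClosed_plane (n : Point) (d : ℝ) : IsClosed {q : Point | n ⬝ᵥ q = d} := by
  have h : Continuous fun q : Point => n ⬝ᵥ q := by
    simp only [dotProduct_three]; fun_prop
  exact isClosed_eq h continuous_const

/-- Displays the relative interior as the trace of an ambient open set, so that its preimage under
the continuous lift is open. -/
theorem relInterior_eq (H s : Set Point) : relInterior H s = H ∩ interior (Hᶜ ∪ s) := by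
  ext p
  simp only [relInterior, mem_ofPred_eq, mem_inter_iff, mem_interior_iff_mem_nhds,
    mem_nhdsWithin_iff_eventually]
  refine and_congr_right fun _ => ?_
  rw [← Filter.eventually_mem_set]
  refine Filter.eventually_congr (Eventually.of_forall fun q => ?_)
  simp only [mem_union, mem_compl_iff]
  tauto

theorem relInterior_subset {H s : Set Point} : relInterior H s ⊆ s := fun _ hp =>
  mem_of_mem_nhdsWithin hp.1 hp.2

theorem isOpen_planeLift_preimage {n : Point} (hn : n 2 ≠ 0) (d : ℝ) (s : Set Point) :
    IsOpen (planeLift n d ⁻¹' relInterior {q | n ⬝ᵥ q = d} s) := by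
  have : planeLift n d ⁻¹' relInterior {q | n ⬝ᵥ q = d} s =
      planeLift n d ⁻¹' interior ({q | n ⬝ᵥ q = d}ᶜ ∪ s) := by
    rw [relInterior_eq, preimage_inter]
    exact inter_eq_right.2 fun q _ => planeLift_mem hn d q
  rw [this]
  exact isOpen_interior.preimage (continuous_planeLift n d)

theorem isBounded_of_lift {s : Set Point} (hs : Bornology.IsBounded s) {g : ℝ × ℝ → ℝ}
    {S : Set (ℝ × ℝ)} (h : ∀ q ∈ S, ![q.1, q.2, g q] ∈ s) : Bornology.IsBounded S := by
  obtain ⟨M, hM⟩ := hs.exists_norm_le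
  refine (Metric.isBounded_closedBall (x := (0 : ℝ × ℝ)) (r := M)).subset fun q hq => ?_
  have h := hM _ (h q hq)
  rw [mem_closedBall_zero_iff, Prod.norm_def]
  exact max_le ((norm_le_pi_norm (![q.1, q.2, g q] : Point) 0).trans h)
    ((norm_le_pi_norm (![q.1, q.2, g q] : Point) 1).trans h)

namespace IsOrientedBoundary

variable {n : Point} {d : ℝ} {s : Set Point} {k : ℕ} {e : Fin k → Edge}

theorem curve_mem_closure {R : Set Point} (hb : IsOrientedBoundary n R e) (j : Fin k) {t : ℝ}
    (ht : t ∈ Icc (0 : ℝ) 1) : (e j).curve t ∈ closure R \ R := by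
  rw [hb.image_eq]; exact mem_iUnion.2 ⟨j, t, ht, rfl⟩

theorem curve_mem_plane (hb : IsOrientedBoundary n (relInterior {q | n ⬝ᵥ q = d} s) e) (j : Fin k)
    {t : ℝ} (ht : t ∈ Icc (0 : ℝ) 1) : n ⬝ᵥ (e j).curve t = d :=
  closure_minimal (fun _ hp => hp.1) (isClosed_plane n d) (hb.curve_mem_closure j ht).1

/-- The curve is confined to the plane only for parameters in `[0, 1]`; uniqueness of derivatives
within the interval covers the end-points. -/
theorem dotProduct_deriv (hb : IsOrientedBoundary n (relInterior {q | n ⬝ᵥ q = d} s) e)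
    (hw : ∀ j, (e j).onSurface = true → 0 < (e j).weight) (j : Fin k)
    {t : ℝ} (ht : t ∈ Icc (0 : ℝ) 1) : n ⬝ᵥ deriv (e j).curve t = 0 := by
  have hd := hasDerivAt_pi.1 (Edge.hasDerivAt_curve (hw j) ht)
  have h1 : HasDerivAt (fun t => n ⬝ᵥ (e j).curve t) (n ⬝ᵥ deriv (e j).curve t) t := by
    simp only [dotProduct_three]
    exact (((hd 0).const_mul _).add ((hd 1).const_mul _)).add ((hd 2).const_mul _)
  have h2 : HasDerivWithinAt (fun t => n ⬝ᵥ (e j).curve t) 0 (Icc 0 1) t :=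
    (hasDerivWithinAt_const t (Icc 0 1) d).congr (fun s hs => hb.curve_mem_plane j hs)
      (hb.curve_mem_plane j ht)
  exact (uniqueDiffOn_Icc zero_lt_one t ht).eq_deriv _ h1.hasDerivWithinAt h2

/-- For `n 2 ≠ 0` projection is an affine isomorphism of the plane onto the `xy`-plane, preserving
orientation exactly if `n 2 > 0`. The required transversal direction is the projection of `n ⨯₃ γ'`.
-/
theorem isPlanarBoundary (hb : IsOrientedBoundary n (relInterior {q | n ⬝ᵥ q = d} s) e)
    (hw : ∀ j, (e j).onSurface = true → 0 < (e j).weight) (hn : n 2 ≠ 0)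
    (hs : Bornology.IsBounded s) :
    IsPlanarBoundary (Real.sign (n 2)) (planeLift n d ⁻¹' relInterior {q | n ⬝ᵥ q = d} s)
      fun j t => ((e j).curve t 0, (e j).curve t 1) where
  orientation := (Real.sign_apply_eq_of_ne_zero _ hn).symm
  isOpen := isOpen_planeLift_preimage hn d s
  isBounded := isBounded_of_lift hs fun _ hq => relInterior_subset hq
  tame_fst j := Edge.tame_curve (hw j) 0
  tame_snd j := Edge.tame_curve (hw j) 1
  frontier_subset := by
    intro q hq
    have h1 : planeLift n d q ∈ closure (relInterior {q | n ⬝ᵥ q = d} s) :=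
      (continuous_planeLift n d).closure_preimage_subset _ hq.1
    by_cases h2 : planeLift n d q ∈ relInterior {q | n ⬝ᵥ q = d} s
    · exfalso
      refine hq.2 (mem_interior_iff_mem_nhds.2 ?_)
      rw [relInterior_eq] at h2
      filter_upwards [(isOpen_interior.preimage (continuous_planeLift n d)).mem_nhds h2.2]
        with q' hq'
      rw [mem_preimage, relInterior_eq]
      exact ⟨planeLift_mem hn d q', hq'⟩
    · have h3 : planeLift n d q ∈ ⋃ j, (e j).curve '' Icc 0 1 := hb.image_eq ▸ ⟨h1, h2⟩
      obtain ⟨j, t, ht, he⟩ := mem_iUnion.1 h3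
      refine mem_iUnion.2 ⟨j, t, ht, ?_⟩
      simp only [he]
      rfl
  finite_meet := by
    refine (hb.finite_meet.image fun p => (p 0, p 1)).subset ?_
    rintro q ⟨a, b, ha, hb', hab, h1, h2⟩
    refine ⟨(e a.1).curve a.2, ⟨a, b, ha, hb', hab, rfl, ?_⟩, h1⟩
    rw [← planeLift_proj hn (hb.curve_mem_plane a.1 ha),
      ← planeLift_proj hn (hb.curve_mem_plane b.1 hb')]
    exact congrArg _ (h2.trans h1.symm)
  side j := by
    refine (hb.left j).subset ?_
    rintro t ⟨ht, hbad⟩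
    refine ⟨ht, fun hgood => hbad ?_⟩
    set g := deriv (e j).curve t with hg
    have hperp : n ⬝ᵥ g = 0 := hb.dotProduct_deriv hw j ht
    have hplane := hb.curve_mem_plane j ht
    have hcr : n ⬝ᵥ (n ⨯₃ g) = 0 := dot_self_cross n g
    -- At a zero of the derivative the two test points coincide, so one point would be both in and
    -- out of the region.
    have hg0 : g ≠ 0 := by
      intro h0
      obtain ⟨σ, hσ⟩ := hgood.exists
      simp [h0] at hσ
    refine ⟨((n ⨯₃ g) 0, (n ⨯₃ g) 1), ?_, ?_⟩
    · rw [Edge.deriv_curve_apply (hw j) ht, Edge.deriv_curve_apply (hw j) ht]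
      -- The projected determinant equals `n 2 * |g|²` because `g` is orthogonal to `n`.
      have e1 : g 0 * (n ⨯₃ g) 1 - g 1 * (n ⨯₃ g) 0 = n 2 * (g 0 ^ 2 + g 1 ^ 2 + g 2 ^ 2) := by
        rw [dotProduct_three] at hperp
        simp only [cross_apply, Matrix.cons_val]
        linear_combination (-g 2) * hperp
      have e2 : 0 < g 0 ^ 2 + g 1 ^ 2 + g 2 ^ 2 := by
        by_contra hle
        apply hg0
        ext i
        fin_cases i <;> simp <;> nlinarith [sq_nonneg (g 0), sq_nonneg (g 1), sq_nonneg (g 2)]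
      simp only [← hg]
      rw [e1, ← mul_assoc]
      exact mul_pos (Real.sign_mul_pos_of_ne_zero _ hn) e2
    · filter_upwards [hgood] with σ hσ
      have e1 : ∀ τ : ℝ, planeLift n d
          (((e j).curve t 0, (e j).curve t 1) + τ • ((n ⨯₃ g) 0, (n ⨯₃ g) 1)) =
          (e j).curve t + τ • (n ⨯₃ g) := by
        intro τ
        have : n ⬝ᵥ ((e j).curve t + τ • (n ⨯₃ g)) = d := by
          rw [dotProduct_add, dotProduct_smul, hcr, hplane, smul_zero, add_zero]
        rw [← planeLift_proj hn this]
        rfl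
      have e2 := e1 (-σ)
      rw [neg_smul, neg_smul, ← sub_eq_add_neg, ← sub_eq_add_neg] at e2
      rw [mem_preimage, mem_preimage, e1, e2]
      exact hσ

end IsOrientedBoundary

end CylinderClip

namespace CylinderClip

open Filter Set

/-! ### Lines through a polyhedron -/

namespace Polyhedron

variable (P : Polyhedron)

/-- The union of the straight edges. -/
def skeleton : Set Point := ⋃ e ∈ P.skeletonEdges, segment ℝ e.1 e.2

/-- The parameter at which the line `p + s • v` meets the plane of the `i`-th face. -/
noncomputable def hit (p v : Point) (i : Fin P.numFaces) : ℝ :=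
  (P.offset i - P.normal i ⬝ᵥ p) / (P.normal i ⬝ᵥ v)

open Classical in
/-- The faces which the line `p + s • v` crosses. -/
noncomputable def crossed (p v : Point) : Finset (Fin P.numFaces) :=
  {i | P.normal i ⬝ᵥ v ≠ 0 ∧ p + P.hit p v i • v ∈ P.face i}

variable {P}

theorem face_subset_carrier (i : Fin P.numFaces) : P.face i ⊆ P.carrier := fun _ hp =>
  P.isCompact_carrier.isClosed.frontier_subset (P.frontier_eq ▸ mem_iUnion.2 ⟨i, hp⟩)

theorem eq_hit {p v : Point} {i : Fin P.numFaces} (hi : P.normal i ⬝ᵥ v ≠ 0) {s : ℝ}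
    (hs : p + s • v ∈ P.plane i) : s = P.hit p v i := by
  have h : P.normal i ⬝ᵥ (p + s • v) = P.offset i := hs
  rw [dotProduct_add, dotProduct_smul, smul_eq_mul] at h
  rw [hit, eq_div_iff hi]
  linarith

theorem mem_crossed {p v : Point} {i : Fin P.numFaces} :
    i ∈ P.crossed p v ↔ P.normal i ⬝ᵥ v ≠ 0 ∧ p + P.hit p v i • v ∈ P.face i := by
  simp [crossed]

open Classical in
/-- The indicator of a polyhedron along a line in general position. -/
theorem indicator_line {p v : Point} (hv : v ≠ 0) (hskel : ∀ s : ℝ, p + s • v ∉ P.skeleton)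
    (hface : ∀ i, P.normal i ⬝ᵥ v = 0 → ∀ s : ℝ, p + s • v ∉ P.face i) :
    (∑ i ∈ P.crossed p v, Real.sign (P.normal i ⬝ᵥ v) = 0) ∧
    ∀ s, s ∉ P.hit p v '' P.crossed p v → (if p + s • v ∈ P.carrier then (1 : ℝ) else 0) =
      stepSum (P.crossed p v) (P.hit p v) (fun i => Real.sign (P.normal i ⬝ᵥ v)) s := by
  have hc : Continuous fun s : ℝ => p + s • v := by fun_prop
  obtain ⟨M, hM⟩ := P.isCompact_carrier.isBounded.exists_norm_le
  have hv0 : 0 < ‖v‖ := norm_pos_iff.2 hv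
  have hbd : ∀ s : ℝ, p + s • v ∈ P.carrier → |s| ≤ (M + ‖p‖) / ‖v‖ := by
    intro s hs
    rw [le_div_iff₀ hv0, ← Real.norm_eq_abs, ← norm_smul]
    calc ‖s • v‖ = ‖(p + s • v) - p‖ := by rw [add_sub_cancel_left]
      _ ≤ ‖p + s • v‖ + ‖p‖ := norm_sub_le _ _
      _ ≤ M + ‖p‖ := by gcongr; exact hM _ hs
  have hstep : ∀ s, s ∉ P.hit p v '' P.crossed p v →
      (if p + s • v ∈ P.carrier then (1 : ℝ) else 0) =
      stepSum (P.crossed p v) (P.hit p v) (fun i => Real.sign (P.normal i ⬝ᵥ v)) s := by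
    intro s hs
    refine eq_stepSum _ _ _ (fun s => if p + s • v ∈ P.carrier then (1 : ℝ) else 0)
      ?_ ?_ ?_ ?_ hs
    -- Two faces crossed at the same parameter would meet in a skeleton point, which the line
    -- avoids.
    · intro i hi i' hi' he
      by_contra hne
      refine hskel (P.hit p v i) (P.face_inter_face i i' hne ⟨(mem_crossed.1 hi).2, ?_⟩)
      rw [he]; exact (mem_crossed.1 hi').2
    · filter_upwards [eventually_gt_atTop ((M + ‖p‖) / ‖v‖)] with s hs
      exact if_neg fun h => absurd ((le_abs_self s).trans (hbd s h)) hs.not_ge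
    · intro s hs
      have hfr : p + s • v ∉ frontier P.carrier := by
        rw [P.frontier_eq]
        intro h
        obtain ⟨i, hi⟩ := mem_iUnion.1 h
        by_cases hn : P.normal i ⬝ᵥ v = 0
        · exact hface i hn s hi
        · have := eq_hit hn (P.face_subset_plane i hi)
          exact hs ⟨i, mem_crossed.2 ⟨hn, this ▸ hi⟩, this.symm⟩
      filter_upwards [hc.continuousAt.eventually (eventually_mem_iff_of_notMem_frontier hfr)]
        with s' hs'
      simp only [hs']
    · intro i hi
      -- Near the crossing the solid is a half-space, so the line leaves or enters it according to
      -- the sign of `normal i ⬝ᵥ v`.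
      obtain ⟨hn, hmem⟩ := mem_crossed.1 hi
      have hout := hc.continuousAt.eventually (P.outward i _ hmem (hskel _))
      have hval : ∀ s : ℝ, P.normal i ⬝ᵥ (p + s • v) ≤ P.offset i ↔
          (s - P.hit p v i) * (P.normal i ⬝ᵥ v) ≤ 0 := by
        intro s
        have h : P.normal i ⬝ᵥ (p + P.hit p v i • v) = P.offset i := P.face_subset_plane i hmem
        rw [dotProduct_add, dotProduct_smul, smul_eq_mul] at h ⊢
        rw [← h, sub_mul]
        constructor <;> intro h' <;> linarith
      rcases lt_or_gt_of_ne hn with hlt | hgt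
      · refine ⟨0, 1, ?_, ?_, by rw [Real.sign_of_neg hlt]; norm_num⟩
        · filter_upwards [mem_nhdsWithin_of_mem_nhds hout, self_mem_nhdsWithin] with s hs hs'
          refine if_neg fun h => ?_
          have hs'' := mem_Iio.1 hs'
          have := (hval s).1 (hs.1 h)
          nlinarith
        · filter_upwards [mem_nhdsWithin_of_mem_nhds hout, self_mem_nhdsWithin] with s hs hs'
          have hs'' := mem_Ioi.1 hs'
          exact if_pos (hs.2 ((hval s).2 (by nlinarith)))
      · refine ⟨1, 0, ?_, ?_, by rw [Real.sign_of_pos hgt]; norm_num⟩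
        · filter_upwards [mem_nhdsWithin_of_mem_nhds hout, self_mem_nhdsWithin] with s hs hs'
          have hs'' := mem_Iio.1 hs'
          exact if_pos (hs.2 ((hval s).2 (by nlinarith)))
        · filter_upwards [mem_nhdsWithin_of_mem_nhds hout, self_mem_nhdsWithin] with s hs hs'
          refine if_neg fun h => ?_
          have hs'' := mem_Ioi.1 hs'
          have := (hval s).1 (hs.1 h)
          nlinarith
  refine ⟨sum_jumps_eq_zero _ _ _ (fun s => if p + s • v ∈ P.carrier then (1 : ℝ) else 0) ?_ hstep,
    hstep⟩
  filter_upwards [eventually_lt_atBot (-((M + ‖p‖) / ‖v‖))] with s hs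
  exact if_neg fun h => absurd (abs_le.1 (hbd s h)).1 hs.not_ge

/-- A face fills its plane close to its points off the skeleton. -/
theorem face_mem_nhdsWithin {i : Fin P.numFaces} {q : Point} (hq : q ∈ P.face i)
    (hs : q ∉ P.skeleton) : P.face i ∈ 𝓝[P.plane i] q := by
  have hother : ∀ᶠ q' in 𝓝 q, ∀ j, j ≠ i → q' ∉ P.face j := by
    refine eventually_all.2 fun j => ?_
    by_cases hj : j = i
    · exact Eventually.of_forall fun _ h => absurd hj h
    · have : q ∉ P.face j := fun h => hs (P.face_inter_face j i hj ⟨h, hq⟩)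
      filter_upwards [(P.isClosed_face j).isOpen_compl.mem_nhds this] with q' hq' _ using hq'
  rw [mem_nhdsWithin_iff_eventually]
  filter_upwards [hother, eventually_eventually_nhds.2 (P.outward i q hq hs)] with q' h1 h2 hp
  have hcar : q' ∈ P.carrier := h2.self_of_nhds.2 (le_of_eq hp)
  -- A small move along the outward normal leaves the half-space, hence the solid, so points of the
  -- plane near `q` are frontier points. They lie in some face, and the other faces stay away from
  -- `q`.
  have hfr : q' ∈ frontier P.carrier := by
    refine ⟨subset_closure hcar, fun hint => ?_⟩
    have hc : Continuous fun s : ℝ => q' + s • P.normal i := by fun_prop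
    have ht : Tendsto (fun s : ℝ => q' + s • P.normal i) (𝓝[>] 0) (𝓝 q') := by
      refine (hc.tendsto' 0 q' (by simp)).mono_left nhdsWithin_le_nhds
    obtain ⟨s, ⟨hs1, hs2⟩, hs3⟩ := ((ht.eventually (h2.and (mem_interior_iff_mem_nhds.1 hint))).and
      self_mem_nhdsWithin).exists
    have h3 := hs1.1 hs2
    have hp' : P.normal i ⬝ᵥ q' = P.offset i := hp
    rw [dotProduct_add, dotProduct_smul, smul_eq_mul, hp'] at h3
    have hs0 : 0 < s := hs3
    have hn : 0 < P.normal i ⬝ᵥ P.normal i := by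
      rw [dotProduct_three]
      by_contra hle
      apply P.normal_ne_zero i
      ext k
      fin_cases k <;> simp <;>
        nlinarith [sq_nonneg (P.normal i 0), sq_nonneg (P.normal i 1), sq_nonneg (P.normal i 2)]
    nlinarith [mul_pos hs0 hn]
  rw [P.frontier_eq] at hfr
  obtain ⟨j, hj⟩ := mem_iUnion.1 hfr
  by_cases hji : j = i
  · exact hji ▸ hj
  · exact absurd hj (h1 j hji)

end Polyhedron

/-! ### Clipped faces and integrals along vertical lines. -/

theorem continuous_phi (α β : ℝ) : Continuous (phi α β) := by
  unfold phi; fun_prop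

theorem isClosed_region (α β : ℝ) : IsClosed (region α β) :=
  isClosed_le (continuous_phi α β) continuous_const

/-- The `i`-th face clipped by the cylinder, as an open subset of its plane. -/
def clippedFace (α β : ℝ) (P : Polyhedron) (i : Fin P.numFaces) : Set Point :=
  relInterior (P.plane i) (P.face i ∩ region α β)

theorem mem_clippedFace {α β : ℝ} {P : Polyhedron} {i : Fin P.numFaces} {q : Point}
    (hq : q ∈ P.face i) (hs : q ∉ P.skeleton) (hφ : phi α β q < 0) : q ∈ clippedFace α β P i := by
  refine ⟨P.face_subset_plane i hq, inter_mem (Polyhedron.face_mem_nhdsWithin hq hs) ?_⟩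
  refine mem_nhdsWithin_of_mem_nhds ?_
  filter_upwards [(continuous_phi α β).continuousAt.eventually_lt continuousAt_const hφ] with p hp
  exact le_of_lt hp

section VerticalLines

variable {E : Type*} [NormedAddCommGroup E] [NormedSpace ℝ E] [CompleteSpace E]
variable {α β : ℝ} {P : Polyhedron}

open Classical in
/-- The integral along a vertical line in general position over a clipped polyhedron. -/
theorem integral_vertical (hP : ∀ p ∈ P.carrier, 0 ≤ p 2) {q : ℝ × ℝ}
    (hskel : ∀ z : ℝ, ![q.1, q.2, z] ∉ P.skeleton)
    (hface : ∀ i, P.normal i 2 = 0 → ∀ z : ℝ, ![q.1, q.2, z] ∉ P.face i)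
    (hsurf : 0 ≤ α ^ 2 - β * q.2 ^ 2 → ∀ i, P.normal i 2 ≠ 0 →
      planeHeight (P.normal i) (P.offset i) q.1 q.2 ≠ zSurface α β q.1 q.2)
    {F f : ℝ → E} (hF : ∀ z, HasDerivAt F (f z) z) (hf : Continuous f) (hF0 : F 0 = 0) :
    ∫ z, {z | ![q.1, q.2, z] ∈ P.carrier ∩ region α β}.indicator f z =
      (∑ i, Real.sign (P.normal i 2) •
        if planeLift (P.normal i) (P.offset i) q ∈ clippedFace α β P i
        then F (planeHeight (P.normal i) (P.offset i) q.1 q.2) else 0) +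
      if ![q.1, q.2, zSurface α β q.1 q.2] ∈ P.carrier then F (zSurface α β q.1 q.2) else 0 := by
  have hφ : ∀ z, phi α β ![q.1, q.2, z] = z ^ 2 - (α ^ 2 - β * q.2 ^ 2) := by
    intro z
    simp only [phi, Matrix.cons_val]
    ring
  rcases lt_or_ge (α ^ 2 - β * q.2 ^ 2) 0 with hneg | hpos
  · have hreg : ∀ z, ![q.1, q.2, z] ∉ region α β := by
      intro z hz
      have : phi α β ![q.1, q.2, z] ≤ 0 := hz
      rw [hφ] at this
      nlinarith [sq_nonneg z]
    -- The real square root of a negative number is zero, so `F 0 = 0` removes the surface term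
    -- where there is no surface.
    have hz0 : zSurface α β q.1 q.2 = 0 := Real.sqrt_eq_zero_of_nonpos hneg.le
    rw [hz0, hF0, ite_self, add_zero]
    rw [Finset.sum_eq_zero]
    · refine integral_eq_zero_of_ae (Eventually.of_forall fun z => ?_)
      exact indicator_of_notMem (fun h => hreg z h.2) _
    · intro i _
      rw [if_neg, smul_zero]
      intro h
      exact hreg _ (relInterior_subset h).2
  · set p : Point := ![q.1, q.2, 0] with hp
    set v : Point := ![0, 0, 1] with hv
    have hline : ∀ z : ℝ, p + z • v = ![q.1, q.2, z] := by
      intro z; ext k; fin_cases k <;> simp [hp, hv]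
    have hnv : ∀ i, P.normal i ⬝ᵥ v = P.normal i 2 := by
      intro i; rw [dotProduct_three]; simp [hv]
    have hhit : ∀ i, P.hit p v i = planeHeight (P.normal i) (P.offset i) q.1 q.2 := by
      intro i
      rw [Polyhedron.hit, planeHeight, hnv, dotProduct_three]
      simp only [hp, Matrix.cons_val]
      ring
    have hv0 : v ≠ 0 := by
      intro h
      have := congrFun h 2
      simp [hv] at this
    obtain ⟨hsum, hstep⟩ := Polyhedron.indicator_line (P := P) (p := p) (v := v) hv0
      (fun z => by rw [hline]; exact hskel z)
      (fun i hi z => by rw [hline]; exact hface i (by rwa [hnv] at hi) z)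
    set J := P.crossed p v with hJ
    have hmemJ : ∀ i, i ∈ J ↔ P.normal i 2 ≠ 0 ∧
        planeLift (P.normal i) (P.offset i) q ∈ P.face i := by
      intro i
      rw [hJ, Polyhedron.mem_crossed, hline, hnv, hhit]; rfl
    set b := P.hit p v with hb
    simp only [hnv, hline] at hsum hstep
    set σ : Fin P.numFaces → ℝ := fun i => Real.sign (P.normal i 2) with hσ
    set Z := zSurface α β q.1 q.2 with hZ
    have hZ0 : 0 ≤ Z := Real.sqrt_nonneg _
    have hZ2 : Z ^ 2 = α ^ 2 - β * q.2 ^ 2 := Real.sq_sqrt hpos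
    have hb0 : ∀ i ∈ J, 0 ≤ b i := by
      intro i hi
      have := hP _ (P.face_subset_carrier i ((hmemJ i).1 hi).2)
      rw [hhit]; exact this
    have hbZ : ∀ i ∈ J, b i ≠ Z := fun i hi => by
      rw [hhit]; exact hsurf hpos i ((hmemJ i).1 hi).1
    -- Truncation at `Z` moves every jump above `Z` down to `Z`: the step sum is unchanged below `Z`
    -- and vanishes from `Z` on.
    set b' : Fin P.numFaces → ℝ := fun i => min (b i) Z with hb'
    set χ : ℝ → ℝ := fun z => if ![q.1, q.2, z] ∈ P.carrier ∧ z < Z then 1 else 0 with hχ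
    have hstep' : ∀ z, z ∉ b' '' J → χ z = stepSum J b' σ z := by
      intro z hz
      by_cases hzZ : z < Z
      · have : χ z = if ![q.1, q.2, z] ∈ P.carrier then 1 else 0 := by simp [hχ, hzZ]
        rw [this, hstep z]
        · refine Finset.sum_congr rfl fun i _ => ?_
          simp [hb', hzZ]
        · rintro ⟨i, hi, rfl⟩
          exact hz ⟨i, hi, min_eq_left hzZ.le⟩
      · have : χ z = 0 := by simp [hχ, hzZ]
        rw [this, stepSum, Finset.sum_eq_zero]
        intro i _
        exact if_neg fun h => hzZ (lt_of_lt_of_le h (min_le_right _ _))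
    have key := integral_smul_of_eq_stepSum J b' σ χ hsum hstep' (a := 0) (c := Z)
      (fun i hi => ⟨le_min (hb0 i hi) hZ0, min_le_right _ _⟩) hZ0 (fun z _ => hF z) hf.continuousOn
    have hset : ∀ z, ![q.1, q.2, z] ∈ P.carrier ∩ region α β ↔
        ![q.1, q.2, z] ∈ P.carrier ∧ 0 ≤ z ∧ z ≤ Z := by
      intro z
      refine and_congr_right fun hz => ?_
      have hz0 : 0 ≤ z := hP _ hz
      have : ![q.1, q.2, z] ∈ region α β ↔ phi α β ![q.1, q.2, z] ≤ 0 := Iff.rfl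
      rw [this, hφ, ← hZ2]
      constructor
      · intro h; exact ⟨hz0, by nlinarith⟩
      · intro h; nlinarith
    have hleft : ∫ z, {z | ![q.1, q.2, z] ∈ P.carrier ∩ region α β}.indicator f z =
        ∫ z in (0 : ℝ)..Z, χ z • f z := by
      rw [intervalIntegral.integral_of_le hZ0, integral_Ioc_eq_integral_Ioo,
        ← integral_Icc_eq_integral_Ioo]
      rw [← setIntegral_eq_integral_of_forall_compl_eq_zero (s := Icc 0 Z)]
      · rw [integral_Icc_eq_integral_Ioo, integral_Icc_eq_integral_Ioo]
        refine setIntegral_congr_fun measurableSet_Ioo fun z hz => ?_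
        simp only [indicator_apply, mem_ofPred_eq, hset, hχ, hz.1.le, hz.2.le, hz.2, and_true]
        split_ifs <;> simp
      · intro z hz
        rw [indicator_apply, if_neg]
        exact fun h => hz ((hset z).1 h).2
    rw [hleft, key]
    -- The jumps above `Z` add up to the value of the indicator at `Z`; this produces the surface
    -- term.
    have hZstep : (∑ i ∈ J, if Z < b i then σ i else 0) =
        if ![q.1, q.2, Z] ∈ P.carrier then 1 else 0 := by
      rw [hstep Z]
      · rfl
      · rintro ⟨i, hi, he⟩
        exact hbZ i hi he
    have hright : ∑ i ∈ J, σ i • F (b' i) =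
        (∑ i ∈ J, if b i < Z then σ i • F (b i) else 0) +
          (∑ i ∈ J, if Z < b i then σ i else 0) • F Z := by
      rw [Finset.sum_smul, ← Finset.sum_add_distrib]
      refine Finset.sum_congr rfl fun i hi => ?_
      rcases lt_or_gt_of_ne (hbZ i hi) with h | h
      · simp [hb', h, h.le, h.not_gt]
      · simp [hb', h, h.le, h.not_gt]
    rw [hright, hZstep]
    congr 1
    · rw [← Finset.sum_subset (Finset.subset_univ J)]
      · refine Finset.sum_congr rfl fun i hi => ?_
        obtain ⟨hn, hfi⟩ := (hmemJ i).1 hi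
        -- Heights are non-negative, so lying strictly inside the cylinder amounts to lying below
        -- `Z`; equality is excluded by general position.
        have hiff : planeLift (P.normal i) (P.offset i) q ∈ clippedFace α β P i ↔ b i < Z := by
          constructor
          · intro h
            have := ((hset _).1 ⟨P.face_subset_carrier i hfi, (relInterior_subset h).2⟩).2.2
            refine lt_of_le_of_ne ?_ (hbZ i hi)
            rw [hhit]; exact this
          · intro h
            refine mem_clippedFace hfi (hskel _) ?_
            have h1 : phi α β (planeLift (P.normal i) (P.offset i) q) = b i ^ 2 - Z ^ 2 := by
              rw [hZ2, hhit]; exact hφ _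
            rw [h1]
            nlinarith [hb0 i hi]
        by_cases h : b i < Z
        · rw [if_pos h, if_pos (hiff.2 h), hhit]
        · rw [if_neg h, if_neg (fun h' => h (hiff.1 h')), smul_zero]
      · intro i _ hi
        by_cases hn : P.normal i 2 = 0
        · rw [hn, Real.sign_zero, zero_smul]
        · rw [if_neg, smul_zero]
          intro h
          exact hi ((hmemJ i).2 ⟨hn, (relInterior_subset h).1⟩)
    · split_ifs <;> simp

end VerticalLines

end CylinderClip

namespace CylinderClip

open Filter Set

variable {E : Type*} [NormedAddCommGroup E] [NormedSpace ℝ E]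

/-! ### Null sets of the plane -/

theorem ae_of_eventually_cofinite {p : ℝ → Prop} (h : ∀ᶠ v in cofinite, p v) : ∀ᵐ v, p v :=
  (measure_mono_null (fun _ hv => hv) (Set.Finite.measure_zero h volume) : _)

/-- Fubini: finite slices are null, and finitely many exceptional heights do not matter. -/
theorem ae_notMem_of_slices {N : Set (ℝ × ℝ)} (hN : IsClosed N)
    (h : ∀ᶠ y in cofinite, {x | (x, y) ∈ N}.Finite) : ∀ᵐ q, q ∉ N := by
  have h1 : volume (Prod.swap ⁻¹' N) = 0 := by
    rw [Measure.volume_eq_prod,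
      Measure.measure_prod_null (hN.preimage continuous_swap).measurableSet]
    filter_upwards [ae_of_eventually_cofinite h] with y hy
    exact hy.measure_zero volume
  have hmp : MeasurePreserving (Prod.swap : ℝ × ℝ → ℝ × ℝ) := by
    rw [Measure.volume_eq_prod]; exact Measure.measurePreserving_swap
  rw [hmp.measure_preimage hN.measurableSet.nullMeasurableSet] at h1
  exact measure_eq_zero_iff_ae_notMem.1 h1

theorem ae_notMem_line {A B : ℝ} (hAB : A ≠ 0 ∨ B ≠ 0) (C : ℝ) :
    ∀ᵐ q : ℝ × ℝ, A * q.1 + B * q.2 ≠ C := by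
  refine ae_notMem_of_slices (N := {q | A * q.1 + B * q.2 = C})
    (isClosed_eq (by fun_prop) continuous_const) ?_
  by_cases hA : A = 0
  · have hB : B ≠ 0 := hAB.resolve_left (not_not.2 hA)
    filter_upwards [(finite_singleton (C / B)).compl_mem_cofinite] with y hy
    convert finite_empty (α := ℝ)
    ext x
    simp only [mem_ofPred_eq, mem_empty_iff_false, iff_false, hA, zero_mul, zero_add]
    intro h
    exact hy (by rw [← h, mul_div_cancel_left₀ _ hB]; rfl)
  · refine Eventually.of_forall fun y => Set.Subsingleton.finite fun x hx x' hx' => ?_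
    have h1 : A * x + B * y = C := hx
    have h2 : A * x' + B * y = C := hx'
    exact mul_left_cancel₀ hA (by linarith)

/-- A line which is not parallel to the `x`-axis meets the cylinder in finitely many points. -/
theorem finite_conic {α β : ℝ} (hα : 0 < α) (hβ : β ≠ 0) (A B : ℝ) {C : ℝ} (hC : C ≠ 0) :
    {y : ℝ | (A + B * y) ^ 2 = C ^ 2 * (α ^ 2 - β * y ^ 2)}.Finite := by
  set p : Polynomial ℝ := (Polynomial.C A + Polynomial.C B * Polynomial.X) ^ 2 -
    Polynomial.C (C ^ 2) * (Polynomial.C (α ^ 2) - Polynomial.C β * Polynomial.X ^ 2) with hp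
  have hev : ∀ y, p.eval y = (A + B * y) ^ 2 - C ^ 2 * (α ^ 2 - β * y ^ 2) := by
    intro y; simp [hp]
  have hp0 : p ≠ 0 := by
    intro h0
    have e0 := hev 0
    have e1 := hev 1
    have e2 := hev (-1)
    rw [h0, Polynomial.eval_zero] at e0 e1 e2
    -- The values at `1` and `-1` differ by `4AB`. The value at `0` makes `A` non-zero, so `B = 0`,
    -- and then the values at `0` and `1` give `C²β = 0`.
    have hAB : A * B = 0 := by linarith
    have hA : A ≠ 0 := by
      rintro rfl
      have : 0 < C ^ 2 * α ^ 2 := by positivity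
      linarith
    have hB : B = 0 := (mul_eq_zero.1 hAB).resolve_left hA
    subst hB
    have : C ^ 2 * β = 0 := by linarith
    exact (mul_ne_zero (pow_ne_zero 2 hC) hβ) this
  refine (Polynomial.finite_setOfPred_isRoot hp0).subset fun y hy => ?_
  have hy' : (A + B * y) ^ 2 = C ^ 2 * (α ^ 2 - β * y ^ 2) := hy
  change p.eval y = 0
  rw [hev, hy', sub_self]

theorem integrableOn_of_isBounded {F : Type*} [NormedAddCommGroup F] {g : ℝ × ℝ → F}
    (hg : Continuous g)
    {s : Set (ℝ × ℝ)} (hs : Bornology.IsBounded s) : IntegrableOn g s :=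
  (hg.continuousOn.integrableOn_compact hs.isCompact_closure).mono_set subset_closure

/-- Fubini's theorem for vertical lines. -/
theorem integral_point {f : Point → E} (hf : Integrable f) :
    ∫ p, f p = ∫ q : ℝ × ℝ, ∫ z, f ![q.1, q.2, z] := by
  have h1 := volume_preserving_piFinSuccAbove (fun _ : Fin 3 => ℝ) 2
  have h2 : MeasurePreserving (Prod.map id MeasurableEquiv.finTwoArrow :
      ℝ × (Fin 2 → ℝ) → ℝ × (ℝ × ℝ)) := by
    rw [Measure.volume_eq_prod, Measure.volume_eq_prod]
    exact (MeasurePreserving.id volume).prod (volume_preserving_finTwoArrow ℝ)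
  set ψ : Point ≃ᵐ ℝ × (ℝ × ℝ) := (MeasurableEquiv.piFinSuccAbove (fun _ : Fin 3 => ℝ) 2).trans
    ((MeasurableEquiv.refl ℝ).prodCongr MeasurableEquiv.finTwoArrow) with hψ
  have h3 : MeasurePreserving ψ := h2.comp h1
  have hψs : ∀ z (q : ℝ × ℝ), ψ.symm (z, q) = ![q.1, q.2, z] := by
    intro z q
    rw [MeasurableEquiv.symm_apply_eq]
    rfl
  have h4 := h3.symm.integral_comp' (g := f)
  rw [← h4, Measure.volume_eq_prod, integral_prod_symm]
  · simp only [hψs]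
  · rw [← Measure.volume_eq_prod]
    exact (h3.symm.integrable_comp_emb ψ.symm.measurableEmbedding).2 hf

/-! ### The divergence theorem in the vertical direction -/

/-- The closed form of `bigPhi`. -/
noncomputable def phiVec (p : Point) : Fin 4 → ℝ := ![p 2, p 0 * p 2, p 1 * p 2, 1 / 2 * p 2 ^ 2]

theorem hasDerivAt_phiVec (x y z : ℝ) :
    HasDerivAt (fun z => phiVec ![x, y, z]) (upsilon ![x, y, z]) z := by
  refine hasDerivAt_pi.2 fun k => ?_
  fin_cases k
  · simpa [phiVec, upsilon] using hasDerivAt_id' z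
  · simpa [phiVec, upsilon] using (hasDerivAt_id z).const_mul x
  · simpa [phiVec, upsilon] using (hasDerivAt_id z).const_mul y
  · change HasDerivAt (fun z : ℝ => 1 / 2 * z ^ 2) z z
    exact ((hasDerivAt_pow 2 z).const_mul (1 / 2 : ℝ)).congr_deriv (by push_cast; ring)

theorem continuous_upsilon : Continuous upsilon := by
  unfold upsilon
  refine continuous_pi fun k => ?_
  fin_cases k <;> simp <;> fun_prop

theorem continuous_phiVec : Continuous phiVec := by
  unfold phiVec
  refine continuous_pi fun k => ?_
  fin_cases k <;> simp <;> fun_prop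

theorem phiVec_zero (x y : ℝ) : phiVec ![x, y, 0] = 0 := by
  ext k; fin_cases k <;> simp [phiVec]

theorem bigPhi_eq (p : Point) : bigPhi p = phiVec p := by
  have hp : ![p 0, p 1, p 2] = p := by ext k; fin_cases k <;> rfl
  rw [bigPhi, intervalIntegral.integral_eq_sub_of_hasDerivAt
    (fun s _ => hasDerivAt_phiVec (p 0) (p 1) s), phiVec_zero, sub_zero, hp]
  refine Continuous.intervalIntegrable (continuous_upsilon.comp ?_) _ _
  refine continuous_pi fun k => ?_
  fin_cases k <;> simp <;> fun_prop

theorem continuous_vec {X : Type*} [TopologicalSpace X] {f g h : X → ℝ} (hf : Continuous f)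
    (hg : Continuous g) (hh : Continuous h) : Continuous fun q => (![f q, g q, h q] : Point) := by
  refine continuous_pi fun k => ?_
  fin_cases k
  · exact hf
  · exact hg
  · exact hh

theorem continuous_zSurface (α β : ℝ) : Continuous fun q : ℝ × ℝ => zSurface α β q.1 q.2 := by
  unfold zSurface; fun_prop

/-- The part of the `xy`-plane below the clipped surface. -/
def surfaceShadow (α β : ℝ) (P : Polyhedron) : Set (ℝ × ℝ) :=
  {q | ![q.1, q.2, zSurface α β q.1 q.2] ∈ P.carrier}

variable {α β : ℝ} {P : Polyhedron}

theorem isClosed_surfaceShadow : IsClosed (surfaceShadow α β P) :=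
  P.isCompact_carrier.isClosed.preimage
    (continuous_vec continuous_fst continuous_snd (continuous_zSurface α β))

theorem isBounded_surfaceShadow : Bornology.IsBounded (surfaceShadow α β P) :=
  isBounded_of_lift P.isCompact_carrier.isBounded (g := fun q => zSurface α β q.1 q.2)
    fun _ hq => hq

/-! ### General position of vertical lines. -/

theorem ae_vertical_skeleton (P : Polyhedron) :
    ∀ᵐ q : ℝ × ℝ, ∀ z : ℝ, ![q.1, q.2, z] ∉ P.skeleton := by
  have h : ∀ e ∈ P.skeletonEdges, ∀ᵐ q : ℝ × ℝ, ∀ z : ℝ, ![q.1, q.2, z] ∉ segment ℝ e.1 e.2 := by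
    rintro ⟨a, b⟩ _
    -- The projected segment lies in a line of the `xy`-plane; when it degenerates to a point, the
    -- line `x = a 0` serves.
    by_cases hab : b 1 - a 1 ≠ 0 ∨ -(b 0 - a 0) ≠ 0
    · filter_upwards [ae_notMem_line hab ((b 1 - a 1) * a 0 + -(b 0 - a 0) * a 1)] with q hq z hz
      obtain ⟨s, t, _, _, hst, hz⟩ := hz
      have h0 := congrFun hz 0
      have h1 := congrFun hz 1
      simp only [Pi.add_apply, Pi.smul_apply, smul_eq_mul, Matrix.cons_val] at h0 h1
      apply hq
      have hs : s = 1 - t := by linarith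
      rw [← h0, ← h1, hs]; ring
    · simp only [not_or, not_not] at hab
      filter_upwards [ae_notMem_line (A := 1) (B := 0) (Or.inl one_ne_zero) (a 0)] with q hq z hz
      obtain ⟨s, t, _, _, hst, hz⟩ := hz
      have h0 := congrFun hz 0
      simp only [Pi.add_apply, Pi.smul_apply, smul_eq_mul, Matrix.cons_val] at h0
      apply hq
      have hs : s = 1 - t := by linarith
      have hb : b 0 = a 0 := by linarith [hab.2]
      rw [← h0, hs, hb]; ring
  filter_upwards [(Finset.eventually_all P.skeletonEdges).2 h] with q hq z hz
  obtain ⟨e, he, hz⟩ := mem_iUnion₂.1 hz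
  exact hq e he z hz

theorem ae_vertical_face (P : Polyhedron) : ∀ᵐ q : ℝ × ℝ, ∀ i, P.normal i 2 = 0 →
    ∀ z : ℝ, ![q.1, q.2, z] ∉ P.face i := by
  refine ae_all_iff.2 fun i => ?_
  by_cases hn : P.normal i 2 = 0
  · have h01 : P.normal i 0 ≠ 0 ∨ P.normal i 1 ≠ 0 := by
      by_contra hcon
      simp only [not_or, not_not] at hcon
      apply P.normal_ne_zero i
      ext k
      fin_cases k
      · exact hcon.1
      · exact hcon.2
      · exact hn
    filter_upwards [ae_notMem_line h01 (P.offset i)] with q hq _ z hz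
    have h := P.face_subset_plane i hz
    change P.normal i ⬝ᵥ ![q.1, q.2, z] = P.offset i at h
    rw [dotProduct_three, hn] at h
    simp only [Matrix.cons_val, zero_mul, add_zero] at h
    exact hq h
  · exact Eventually.of_forall fun q h => absurd h hn

/-- The upper sheet has constant height at fixed `y`, so a plane with `n 0 ≠ 0` meets it for at most
one `x`. If `n 0 = 0`, meeting it restricts `y` to the finite set of `finite_conic`. -/
theorem ae_vertical_surface (hα : 0 < α) (hβ : β ≠ 0) (P : Polyhedron) :
    ∀ᵐ q : ℝ × ℝ, 0 ≤ α ^ 2 - β * q.2 ^ 2 → ∀ i, P.normal i 2 ≠ 0 →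
      planeHeight (P.normal i) (P.offset i) q.1 q.2 ≠ zSurface α β q.1 q.2 := by
  have h : ∀ i, ∀ᵐ q : ℝ × ℝ, 0 ≤ α ^ 2 - β * q.2 ^ 2 → P.normal i 2 ≠ 0 →
      planeHeight (P.normal i) (P.offset i) q.1 q.2 ≠ zSurface α β q.1 q.2 := by
    intro i
    by_cases hn : P.normal i 2 = 0
    · exact Eventually.of_forall fun q _ h => absurd hn h
    · set N : Set (ℝ × ℝ) := {q | 0 ≤ α ^ 2 - β * q.2 ^ 2 ∧
        planeHeight (P.normal i) (P.offset i) q.1 q.2 = zSurface α β q.1 q.2}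
      have hNc : IsClosed N := by
        have h1 : Continuous fun q : ℝ × ℝ => α ^ 2 - β * q.2 ^ 2 := by fun_prop
        have h2 : Continuous fun q : ℝ × ℝ =>
            planeHeight (P.normal i) (P.offset i) q.1 q.2 := by unfold planeHeight; fun_prop
        exact (isClosed_le continuous_const h1).inter (isClosed_eq h2 (continuous_zSurface α β))
      have hN := ae_notMem_of_slices hNc ?_
      · filter_upwards [hN] with q hq h0 _ he
        exact hq ⟨h0, he⟩
      by_cases hn0 : P.normal i 0 = 0
      · filter_upwards [(finite_conic hα hβ (P.offset i) (-P.normal i 1) hn).compl_mem_cofinite]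
          with y hy
        convert finite_empty (α := ℝ)
        ext x
        simp only [mem_ofPred_eq, mem_empty_iff_false, iff_false]
        rintro ⟨h0, he⟩
        apply hy
        simp only [planeHeight, hn0, zero_mul, sub_zero, zSurface] at he h0
        rw [div_eq_iff hn] at he
        have : P.offset i + -P.normal i 1 * y = √(α ^ 2 - β * y ^ 2) * P.normal i 2 := by
          rw [← he]; ring
        rw [mem_ofPred_eq, this, mul_pow, Real.sq_sqrt h0, mul_comm]
      · refine Eventually.of_forall fun y => Set.Subsingleton.finite fun x hx x' hx' => ?_
        have h1 := hx.2
        have h2 := hx'.2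
        simp only [planeHeight, zSurface] at h1 h2
        rw [← h2, div_left_inj' hn] at h1
        exact mul_left_cancel₀ hn0 (by linarith)
  filter_upwards [ae_all_iff.2 h] with q hq h0 i hn
  exact hq i h0 hn

/-- The moments of a clipped polyhedron as integrals over the shadows of its clipped faces and of
the clipped surface. -/
theorem moments_eq (hα : 0 < α) (hβ : β ≠ 0) (hP : ∀ p ∈ P.carrier, 0 ≤ p 2) :
    moments (P.carrier ∩ region α β) =
      (∑ i, Real.sign (P.normal i 2) •
        ∫ q in planeLift (P.normal i) (P.offset i) ⁻¹' clippedFace α β P i,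
          phiVec (planeLift (P.normal i) (P.offset i) q)) +
      ∫ q in surfaceShadow α β P, phiVec ![q.1, q.2, zSurface α β q.1 q.2] := by
  classical
  have hcl : IsClosed (P.carrier ∩ region α β) :=
    P.isCompact_carrier.isClosed.inter (isClosed_region α β)
  have hint : Integrable ((P.carrier ∩ region α β).indicator upsilon) := by
    rw [integrable_indicator_iff hcl.measurableSet]
    exact continuous_upsilon.continuousOn.integrableOn_compact
      (P.isCompact_carrier.inter_right (isClosed_region α β))
  rw [moments, ← integral_indicator hcl.measurableSet, integral_point hint]
  have hS : Integrable ((surfaceShadow α β P).indicator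
      fun q => phiVec ![q.1, q.2, zSurface α β q.1 q.2]) := by
    rw [integrable_indicator_iff isClosed_surfaceShadow.measurableSet]
    exact integrableOn_of_isBounded (continuous_phiVec.comp
      (continuous_vec continuous_fst continuous_snd (continuous_zSurface α β)))
      isBounded_surfaceShadow
  have hm : ∀ i, P.normal i 2 ≠ 0 →
      MeasurableSet (planeLift (P.normal i) (P.offset i) ⁻¹' clippedFace α β P i) :=
    fun i hn => (isOpen_planeLift_preimage hn _ _).measurableSet
  have hF : ∀ i, P.normal i 2 ≠ 0 →
      Integrable ((planeLift (P.normal i) (P.offset i) ⁻¹' clippedFace α β P i).indicator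
        fun q => phiVec (planeLift (P.normal i) (P.offset i) q)) := by
    intro i hn
    rw [integrable_indicator_iff (hm i hn)]
    exact integrableOn_of_isBounded (continuous_phiVec.comp (continuous_planeLift _ _))
      (isBounded_of_lift P.isCompact_carrier.isBounded fun q hq =>
        P.face_subset_carrier i (relInterior_subset hq).1)
  have hF' : ∀ i, Integrable (fun q => Real.sign (P.normal i 2) •
      (planeLift (P.normal i) (P.offset i) ⁻¹' clippedFace α β P i).indicator
        (fun q => phiVec (planeLift (P.normal i) (P.offset i) q)) q) := by
    intro i
    by_cases hn : P.normal i 2 = 0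
    · simp [hn]
    · exact (hF i hn).smul (Real.sign (P.normal i 2))
  have hpt : ∀ᵐ q : ℝ × ℝ, ∫ z, (P.carrier ∩ region α β).indicator upsilon ![q.1, q.2, z] =
      (∑ i, Real.sign (P.normal i 2) •
        (planeLift (P.normal i) (P.offset i) ⁻¹' clippedFace α β P i).indicator
          (fun q => phiVec (planeLift (P.normal i) (P.offset i) q)) q) +
      (surfaceShadow α β P).indicator
        (fun q => phiVec ![q.1, q.2, zSurface α β q.1 q.2]) q := by
    filter_upwards [ae_vertical_skeleton P, ae_vertical_face P, ae_vertical_surface hα hβ P]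
      with q h1 h2 h3
    exact integral_vertical hP h1 h2 h3 (hasDerivAt_phiVec q.1 q.2)
      (continuous_upsilon.comp (continuous_vec continuous_const continuous_const continuous_id))
      (phiVec_zero q.1 q.2)
  rw [integral_congr_ae hpt, integral_add (integrable_finsetSum _ fun i _ => hF' i) hS,
    integral_finsetSum _ fun i _ => hF' i, integral_indicator isClosed_surfaceShadow.measurableSet]
  congr 1
  refine Finset.sum_congr rfl fun i _ => ?_
  rw [integral_smul]
  by_cases hn : P.normal i 2 = 0
  · simp [hn]
  · rw [integral_indicator (hm i hn)]

end CylinderClip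

namespace CylinderClip

open Filter Set

/-! ### The divergence theorem on the clipped surface -/

theorem zSurface_of_mem {α β : ℝ} {p : Point} (hp : p ∈ surface α β) (h0 : 0 ≤ p 2) (x : ℝ) :
    zSurface α β x (p 1) = p 2 := by
  have h : phi α β p = 0 := hp
  have : α ^ 2 - β * p 1 ^ 2 = p 2 ^ 2 := by
    unfold phi at h; linarith
  rw [zSurface, this, Real.sqrt_sq h0]

/-- On a segment along which `y` varies, `z` is affine in `y`, and the cylinder equation becomes a
non-trivial quadratic equation in `y`. The lemma discards the levels of skeleton points and of
straight edges. -/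
theorem finite_segment_inter_surface {α β : ℝ} (hα : 0 < α) (hβ : β ≠ 0) (a b : Point) :
    {y | ∃ p ∈ segment ℝ a b, p ∈ surface α β ∧ p 1 = y}.Finite := by
  by_cases hd : b 1 - a 1 = 0
  · refine (finite_singleton (a 1)).subset ?_
    rintro y ⟨p, ⟨s, t, _, _, hst, rfl⟩, _, rfl⟩
    have hs : s = 1 - t := by linarith
    have hb : b 1 = a 1 := by linarith
    simp only [Pi.add_apply, Pi.smul_apply, smul_eq_mul, hb, hs, mem_singleton_iff]
    ring
  · refine (finite_conic hα hβ (a 2 * (b 1 - a 1) - a 1 * (b 2 - a 2)) (b 2 - a 2) hd).subset ?_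
    rintro y ⟨p, ⟨s, t, _, _, hst, rfl⟩, hS, rfl⟩
    have hs : s = 1 - t := by linarith
    have h : phi α β (s • a + t • b) = 0 := hS
    simp only [phi, Pi.add_apply, Pi.smul_apply, smul_eq_mul, hs] at h
    simp only [Pi.add_apply, Pi.smul_apply, smul_eq_mul, hs, mem_ofPred_eq]
    linear_combination (b 1 - a 1) ^ 2 * h

/-- A plane parallel to the `x`-axis is a line in the coordinates `y, z`, and this line meets the
conic in finitely many points. -/
theorem finite_plane_inter_surface {α β : ℝ} (hα : 0 < α) (hβ : β ≠ 0) {n : Point} (hn : n ≠ 0)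
    (hn0 : n 0 = 0) (d : ℝ) : {y | ∃ p, n ⬝ᵥ p = d ∧ p ∈ surface α β ∧ p 1 = y}.Finite := by
  by_cases hn2 : n 2 = 0
  · refine (finite_singleton (d / n 1)).subset ?_
    rintro y ⟨p, hp, _, rfl⟩
    have hn1 : n 1 ≠ 0 := by
      intro hn1
      apply hn
      ext k
      fin_cases k
      · exact hn0
      · exact hn1
      · exact hn2
    rw [dotProduct_three, hn0, hn2] at hp
    rw [mem_singleton_iff, eq_div_iff hn1]
    linarith
  · refine (finite_conic hα hβ d (-n 1) hn2).subset ?_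
    rintro y ⟨p, hp, hS, rfl⟩
    have h : phi α β p = 0 := hS
    rw [dotProduct_three, hn0] at hp
    simp only [phi] at h
    have e : d + -n 1 * p 1 = n 2 * p 2 := by linarith
    rw [mem_ofPred_eq, e]
    linear_combination n 2 ^ 2 * h

theorem contDiff_psiR : ContDiff ℝ 1 psiR := by
  unfold psiR
  refine contDiff_pi.2 fun k => ?_
  fin_cases k <;> simp <;> fun_prop

theorem hasDerivAt_psiR (x y z : ℝ) :
    HasDerivAt (fun x => psiR ![x, y, z]) (phiVec ![x, y, z]) x := by
  refine hasDerivAt_pi.2 fun k => ?_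
  fin_cases k
  · change HasDerivAt (fun x : ℝ => x * z) z x
    exact ((hasDerivAt_id' x).mul_const z).congr_deriv (one_mul z)
  · change HasDerivAt (fun x : ℝ => 1 / 2 * x ^ 2 * z) (x * z) x
    exact (((hasDerivAt_pow 2 x).const_mul (1 / 2 : ℝ)).mul_const z).congr_deriv
      (by push_cast; ring)
  · change HasDerivAt (fun x : ℝ => x * y * z) (y * z) x
    exact (((hasDerivAt_id' x).mul_const y).mul_const z).congr_deriv (by ring)
  · change HasDerivAt (fun x : ℝ => 1 / 2 * x * z ^ 2) (1 / 2 * z ^ 2) x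
    exact (((hasDerivAt_id' x).const_mul (1 / 2 : ℝ)).mul_const (z ^ 2)).congr_deriv (by ring)

theorem phi_add_smul (α β : ℝ) (p c : Point) (s : ℝ) :
    phi α β (p + s • c) = phi α β p + s * (2 * (β * p 1 * c 1 + p 2 * c 2)) +
      s ^ 2 * (β * c 1 ^ 2 + c 2 ^ 2) := by
  simp only [phi, Pi.add_apply, Pi.smul_apply, smul_eq_mul]
  ring

namespace Edge

theorem continuousOn_deriv_curve {e : Edge} (hw : e.onSurface = true → 0 < e.weight) :
    ContinuousOn (deriv e.curve) (Icc 0 1) := by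
  refine continuousOn_pi.2 fun i => ?_
  exact (tame_curve hw i).continuousOn_deriv.congr fun t ht => (deriv_curve_apply hw ht i).symm

theorem continuousOn_curve {e : Edge} (hw : e.onSurface = true → 0 < e.weight) :
    ContinuousOn e.curve (Icc 0 1) :=
  fun _ ht => (hasDerivAt_curve hw ht).continuousAt.continuousWithinAt

end Edge

/-! ### Edges of clipped faces: incidence, tangency and orientation. -/

namespace ClippedEdges

variable {α β : ℝ} {P : Polyhedron}

theorem curve_mem_face (E : ClippedEdges α β P) (i : Fin P.numFaces) (j : Fin (E.numEdges i))
    {t : ℝ} (ht : t ∈ Icc (0 : ℝ) 1) : (E.edge i j).curve t ∈ P.face i :=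
  closure_minimal (fun _ hp => (relInterior_subset hp).1) (P.isClosed_face i)
    ((E.isOrientedBoundary i).curve_mem_closure j ht).1

theorem curve_mem_surface (E : ClippedEdges α β P) {i : Fin P.numFaces} {j : Fin (E.numEdges i)}
    (h : (E.edge i j).onSurface = true) {t : ℝ} (ht : t ∈ Icc (0 : ℝ) 1) :
    (E.edge i j).curve t ∈ surface α β :=
  ((E.onSurface_iff i j).1 h t ht).1.1

theorem dotProduct_curve (E : ClippedEdges α β P) (i : Fin P.numFaces) (j : Fin (E.numEdges i))
    {t : ℝ} (ht : t ∈ Icc (0 : ℝ) 1) : P.normal i ⬝ᵥ (E.edge i j).curve t = P.offset i :=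
  P.face_subset_plane i (E.curve_mem_face i j ht)

theorem dotProduct_deriv_curve (E : ClippedEdges α β P) (i : Fin P.numFaces)
    (j : Fin (E.numEdges i)) {t : ℝ} (ht : t ∈ Icc (0 : ℝ) 1) :
    P.normal i ⬝ᵥ deriv (E.edge i j).curve t = 0 :=
  (E.isOrientedBoundary i).dotProduct_deriv (E.weight_pos i) j ht

theorem deriv_curve_tangent (E : ClippedEdges α β P) {i : Fin P.numFaces} {j : Fin (E.numEdges i)}
    (h : (E.edge i j).onSurface = true) {t : ℝ} (ht : t ∈ Icc (0 : ℝ) 1) :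
    β * (E.edge i j).curve t 1 * deriv (E.edge i j).curve t 1 +
      (E.edge i j).curve t 2 * deriv (E.edge i j).curve t 2 = 0 := by
  have hd := hasDerivAt_pi.1 (Edge.hasDerivAt_curve (E.weight_pos i j) ht)
  have h1 : HasDerivAt (fun t => phi α β ((E.edge i j).curve t))
      (β * (2 * (E.edge i j).curve t 1 * deriv (E.edge i j).curve t 1) +
        2 * (E.edge i j).curve t 2 * deriv (E.edge i j).curve t 2) t := by
    unfold phi
    refine (((((hd 1).pow 2).const_mul β).add ((hd 2).pow 2)).sub_const (α ^ 2)).congr_deriv ?_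
    push_cast; ring
  have h2 : HasDerivWithinAt (fun t => phi α β ((E.edge i j).curve t)) 0 (Icc 0 1) t :=
    (hasDerivWithinAt_const t (Icc 0 1) (0 : ℝ)).congr
      (fun s hs => E.curve_mem_surface h hs) (E.curve_mem_surface h ht)
  have := (uniqueDiffOn_Icc zero_lt_one t ht).eq_deriv _ h1.hasDerivWithinAt h2
  linarith

/-- On the clipped surface the sign of `y'` along an edge is opposite to that of the
`x`-component of the normal of the face. -/
theorem sign_deriv_curve (E : ClippedEdges α β P) {i : Fin P.numFaces} {j : Fin (E.numEdges i)}
    (h : (E.edge i j).onSurface = true) {t : ℝ} (ht : t ∈ Icc (0 : ℝ) 1)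
    (hleft : ∀ᶠ s in 𝓝[>] (0 : ℝ), (E.edge i j).curve t +
      s • (P.normal i ⨯₃ deriv (E.edge i j).curve t) ∈ clippedFace α β P i)
    (hz : 0 < (E.edge i j).curve t 2) (hn : P.normal i 0 ≠ 0)
    (hy : deriv (E.edge i j).curve t 1 ≠ 0) :
    Real.sign (deriv (E.edge i j).curve t 1) = -Real.sign (P.normal i 0) := by
  have hperp := E.dotProduct_deriv_curve i j ht
  have htan := E.deriv_curve_tangent h ht
  have hφ : phi α β ((E.edge i j).curve t) = 0 := E.curve_mem_surface h ht
  set p := (E.edge i j).curve t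
  set g := deriv (E.edge i j).curve t
  set n := P.normal i
  set c := n ⨯₃ g with hc
  -- Moving to the left of the edge stays inside the clipped face, where `phi ≤ 0`; as `phi`
  -- vanishes at `p`, its derivative in that direction is not positive.
  have hle : 2 * (β * p 1 * c 1 + p 2 * c 2) ≤ 0 := by
    have hlim : Tendsto (fun s : ℝ => 2 * (β * p 1 * c 1 + p 2 * c 2) +
        s * (β * c 1 ^ 2 + c 2 ^ 2)) (𝓝[>] 0) (𝓝 (2 * (β * p 1 * c 1 + p 2 * c 2))) := by
      refine Tendsto.mono_left ?_ nhdsWithin_le_nhds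
      exact Continuous.tendsto' (by fun_prop) _ _ (by simp)
    refine le_of_tendsto hlim ?_
    filter_upwards [hleft, self_mem_nhdsWithin] with s hs hs0
    have hs0' : 0 < s := hs0
    have h1 : phi α β (p + s • c) ≤ 0 := (relInterior_subset hs).2
    rw [phi_add_smul, hφ] at h1
    by_contra hcon
    have := mul_pos hs0' (not_le.1 hcon)
    nlinarith
  rw [dotProduct_three] at hperp
  have hK : 0 < n 0 ^ 2 * (p 2 ^ 2 + β ^ 2 * p 1 ^ 2) + (p 2 * n 1 - β * p 1 * n 2) ^ 2 := by
    have : 0 < n 0 ^ 2 := by positivity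
    have : 0 < p 2 ^ 2 := by positivity
    have : 0 ≤ β ^ 2 * p 1 ^ 2 := by positivity
    positivity
  -- Orthogonality to `n` and tangency to the cylinder express this derivative, up to the factor `p
  -- 2 * n 0`, as `g 1` times the positive quantity of `hK`.
  have hid : (β * p 1 * c 1 + p 2 * c 2) * (p 2 * n 0) =
      g 1 * (n 0 ^ 2 * (p 2 ^ 2 + β ^ 2 * p 1 ^ 2) + (p 2 * n 1 - β * p 1 * n 2) ^ 2) := by
    simp only [hc, cross_apply, Matrix.cons_val]
    linear_combination (β * p 1 * n 2 - p 2 * n 1) * p 2 * hperp +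
      (-β * p 1 * n 0 ^ 2 - (β * p 1 * n 2 - p 2 * n 1) * n 2) * htan
  have hprod : g 1 * n 0 < 0 := by
    have h1 : g 1 * n 0 * (n 0 ^ 2 * (p 2 ^ 2 + β ^ 2 * p 1 ^ 2) +
        (p 2 * n 1 - β * p 1 * n 2) ^ 2) ≤ 0 := by
      have h0 : 0 ≤ p 2 * n 0 ^ 2 := by positivity
      have h3 := mul_nonpos_of_nonpos_of_nonneg hle h0
      have h4 : g 1 * n 0 * (n 0 ^ 2 * (p 2 ^ 2 + β ^ 2 * p 1 ^ 2) +
          (p 2 * n 1 - β * p 1 * n 2) ^ 2) =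
          (β * p 1 * c 1 + p 2 * c 2) * (p 2 * n 0 ^ 2) := by linear_combination -n 0 * hid
      linarith
    have h2 : g 1 * n 0 ≠ 0 := mul_ne_zero hy hn
    rcases lt_or_gt_of_ne h2 with h3 | h3
    · exact h3
    · exact absurd h1 (not_le.2 (mul_pos h3 hK))
  rcases lt_or_gt_of_ne hn with h1 | h1
  · rw [Real.sign_of_neg h1, Real.sign_of_pos (by nlinarith)]; norm_num
  · rw [Real.sign_of_pos h1, Real.sign_of_neg (by nlinarith)]

end ClippedEdges

variable {α β : ℝ} {P : Polyhedron}

/-- A point of a face on the cylinder is a relative boundary point of the clipped face. -/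
theorem mem_closure_clippedFace_diff {i : Fin P.numFaces} {q : Point} (hq : q ∈ P.face i)
    (hs : q ∉ P.skeleton) (hn : P.normal i 0 ≠ 0) (hφ : q ∈ surface α β) (hz : 0 < q 2) :
    q ∈ closure (clippedFace α β P i) \ clippedFace α β P i := by
  -- A direction in the plane of the face with `y` fixed and `z` increasing: along it `phi` equals
  -- `s * (2 z + s)`, negative for small `s < 0` and positive for `s > 0`.
  set v : Point := ![-P.normal i 2 / P.normal i 0, 0, 1] with hv
  have hnv : P.normal i ⬝ᵥ v = 0 := by
    rw [dotProduct_three]; simp only [hv, Matrix.cons_val]; field_simp; ring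
  have hplane : ∀ s : ℝ, q + s • v ∈ P.plane i := by
    intro s
    have : P.normal i ⬝ᵥ q = P.offset i := P.face_subset_plane i hq
    change P.normal i ⬝ᵥ (q + s • v) = P.offset i
    rw [dotProduct_add, dotProduct_smul, hnv, smul_zero, add_zero, this]
  have hφs : ∀ s : ℝ, phi α β (q + s • v) = s * (2 * q 2 + s) := by
    intro s
    have h0 : phi α β q = 0 := hφ
    rw [phi_add_smul, h0]
    simp only [hv, Matrix.cons_val]; ring
  have htend : Tendsto (fun s : ℝ => q + s • v) (𝓝 0) (𝓝[P.plane i] q) := by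
    refine tendsto_nhdsWithin_iff.2 ⟨?_, Eventually.of_forall hplane⟩
    exact Continuous.tendsto' (by fun_prop) _ _ (by simp)
  have hface := P.face_mem_nhdsWithin hq hs
  constructor
  · refine mem_closure_of_tendsto (b := 𝓝[<] (0 : ℝ)) (f := fun s : ℝ => q + s • v) ?_ ?_
    · exact (htend.mono_left nhdsWithin_le_nhds).mono_right nhdsWithin_le_nhds
    · filter_upwards [(htend.mono_left nhdsWithin_le_nhds).eventually
        (eventually_eventually_nhdsWithin.2 hface), self_mem_nhdsWithin,
        mem_nhdsWithin_of_mem_nhds (Ioi_mem_nhds (show -q 2 < 0 by linarith))] with s h1 h2 h3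
      refine ⟨hplane s, inter_mem h1 (mem_nhdsWithin_of_mem_nhds ?_)⟩
      have h2' : s < 0 := h2
      have h3' : -q 2 < s := h3
      have : phi α β (q + s • v) < 0 := by rw [hφs]; nlinarith
      filter_upwards [(continuous_phi α β).continuousAt.eventually_lt continuousAt_const this]
        with p hp using le_of_lt hp
  · intro hR
    have h1 : ∀ᶠ s in 𝓝[>] (0 : ℝ), q + s • v ∈ P.face i ∩ region α β :=
      (htend.mono_left nhdsWithin_le_nhds).eventually hR.2
    obtain ⟨s, hs1, hs2⟩ := (h1.and self_mem_nhdsWithin).exists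
    have hs2' : 0 < s := hs2
    have : phi α β (q + s • v) ≤ 0 := hs1.2
    rw [hφs] at this
    nlinarith

/-- The sum of the level sums over the edges of the clipped surface in a face. -/
noncomputable def surfaceLevelSum (E : ClippedEdges α β P) (i : Fin P.numFaces) (v : ℝ) :
    Fin 4 → ℝ :=
  ∑ j, (E.edge i j).indicator • levelSum (fun t => (E.edge i j).curve t 1)
    (fun t => psiR ((E.edge i j).curve t)) v

-- At a generic level `v`, a point of a marked edge lies on the ruling of the upper sheet over `y =
-- v`, hence where this ruling crosses the plane of the face. Conversely a crossing point in the
-- face is a relative boundary point of the clipped face, so it lies on an edge, and only on one.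
open Classical in
theorem surfaceLevelSum_eq (hα : 0 < α) (hβ : β ≠ 0) (hP : ∀ p ∈ P.carrier, 0 ≤ p 2)
    (E : ClippedEdges α β P) (i : Fin P.numFaces) :
    ∀ᶠ v in cofinite, surfaceLevelSum E i v =
      if 0 < α ^ 2 - β * v ^ 2 ∧ i ∈ P.crossed ![0, v, zSurface α β 0 v] ![1, 0, 0] then
        -Real.sign (P.normal i 0) •
          psiR ![P.hit ![0, v, zSurface α β 0 v] ![1, 0, 0] i, v, zSurface α β 0 v]
      else 0 := by
  have hb := E.isOrientedBoundary i
  have g0 : ∀ᶠ v in cofinite, α ^ 2 - β * v ^ 2 ≠ 0 := by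
    refine ((finite_conic hα hβ 0 0 one_ne_zero).subset fun v hv => ?_).compl_mem_cofinite
    have : α ^ 2 - β * v ^ 2 = 0 := hv
    simp [this]
  have g1 : ∀ᶠ v in cofinite, P.normal i 0 = 0 →
      v ∉ {y | ∃ p, P.normal i ⬝ᵥ p = P.offset i ∧ p ∈ surface α β ∧ p 1 = y} := by
    by_cases hn : P.normal i 0 = 0
    · filter_upwards [(finite_plane_inter_surface hα hβ (P.normal_ne_zero i) hn
        (P.offset i)).compl_mem_cofinite] with v hv _ using hv
    · exact Eventually.of_forall fun _ h => absurd h hn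
  have g2 : ∀ᶠ v in cofinite, ∀ e ∈ P.skeletonEdges,
      v ∉ {y | ∃ p ∈ segment ℝ e.1 e.2, p ∈ surface α β ∧ p 1 = y} :=
    (Finset.eventually_all P.skeletonEdges).2 fun e _ =>
      (finite_segment_inter_surface hα hβ e.1 e.2).compl_mem_cofinite
  have g3 : ∀ᶠ v in cofinite, ∀ j, v ∉ {y | ∃ p ∈ segment ℝ (E.edge i j).source (E.edge i j).target,
      p ∈ surface α β ∧ p 1 = y} :=
    eventually_all.2 fun j => (finite_segment_inter_surface hα hβ _ _).compl_mem_cofinite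
  have g4 := (hb.finite_meet.image fun p => p 1).compl_mem_cofinite
  have g5 : ∀ᶠ v in cofinite, ∀ j, v ∉ (fun t => (E.edge i j).curve t 1) '' {t : ℝ |
      t ∈ Icc 0 1 ∧ ¬ ∀ᶠ s in 𝓝[>] (0 : ℝ),
      (E.edge i j).curve t + s • (P.normal i ⨯₃ deriv (E.edge i j).curve t) ∈ clippedFace α β P i ∧
      (E.edge i j).curve t - s • (P.normal i ⨯₃ deriv (E.edge i j).curve t) ∉
        clippedFace α β P i} :=
    eventually_all.2 fun j => ((hb.left j).image _).compl_mem_cofinite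
  have g6 : ∀ᶠ v in cofinite, ∀ j, ∀ t ∈ Icc (0 : ℝ) 1, (E.edge i j).curve t 1 = v →
      deriv (fun t => (E.edge i j).curve t 1) t ≠ 0 :=
    eventually_all.2 fun j => (Edge.tame_curve (E.weight_pos i j) 1).regular.mono fun _ h => h.2
  filter_upwards [g0, g1, g2, g3, g4, g5, g6] with v g0 g1 g2 g3 g4 g5 g6
  set z := zSurface α β 0 v with hz
  set p₀ : Point := ![0, v, z] with hp₀
  set e₁ : Point := ![1, 0, 0] with he₁
  have hline : ∀ x : ℝ, p₀ + x • e₁ = ![x, v, z] := by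
    intro x; ext k; fin_cases k <;> simp [hp₀, he₁]
  have hne : P.normal i ⬝ᵥ e₁ = P.normal i 0 := by
    rw [dotProduct_three]; simp [he₁]
  -- points of the edges of the clipped surface
  have hpoint : ∀ j, (E.edge i j).onSurface = true → ∀ t ∈ Icc (0 : ℝ) 1,
      (E.edge i j).curve t 1 = v →
      0 < α ^ 2 - β * v ^ 2 ∧ i ∈ P.crossed p₀ e₁ ∧
        (E.edge i j).curve t = ![P.hit p₀ e₁ i, v, z] := by
    intro j hj t ht htv
    have hS := E.curve_mem_surface hj ht
    have hF := E.curve_mem_face i j ht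
    have h0 := hP _ (P.face_subset_carrier i hF)
    have hzz : (E.edge i j).curve t 2 = z := by
      rw [hz, ← zSurface_of_mem hS h0 0, htv]
    have hpos : 0 < α ^ 2 - β * v ^ 2 := by
      have h : phi α β ((E.edge i j).curve t) = 0 := hS
      unfold phi at h
      rw [htv] at h
      refine lt_of_le_of_ne ?_ g0.symm
      nlinarith [sq_nonneg ((E.edge i j).curve t 2)]
    have hn : P.normal i 0 ≠ 0 := fun hn =>
      g1 hn ⟨_, P.face_subset_plane i hF, hS, htv⟩
    have hq : (E.edge i j).curve t = p₀ + (E.edge i j).curve t 0 • e₁ := by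
      rw [hline, ← htv, ← hzz]
      ext k; fin_cases k <;> rfl
    have hx : (E.edge i j).curve t 0 = P.hit p₀ e₁ i := by
      refine P.eq_hit (by rwa [hne]) ?_
      rw [← hq]; exact P.face_subset_plane i hF
    rw [hx] at hq
    exact ⟨hpos, P.mem_crossed.2 ⟨by rwa [hne], hq ▸ hF⟩, by rw [hq, hline]⟩
  by_cases hcr : 0 < α ^ 2 - β * v ^ 2 ∧ i ∈ P.crossed p₀ e₁
  · rw [if_pos hcr]
    obtain ⟨hpos, hcr⟩ := hcr
    obtain ⟨hn, hF⟩ := P.mem_crossed.1 hcr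
    rw [hne] at hn
    rw [hline] at hF
    set q : Point := ![P.hit p₀ e₁ i, v, z] with hq
    have hz0 : 0 < z := Real.sqrt_pos.2 hpos
    have hzsq : z ^ 2 = α ^ 2 - β * v ^ 2 := Real.sq_sqrt hpos.le
    have hS : q ∈ surface α β := by
      change phi α β q = 0
      simp only [phi, hq, Matrix.cons_val]
      linarith
    have hskel : q ∉ P.skeleton := by
      intro h
      obtain ⟨e, he, hqe⟩ := mem_iUnion₂.1 h
      exact g2 e he ⟨q, hqe, hS, rfl⟩
    have hbd := mem_closure_clippedFace_diff hF hskel hn hS hz0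
    have hbd' : q ∈ ⋃ j, (E.edge i j).curve '' Icc 0 1 := hb.image_eq ▸ hbd
    obtain ⟨j, t, ht, hjt⟩ := mem_iUnion.1 hbd'
    have htv : (E.edge i j).curve t 1 = v := by rw [hjt]; rfl
    -- An unmarked edge is a segment, and the level was chosen away from its finitely many meetings
    -- with the cylinder.
    have hj : (E.edge i j).onSurface = true := by
      by_contra hj
      refine g3 j ⟨q, ?_, hS, rfl⟩
      rw [← hjt, Edge.curve, if_neg hj]
      exact ⟨1 - t, t, by linarith [ht.2], ht.1, by ring, rfl⟩
    have huniq : ∀ j' t', t' ∈ Icc (0 : ℝ) 1 → (E.edge i j').curve t' = q → j' = j ∧ t' = t := by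
      intro j' t' ht' h'
      by_contra hcon
      refine g4 ⟨q, ⟨(j, t), (j', t'), ht, ht', ?_, hjt, h'⟩, rfl⟩
      intro hh
      rw [Prod.mk.injEq] at hh
      exact hcon ⟨hh.1.symm, hh.2.symm⟩
    rw [surfaceLevelSum, Finset.sum_eq_single j]
    · have hlev : {t | t ∈ Icc (0 : ℝ) 1 ∧ (E.edge i j).curve t 1 = v} = {t} := by
        ext t'
        simp only [mem_ofPred_eq, mem_singleton_iff]
        constructor
        · rintro ⟨ht', h'⟩
          exact (huniq j t' ht' (hpoint j hj t' ht' h').2.2).2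
        · rintro rfl
          exact ⟨ht, htv⟩
      have hind : (E.edge i j).indicator = 1 := if_pos hj
      have hleft : ∀ᶠ s in 𝓝[>] (0 : ℝ), (E.edge i j).curve t +
          s • (P.normal i ⨯₃ deriv (E.edge i j).curve t) ∈ clippedFace α β P i := by
        by_contra hcon
        refine g5 j ⟨t, ⟨ht, fun h => hcon (h.mono fun s hs => hs.1)⟩, htv⟩
      have hy := g6 j t ht htv
      rw [Edge.deriv_curve_apply (E.weight_pos i j) ht] at hy
      have hzc : 0 < (E.edge i j).curve t 2 := by rw [hjt]; exact hz0
      rw [hind, one_smul, levelSum, hlev, finsum_mem_singleton,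
        Edge.deriv_curve_apply (E.weight_pos i j) ht, E.sign_deriv_curve hj ht hleft hzc hn hy, hjt]
    · intro j' _ hne'
      by_cases hj' : (E.edge i j').onSurface = true
      · have hlev : {t | t ∈ Icc (0 : ℝ) 1 ∧ (E.edge i j').curve t 1 = v} = ∅ := by
          ext t'
          simp only [mem_ofPred_eq, mem_empty_iff_false, iff_false]
          rintro ⟨ht', h'⟩
          exact hne' (huniq j' t' ht' (hpoint j' hj' t' ht' h').2.2).1
        rw [levelSum, hlev, finsum_mem_empty, smul_zero]
      · rw [Edge.indicator, if_neg hj', zero_smul]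
    · exact fun h => absurd (Finset.mem_univ j) h
  · rw [if_neg hcr, surfaceLevelSum]
    refine Finset.sum_eq_zero fun j _ => ?_
    by_cases hj : (E.edge i j).onSurface = true
    · have hlev : {t | t ∈ Icc (0 : ℝ) 1 ∧ (E.edge i j).curve t 1 = v} = ∅ := by
        ext t'
        simp only [mem_ofPred_eq, mem_empty_iff_false, iff_false]
        rintro ⟨ht', h'⟩
        have := hpoint j hj t' ht' h'
        exact hcr ⟨this.1, this.2.1⟩
      rw [levelSum, hlev, finsum_mem_empty, smul_zero]
    · rw [Edge.indicator, if_neg hj, zero_smul]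

-- The slice of the shadow at `y = v` is the trace of the solid on a ruling of the cylinder, so the
-- jump formula applies; `psiR` is an `x`-primitive because `z` is constant there.
open Classical in
theorem integral_surface_slice (hα : 0 < α) (hβ : β ≠ 0) (P : Polyhedron) :
    ∀ᶠ v in cofinite, ∫ x, (surfaceShadow α β P).indicator
        (fun q => phiVec ![q.1, q.2, zSurface α β q.1 q.2]) (x, v) =
      ∑ i, if 0 < α ^ 2 - β * v ^ 2 ∧ i ∈ P.crossed ![0, v, zSurface α β 0 v] ![1, 0, 0] then
        Real.sign (P.normal i 0) •
          psiR ![P.hit ![0, v, zSurface α β 0 v] ![1, 0, 0] i, v, zSurface α β 0 v]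
      else 0 := by
  have g1 : ∀ᶠ v in cofinite, ∀ i, P.normal i 0 = 0 →
      v ∉ {y | ∃ p, P.normal i ⬝ᵥ p = P.offset i ∧ p ∈ surface α β ∧ p 1 = y} := by
    refine eventually_all.2 fun i => ?_
    by_cases hn : P.normal i 0 = 0
    · filter_upwards [(finite_plane_inter_surface hα hβ (P.normal_ne_zero i) hn
        (P.offset i)).compl_mem_cofinite] with v hv _ using hv
    · exact Eventually.of_forall fun _ h => absurd h hn
  have g2 : ∀ᶠ v in cofinite, ∀ e ∈ P.skeletonEdges,
      v ∉ {y | ∃ p ∈ segment ℝ e.1 e.2, p ∈ surface α β ∧ p 1 = y} :=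
    (Finset.eventually_all P.skeletonEdges).2 fun e _ =>
      (finite_segment_inter_surface hα hβ e.1 e.2).compl_mem_cofinite
  filter_upwards [g1, g2] with v g1 g2
  have hzx : ∀ x, zSurface α β x v = zSurface α β 0 v := fun _ => rfl
  set z := zSurface α β 0 v with hz
  rcases le_or_gt (α ^ 2 - β * v ^ 2) 0 with hneg | hpos
  · have hz0 : z = 0 := Real.sqrt_eq_zero_of_nonpos hneg
    rw [Finset.sum_eq_zero fun i _ => if_neg fun h => absurd h.1 hneg.not_gt]
    refine integral_eq_zero_of_ae (Eventually.of_forall fun x => ?_)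
    simp only [indicator_apply, hzx, hz0, phiVec_zero, ite_self, Pi.zero_apply]
  · set p₀ : Point := ![0, v, z] with hp₀
    set e₁ : Point := ![1, 0, 0] with he₁
    have hline : ∀ x : ℝ, p₀ + x • e₁ = ![x, v, z] := by
      intro x; ext k; fin_cases k <;> simp [hp₀, he₁]
    have hne : ∀ i, P.normal i ⬝ᵥ e₁ = P.normal i 0 := by
      intro i; rw [dotProduct_three]; simp [he₁]
    have he0 : e₁ ≠ 0 := by
      intro h
      have := congrFun h 0
      simp [he₁] at this
    have hzsq : z ^ 2 = α ^ 2 - β * v ^ 2 := Real.sq_sqrt hpos.le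
    have hS : ∀ x, (![x, v, z] : Point) ∈ surface α β := by
      intro x
      change phi α β ![x, v, z] = 0
      simp only [phi, Matrix.cons_val]
      linarith
    obtain ⟨hsum, hstep⟩ := Polyhedron.indicator_line (P := P) (p := p₀) (v := e₁) he0
      (fun x hx => by
        rw [hline] at hx
        obtain ⟨e, he, hqe⟩ := mem_iUnion₂.1 hx
        exact g2 e he ⟨_, hqe, hS x, rfl⟩)
      (fun i hi x hx => by
        rw [hline] at hx
        rw [hne] at hi
        exact g1 i hi ⟨_, P.face_subset_plane i hx, hS x, rfl⟩)
    simp only [hne, hline] at hsum hstep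
    have key := integral_univ_smul_of_eq_stepSum (P.crossed p₀ e₁) (P.hit p₀ e₁) _
      (fun x => if ![x, v, z] ∈ P.carrier then (1 : ℝ) else 0) hsum hstep
      (F := fun x => psiR ![x, v, z]) (fun x => hasDerivAt_psiR x v z)
      (continuous_phiVec.comp (continuous_vec continuous_id continuous_const continuous_const))
    have hL : ∀ x, (surfaceShadow α β P).indicator
        (fun q => phiVec ![q.1, q.2, zSurface α β q.1 q.2]) (x, v) =
        (if ![x, v, z] ∈ P.carrier then (1 : ℝ) else 0) • phiVec ![x, v, z] := by
      intro x
      simp only [indicator_apply, surfaceShadow, mem_ofPred_eq, hzx]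
      split_ifs <;> simp
    simp only [hL]
    refine key.trans ?_
    simp only [hpos, true_and]
    rw [Finset.sum_ite_mem, Finset.univ_inter]

/-- The level sums of the marked edges are the negatives of the jump terms on the rulings; the area
formula then integrates over the levels. How the marked edges fit together on the surface never
matters. -/
theorem integral_surfaceShadow (hα : 0 < α) (hβ : β ≠ 0) (hP : ∀ p ∈ P.carrier, 0 ≤ p 2)
    (E : ClippedEdges α β P) :
    ∫ q in surfaceShadow α β P, phiVec ![q.1, q.2, zSurface α β q.1 q.2] =
      ∑ i, ∑ j, (-(E.edge i j).indicator) • ∫ t in (0 : ℝ)..1,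
        deriv (fun s => (E.edge i j).curve s 1) t • psiR ((E.edge i j).curve t) := by
  classical
  have harea : ∀ i j, _ := fun i (j : Fin (E.numEdges i)) =>
    integrable_levelSum_and_integral (Edge.tame_curve (E.weight_pos i j) 1)
      (G := fun t => psiR ((E.edge i j).curve t))
      (G' := fun t => fderiv ℝ psiR ((E.edge i j).curve t) (deriv (E.edge i j).curve t))
      (fun t ht => ((contDiff_psiR.differentiable one_ne_zero).differentiableAt.hasFDerivAt
        ).comp_hasDerivAt t (Edge.hasDerivAt_curve (E.weight_pos i j) ht))
      (((contDiff_psiR.continuous_fderiv one_ne_zero).comp_continuousOn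
        (Edge.continuousOn_curve (E.weight_pos i j))).clm_apply
        (Edge.continuousOn_deriv_curve (E.weight_pos i j)))
  have hS : Integrable ((surfaceShadow α β P).indicator
      fun q => phiVec ![q.1, q.2, zSurface α β q.1 q.2]) := by
    rw [integrable_indicator_iff isClosed_surfaceShadow.measurableSet]
    exact integrableOn_of_isBounded (continuous_phiVec.comp
      (continuous_vec continuous_fst continuous_snd (continuous_zSurface α β)))
      isBounded_surfaceShadow
  have hslice : ∀ᵐ v, ∫ x, (surfaceShadow α β P).indicator
        (fun q => phiVec ![q.1, q.2, zSurface α β q.1 q.2]) (x, v) =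
      ∑ i, ∑ j, (-(E.edge i j).indicator) • levelSum (fun t => (E.edge i j).curve t 1)
        (fun t => psiR ((E.edge i j).curve t)) v := by
    refine ae_of_eventually_cofinite ?_
    filter_upwards [integral_surface_slice hα hβ P,
      eventually_all.2 fun i => surfaceLevelSum_eq hα hβ hP E i] with v h1 h2
    rw [h1]
    refine Finset.sum_congr rfl fun i _ => ?_
    have h3 := h2 i
    rw [surfaceLevelSum] at h3
    simp only [neg_smul]
    rw [Finset.sum_neg_distrib, h3]
    split_ifs
    · rw [neg_smul, neg_neg]
    · rw [neg_zero]
  have hint : ∀ i, ∀ j : Fin (E.numEdges i), Integrable fun v => (-(E.edge i j).indicator) •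
      levelSum (fun t => (E.edge i j).curve t 1) (fun t => psiR ((E.edge i j).curve t)) v :=
    fun i j => (harea i j).1.smul (-(E.edge i j).indicator)
  rw [← integral_indicator isClosed_surfaceShadow.measurableSet, Measure.volume_eq_prod,
    integral_prod_symm _ (by rw [← Measure.volume_eq_prod]; exact hS), integral_congr_ae hslice,
    integral_finsetSum _ fun i _ => integrable_finsetSum _ fun j _ => hint i j]
  refine Finset.sum_congr rfl fun i _ => ?_
  rw [integral_finsetSum _ fun j _ => hint i j]
  refine Finset.sum_congr rfl fun j _ => ?_
  rw [integral_smul, (harea i j).2]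

end CylinderClip

namespace CylinderClip

open Filter Set

/-! ### Integrands of the planar faces -/

/-- The integrand of a planar face on which `z` has slope `s` in the direction of `x`. -/
noncomputable def psiF (s : ℝ) (p : Point) : Fin 4 → ℝ :=
  ![p 0 * p 2 - s / 2 * p 0 ^ 2, 1 / 2 * p 0 ^ 2 * p 2 - s / 6 * p 0 ^ 3,
    p 1 * (p 0 * p 2 - s / 2 * p 0 ^ 2),
    1 / 2 * p 0 * p 2 ^ 2 - s * (1 / 2 * p 0 ^ 2 * p 2 - s / 6 * p 0 ^ 3)]

theorem contDiff_psiF (s : ℝ) {m : WithTop ℕ∞} : ContDiff ℝ m (psiF s) := by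
  unfold psiF
  refine contDiff_pi.2 fun k => ?_
  fin_cases k <;> simp <;> fun_prop

theorem hasDerivAt_psiF {s x y : ℝ} {z : ℝ → ℝ} (hz : HasDerivAt z s x) :
    HasDerivAt (fun x => psiF s ![x, y, z x]) (phiVec ![x, y, z x]) x := by
  have hx := hasDerivAt_id' x
  have h1 : HasDerivAt (fun x => x * z x - s / 2 * x ^ 2) (z x) x :=
    ((hx.mul hz).sub ((hx.pow 2).const_mul (s / 2))).congr_deriv (by push_cast; ring)
  have h2 : HasDerivAt (fun x => 1 / 2 * x ^ 2 * z x - s / 6 * x ^ 3) (x * z x) x :=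
    ((((hx.pow 2).const_mul (1 / 2)).mul hz).sub ((hx.pow 3).const_mul (s / 6))).congr_deriv
      (by simp only [Pi.pow_apply]; push_cast; ring)
  refine hasDerivAt_pi.2 fun k => ?_
  fin_cases k
  · exact h1
  · exact h2
  · exact h1.const_mul y
  · refine (((hx.const_mul (1 / 2 : ℝ)).mul (hz.pow 2)).sub (h2.const_mul s)).congr_deriv ?_
    change _ = 1 / 2 * z x ^ 2
    simp only [Pi.pow_apply]
    push_cast; ring

theorem psiF_zero (s y z : ℝ) : psiF s ![0, y, z] = 0 := by
  ext k; fin_cases k <;> simp [psiF]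

theorem psiR_zero (y z : ℝ) : psiR ![0, y, z] = 0 := by
  ext k; fin_cases k <;> simp [psiR]

/-- The height of the upper sheet does not depend on `x`, so `psiR` at that fixed height is the
primitive. -/
theorem bigPsi_zSurface (α β x y : ℝ) :
    bigPsi (zSurface α β) x y = psiR ![x, y, zSurface α β x y] := by
  have h : ∀ u ∈ uIcc 0 x, HasDerivAt (fun u => psiR ![u, y, zSurface α β x y])
      (bigPhi ![u, y, zSurface α β u y]) u := by
    intro u _
    rw [bigPhi_eq]
    exact hasDerivAt_psiR u y _
  rw [bigPsi, intervalIntegral.integral_eq_sub_of_hasDerivAt h, psiR_zero, sub_zero]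
  refine Continuous.intervalIntegrable ?_ _ _
  simp only [bigPhi_eq]
  exact continuous_phiVec.comp (continuous_vec continuous_id continuous_const continuous_const)

theorem bigPsi_zSurface_of_mem {α β : ℝ} {p : Point} (hp : p ∈ surface α β) (h0 : 0 ≤ p 2) :
    bigPsi (zSurface α β) (p 0) (p 1) = psiR p := by
  rw [bigPsi_zSurface, zSurface_of_mem hp h0]
  congr 1
  ext k; fin_cases k <;> rfl

theorem hasDerivAt_planeHeight (n : Point) (d x y : ℝ) :
    HasDerivAt (fun x => planeHeight n d x y) (-n 0 / n 2) x := by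
  unfold planeHeight
  refine ((((hasDerivAt_id' x).const_mul (n 0)).const_sub d).sub_const (n 1 * y)).div_const
    (n 2) |>.congr_deriv ?_
  ring

theorem bigPsi_zFace {P : Polyhedron} {i : Fin P.numFaces} (hn : P.normal i 2 ≠ 0) {p : Point}
    (hp : p ∈ P.plane i) :
    bigPsi (P.zFace i) (p 0) (p 1) = psiF (-P.normal i 0 / P.normal i 2) p := by
  have h : ∀ u ∈ uIcc 0 (p 0), HasDerivAt
      (fun u => psiF (-P.normal i 0 / P.normal i 2) ![u, p 1, P.zFace i u (p 1)])
      (bigPhi ![u, p 1, P.zFace i u (p 1)]) u := by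
    intro u _
    rw [bigPhi_eq]
    exact hasDerivAt_psiF (hasDerivAt_planeHeight (P.normal i) (P.offset i) u (p 1))
  rw [bigPsi, intervalIntegral.integral_eq_sub_of_hasDerivAt h, psiF_zero, sub_zero]
  · exact congrArg _ (planeLift_proj hn hp)
  · refine Continuous.intervalIntegrable ?_ _ _
    simp only [bigPhi_eq]
    refine continuous_phiVec.comp (continuous_vec continuous_id continuous_const ?_)
    unfold Polyhedron.zFace
    fun_prop

theorem contDiff_planeLift (n : Point) (d : ℝ) {m : WithTop ℕ∞} : ContDiff ℝ m (planeLift n d) := by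
  unfold planeLift planeHeight
  refine contDiff_pi.2 fun k => ?_
  fin_cases k <;> simp <;> fun_prop

theorem fderiv_psiF_planeLift (n : Point) (d : ℝ) (q : ℝ × ℝ) :
    fderiv ℝ (fun q => psiF (-n 0 / n 2) (planeLift n d q)) q (1, 0) =
      phiVec (planeLift n d q) := by
  have h1 : HasFDerivAt (fun q => psiF (-n 0 / n 2) (planeLift n d q)) _ q :=
    ((((contDiff_psiF _).comp (contDiff_planeLift n d)).differentiable
      one_ne_zero).differentiableAt (x := q)).hasFDerivAt
  have h2 : HasDerivAt (fun x : ℝ => (x, q.2)) ((1 : ℝ), (0 : ℝ)) q.1 :=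
    (hasDerivAt_id' q.1).prodMk (hasDerivAt_const _ _)
  have h3 := HasFDerivAt.comp_hasDerivAt (f := fun x : ℝ => (x, q.2)) q.1 h1 h2
  exact h3.unique (hasDerivAt_psiF (hasDerivAt_planeHeight n d q.1 q.2))

/-- The divergence theorem on a clipped face. -/
theorem integral_clippedFace {α β : ℝ} {P : Polyhedron} (E : ClippedEdges α β P)
    {i : Fin P.numFaces} (hn : P.normal i 2 ≠ 0) :
    Real.sign (P.normal i 2) • ∫ q in planeLift (P.normal i) (P.offset i) ⁻¹' clippedFace α β P i,
      phiVec (planeLift (P.normal i) (P.offset i) q) =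
    ∑ j, ∫ t in (0 : ℝ)..1, deriv (fun s => (E.edge i j).curve s 1) t •
      psiF (-P.normal i 0 / P.normal i 2) ((E.edge i j).curve t) := by
  have hb := (E.isOrientedBoundary i).isPlanarBoundary (E.weight_pos i) hn
    (P.isCompact_carrier.isBounded.subset
      (inter_subset_left.trans (P.face_subset_carrier i)))
  have h := hb.green (f := fun q => psiF (-P.normal i 0 / P.normal i 2)
    (planeLift (P.normal i) (P.offset i) q))
    ((contDiff_psiF _).comp (contDiff_planeLift _ _))
  simp only [fderiv_psiF_planeLift] at h
  refine h.trans (Finset.sum_congr rfl fun j _ => intervalIntegral.integral_congr fun t ht => ?_)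
  rw [uIcc_of_le zero_le_one] at ht
  simp only [planeLift_proj hn (E.dotProduct_curve i j ht)]

/-! ### Integrals along chords -/

/-- The hypothesis says that `f` is its own cubic Lagrange interpolant at `0, 1, 2, 3`; the weights
`9, 19, -5, 1` over `24` are the integrals of the Lagrange basis over `[0, 1]`. -/
theorem integral_cubic {f : ℝ → Fin 4 → ℝ}
    (hf : ∀ t k, f t k = -((t - 1) * (t - 2) * (t - 3) / 6) * f 0 k +
      t * (t - 2) * (t - 3) / 2 * f 1 k - t * (t - 1) * (t - 3) / 2 * f 2 k +
      t * (t - 1) * (t - 2) / 6 * f 3 k) :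
    ∫ t in (0 : ℝ)..1, f t =
      (1 / 24 : ℝ) • ((9 : ℝ) • f 0 + (19 : ℝ) • f 1 - (5 : ℝ) • f 2 + f 3) := by
  have hc : Continuous f := continuous_pi fun k => by
    rw [funext fun t => hf t k]; fun_prop
  have hp : ∀ (n : ℕ) (t : ℝ), HasDerivAt (fun t : ℝ => t ^ (n + 1) / (n + 1 : ℝ)) (t ^ n) t := by
    intro n t
    refine ((hasDerivAt_pow (n + 1) t).div_const _).congr_deriv ?_
    have : (n + 1 : ℝ) ≠ 0 := by positivity
    push_cast; field_simp
  set F : ℝ → Fin 4 → ℝ := fun t k =>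
    -(t ^ 4 / 4 - 6 * (t ^ 3 / 3) + 11 * (t ^ 2 / 2) - 6 * t) / 6 * f 0 k +
    (t ^ 4 / 4 - 5 * (t ^ 3 / 3) + 6 * (t ^ 2 / 2)) / 2 * f 1 k -
    (t ^ 4 / 4 - 4 * (t ^ 3 / 3) + 3 * (t ^ 2 / 2)) / 2 * f 2 k +
    (t ^ 4 / 4 - 3 * (t ^ 3 / 3) + 2 * (t ^ 2 / 2)) / 6 * f 3 k with hF
  have hd : ∀ t ∈ uIcc (0 : ℝ) 1, HasDerivAt F (f t) t := by
    intro t _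
    refine hasDerivAt_pi.2 fun k => ?_
    have h4 := hp 3 t
    have h3 := hp 2 t
    have h2 := hp 1 t
    norm_num at h4 h3 h2
    refine ((((((((h4.sub (h3.const_mul 6)).add (h2.const_mul 11)).sub
      ((hasDerivAt_id' t).const_mul 6)).neg.div_const 6).mul_const (f 0 k)).add
      ((((h4.sub (h3.const_mul 5)).add (h2.const_mul 6)).div_const 2).mul_const (f 1 k))).sub
      ((((h4.sub (h3.const_mul 4)).add (h2.const_mul 3)).div_const 2).mul_const (f 2 k))).add
      ((((h4.sub (h3.const_mul 3)).add (h2.const_mul 2)).div_const 6).mul_const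
      (f 3 k))).congr_deriv ?_
    rw [hf t k]; ring
  rw [intervalIntegral.integral_eq_sub_of_hasDerivAt hd (hc.intervalIntegrable _ _)]
  ext k
  simp only [hF, Pi.sub_apply, Pi.add_apply, Pi.smul_apply, smul_eq_mul]
  ring

theorem hasDerivAt_linearCurve (a b : Point) (i : Fin 3) (t : ℝ) :
    HasDerivAt (fun t => linearCurve a b t i) (b i - a i) t := by
  simp only [linearCurve_apply]
  refine ((((hasDerivAt_id' t).const_sub 1).mul_const (a i)).add
    ((hasDerivAt_id' t).mul_const (b i))).congr_deriv ?_
  ring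

theorem integral_chord_psiR (a b : Point) :
    ∫ t in (0 : ℝ)..1, deriv (fun t => linearCurve a b t 1) t • psiR (linearCurve a b t) =
      (b 1 - a 1) • B2 a b := by
  simp only [(hasDerivAt_linearCurve a b 1 _).deriv]
  rw [intervalIntegral.integral_smul, integral_cubic]
  · congr 1
    ext k
    fin_cases k <;> simp [psiR, B2, linearCurve_apply] <;> ring
  · intro t k
    fin_cases k <;> simp [psiR, linearCurve_apply] <;> ring

theorem ClippedEdges.M2_eq {α β : ℝ} {P : Polyhedron} (E : ClippedEdges α β P)
    (i : Fin P.numFaces) :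
    E.M2 i = ∑ j, (-(E.edge i j).indicator) • ∫ t in (0 : ℝ)..1,
      deriv (fun s => (E.edge i j).chord s 1) t • psiR ((E.edge i j).chord t) := by
  refine Finset.sum_congr rfl fun j _ => ?_
  simp only [Edge.chord]
  rw [integral_chord_psiR, smul_smul]
  congr 1
  ring

/-- The integral of `psiF` along the segment from `a` to `b`. -/
noncomputable def chordF (s : ℝ) (a b : Point) : Fin 4 → ℝ :=
  (b 1 - a 1) • (1 / 24 : ℝ) • ((9 : ℝ) • psiF s a + (19 : ℝ) • psiF s b -
    (5 : ℝ) • psiF s (2 • b - a) + psiF s (3 • b - 2 • a))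

/-- The four points in `chordF` are those with parameters `0, 1, 2, 3` on the line through `a` and
`b`. -/
theorem integral_chord_psiF (s : ℝ) (a b : Point) :
    ∫ t in (0 : ℝ)..1, deriv (fun t => linearCurve a b t 1) t • psiF s (linearCurve a b t) =
      chordF s a b := by
  simp only [(hasDerivAt_linearCurve a b 1 _).deriv]
  rw [intervalIntegral.integral_smul, integral_cubic, chordF]
  · congr 1
    ext k
    fin_cases k <;> simp [psiF, linearCurve_apply] <;> ring
  · intro t k
    fin_cases k <;> simp [psiF, linearCurve_apply] <;> ring

/-- Green's theorem on the triangle `a, b, r`: the left side is the integral of `phiVec` over its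
oriented projection. Once `z` is eliminated by the plane equation it is a polynomial identity. -/
theorem chordF_triangle {n : Point} (hn : n 2 ≠ 0) {d : ℝ} {a b r : Point} (ha : n ⬝ᵥ a = d)
    (hb : n ⬝ᵥ b = d) (hr : n ⬝ᵥ r = d) :
    areaXY a b r • B1 a b r = chordF (-n 0 / n 2) a b + chordF (-n 0 / n 2) b r -
      chordF (-n 0 / n 2) a r := by
  have h : ∀ p : Point, n ⬝ᵥ p = d → p 2 = d / n 2 + -n 0 / n 2 * p 0 + -n 1 / n 2 * p 1 := by
    intro p hp
    rw [← hp, dotProduct_three]; field_simp; ring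
  replace ha := h a ha
  replace hb := h b hb
  replace hr := h r hr
  generalize -n 0 / n 2 = s at *
  generalize -n 1 / n 2 = q at *
  generalize d / n 2 = c at *
  ext k
  fin_cases k <;> simp [chordF, psiF, B1, areaXY, ha, hb, hr] <;> ring

theorem contDiff_chordF (s : ℝ) (r : Point) {m : WithTop ℕ∞} :
    ContDiff ℝ m fun p => chordF s p r := by
  have h : ContDiff ℝ m (psiF s) := contDiff_psiF s
  have h0 : ContDiff ℝ m fun p : Point => p 1 := contDiff_apply ℝ ℝ 1
  have h1 : ContDiff ℝ m fun p => psiF s (2 • r - p) := h.comp (by fun_prop)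
  have h2 : ContDiff ℝ m fun p => psiF s (3 • r - 2 • p) := h.comp (by fun_prop)
  unfold chordF
  fun_prop

theorem areaXY_eq_zero {n : Point} (h0 : n ≠ 0) (hn : n 2 = 0) {d : ℝ} {a b r : Point}
    (ha : n ⬝ᵥ a = d) (hb : n ⬝ᵥ b = d) (hr : n ⬝ᵥ r = d) : areaXY a b r = 0 := by
  rw [dotProduct_three, hn] at ha hb hr
  have e1 : n 0 * (a 0 - r 0) + n 1 * (a 1 - r 1) = 0 := by linarith
  have e2 : n 0 * (b 0 - r 0) + n 1 * (b 1 - r 1) = 0 := by linarith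
  have h1 : n 0 * areaXY a b r = 0 := by
    unfold areaXY
    linear_combination (1 / 2) * (b 1 - r 1) * e1 - (1 / 2) * (a 1 - r 1) * e2
  have h2 : n 1 * areaXY a b r = 0 := by
    unfold areaXY
    linear_combination -(1 / 2) * (b 0 - r 0) * e1 + (1 / 2) * (a 0 - r 0) * e2
  by_contra h
  apply h0
  ext k
  fin_cases k
  · exact (mul_eq_zero.1 h1).resolve_right h
  · exact (mul_eq_zero.1 h2).resolve_right h
  · exact hn

/-! ### The first contribution as a sum over chords. -/

namespace ClippedEdges

variable {α β : ℝ} {P : Polyhedron}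

theorem source_mem (E : ClippedEdges α β P) (i : Fin P.numFaces) (j : Fin (E.numEdges i)) :
    P.normal i ⬝ᵥ (E.edge i j).source = P.offset i := by
  rw [← Edge.curve_zero]; exact E.dotProduct_curve i j (left_mem_Icc.2 zero_le_one)

theorem target_mem (E : ClippedEdges α β P) (i : Fin P.numFaces) (j : Fin (E.numEdges i)) :
    P.normal i ⬝ᵥ (E.edge i j).target = P.offset i := by
  rw [← Edge.curve_one]; exact E.dotProduct_curve i j (right_mem_Icc.2 zero_le_one)

theorem chord_mem (E : ClippedEdges α β P) (i : Fin P.numFaces) (j : Fin (E.numEdges i)) (t : ℝ) :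
    P.normal i ⬝ᵥ (E.edge i j).chord t = P.offset i := by
  rw [Edge.chord, linearCurve, dotProduct_add, dotProduct_smul, dotProduct_smul, E.source_mem,
    E.target_mem, smul_eq_mul, smul_eq_mul]
  ring

/-- The sides towards the reference point cancel, because targets and sources give equal sums of any
smooth function (`sum_endpoints`); no matching of consecutive edges is needed. -/
theorem M1_eq_sum_chordF (E : ClippedEdges α β P) {i : Fin P.numFaces} (hn : P.normal i 2 ≠ 0) :
    E.M1 i = ∑ j, chordF (-P.normal i 0 / P.normal i 2) (E.edge i j).source
      (E.edge i j).target := by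
  set s := -P.normal i 0 / P.normal i 2
  have hb := (E.isOrientedBoundary i).isPlanarBoundary (E.weight_pos i) hn
    (P.isCompact_carrier.isBounded.subset
      (inter_subset_left.trans (P.face_subset_carrier i)))
  have h := hb.sum_endpoints (f := fun q => chordF s (planeLift (P.normal i) (P.offset i) q)
    (E.refPoint i)) ((contDiff_chordF s _).comp (contDiff_planeLift _ _))
  simp only [Edge.curve_zero, Edge.curve_one, planeLift_proj hn (E.source_mem i _),
    planeLift_proj hn (E.target_mem i _)] at h
  rw [M1, Finset.sum_congr rfl fun j _ => chordF_triangle hn (E.source_mem i j) (E.target_mem i j)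
    (E.refPoint_mem i), Finset.sum_sub_distrib, Finset.sum_add_distrib, h, add_sub_cancel_right]

theorem M1_eq (E : ClippedEdges α β P) {i : Fin P.numFaces} (hn : P.normal i 2 ≠ 0) :
    E.M1 i = ∑ j, ∫ t in (0 : ℝ)..1, deriv (fun s => (E.edge i j).chord s 1) t •
      bigPsi (P.zFace i) ((E.edge i j).chord t 0) ((E.edge i j).chord t 1) := by
  rw [E.M1_eq_sum_chordF hn]
  refine Finset.sum_congr rfl fun j _ => ?_
  simp only [bigPsi_zFace hn (E.chord_mem i j _)]
  simp only [Edge.chord]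
  rw [integral_chord_psiF]

theorem M1_eq_zero (E : ClippedEdges α β P) {i : Fin P.numFaces} (hn : P.normal i 2 = 0) :
    E.M1 i = 0 := by
  refine Finset.sum_eq_zero fun j _ => ?_
  rw [areaXY_eq_zero (P.normal_ne_zero i) hn (E.source_mem i j) (E.target_mem i j)
    (E.refPoint_mem i), zero_smul]

end ClippedEdges

end CylinderClip

namespace CylinderClip

open Filter Set

/-! ### Integrals over curves in barycentric coordinates -/

/-- A continuously differentiable curve in the plane from `(1, 0)` to `(0, 1)` over `[0, 1]`. -/
structure IsLensSide (u v u' v' : ℝ → ℝ) : Prop where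
  deriv_u : ∀ t ∈ Icc (0 : ℝ) 1, HasDerivAt u (u' t) t
  deriv_v : ∀ t ∈ Icc (0 : ℝ) 1, HasDerivAt v (v' t) t
  cont_u' : ContinuousOn u' (Icc 0 1)
  cont_v' : ContinuousOn v' (Icc 0 1)
  u_zero : u 0 = 1
  v_zero : v 0 = 0
  u_one : u 1 = 0
  v_one : v 1 = 1

/-- The affine function with values `f 0, f 1, f 2` at the vertices of a triangle. -/
def bary (f : Fin 3 → ℝ) (u v : ℝ) : ℝ := f 0 * u + f 1 * v + f 2 * (1 - u - v)

/-- The moment `∫ u ^ i v ^ j dv`. -/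
noncomputable def lineMoment (u v v' : ℝ → ℝ) (i j : ℕ) : ℝ :=
  ∫ t in (0 : ℝ)..1, u t ^ i * v t ^ j * v' t

namespace IsLensSide

variable {u v u' v' : ℝ → ℝ}

theorem cont_u (h : IsLensSide u v u' v') : ContinuousOn u (Icc 0 1) :=
  fun t ht => (h.deriv_u t ht).continuousAt.continuousWithinAt

theorem cont_v (h : IsLensSide u v u' v') : ContinuousOn v (Icc 0 1) :=
  fun t ht => (h.deriv_v t ht).continuousAt.continuousWithinAt

theorem intervalIntegrable_monomial (h : IsLensSide u v u' v') (i j : ℕ) :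
    IntervalIntegrable (fun t => u t ^ i * v t ^ j * v' t) volume 0 1 := by
  refine ContinuousOn.intervalIntegrable ?_
  rw [uIcc_of_le zero_le_one]
  exact ((h.cont_u.pow i).mul (h.cont_v.pow j)).mul h.cont_v'

/-- Modulo exact differentials, whose integrals only see the end-points `(1, 0)` and `(0, 1)`, a
monomial times `du` is a multiple of a monomial times `dv`. Pure powers of `v` times `dv` are exact
too, so six moments survive. -/
theorem integral_polynomial (h : IsLensSide u v u' v')
    (c00 c10 c01 c20 c11 c02 c30 c21 c12 c03 g₁ g₂ : ℝ) :
    ∫ t in (0 : ℝ)..1, (c00 + c10 * u t + c01 * v t + c20 * u t ^ 2 + c11 * u t * v t +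
        c02 * v t ^ 2 + c30 * u t ^ 3 + c21 * u t ^ 2 * v t + c12 * u t * v t ^ 2 +
        c03 * v t ^ 3) * (g₁ * u' t + g₂ * v' t) =
      g₂ * (c00 + c01 / 2 + c02 / 3 + c03 / 4) - g₁ * (c00 + c10 / 2 + c20 / 3 + c30 / 4) +
      (g₂ * c10 - g₁ * c01) * lineMoment u v v' 1 0 +
      (g₂ * c20 - g₁ * c11 / 2) * lineMoment u v v' 2 0 +
      (g₂ * c11 - g₁ * (2 * c02)) * lineMoment u v v' 1 1 +
      (g₂ * c30 - g₁ * c21 / 3) * lineMoment u v v' 3 0 +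
      (g₂ * c21 - g₁ * c12) * lineMoment u v v' 2 1 +
      (g₂ * c12 - g₁ * (3 * c03)) * lineMoment u v v' 1 2 := by
  set H : ℝ → ℝ := fun t =>
    g₂ * (c00 * v t + c01 * (v t ^ 2 / 2) + c02 * (v t ^ 3 / 3) + c03 * (v t ^ 4 / 4)) +
    g₁ * (c00 * u t + c10 * (u t ^ 2 / 2) + c20 * (u t ^ 3 / 3) + c30 * (u t ^ 4 / 4) +
      c01 * (u t * v t) + c02 * (u t * v t ^ 2) + c03 * (u t * v t ^ 3) +
      c11 * (u t ^ 2 * v t / 2) + c12 * (u t ^ 2 * v t ^ 2 / 2) +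
      c21 * (u t ^ 3 * v t / 3)) with hH
  set R : ℝ → ℝ := fun t =>
      (g₂ * c10 - g₁ * c01) * (u t ^ 1 * v t ^ 0 * v' t) +
      (g₂ * c20 - g₁ * c11 / 2) * (u t ^ 2 * v t ^ 0 * v' t) +
      (g₂ * c11 - g₁ * (2 * c02)) * (u t ^ 1 * v t ^ 1 * v' t) +
      (g₂ * c30 - g₁ * c21 / 3) * (u t ^ 3 * v t ^ 0 * v' t) +
      (g₂ * c21 - g₁ * c12) * (u t ^ 2 * v t ^ 1 * v' t) +
      (g₂ * c12 - g₁ * (3 * c03)) * (u t ^ 1 * v t ^ 2 * v' t) with hR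
  set F : ℝ → ℝ := fun t => (c00 + c10 * u t + c01 * v t + c20 * u t ^ 2 + c11 * u t * v t +
        c02 * v t ^ 2 + c30 * u t ^ 3 + c21 * u t ^ 2 * v t + c12 * u t * v t ^ 2 +
        c03 * v t ^ 3) * (g₁ * u' t + g₂ * v' t) with hF
  have hi := h.intervalIntegrable_monomial
  have hRint : IntervalIntegrable R volume 0 1 :=
    ((((((hi 1 0).const_mul _).add ((hi 2 0).const_mul _)).add ((hi 1 1).const_mul _)).add
      ((hi 3 0).const_mul _)).add ((hi 2 1).const_mul _)).add ((hi 1 2).const_mul _)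
  have hFint : IntervalIntegrable F volume 0 1 := by
    refine ContinuousOn.intervalIntegrable ?_
    rw [uIcc_of_le zero_le_one]
    have := h.cont_u; have := h.cont_v; have := h.cont_u'; have := h.cont_v'
    fun_prop
  have hd : ∀ t ∈ uIcc (0 : ℝ) 1, HasDerivAt H (F t - R t) t := by
    intro t ht
    rw [uIcc_of_le zero_le_one] at ht
    have hu := h.deriv_u t ht
    have hv := h.deriv_v t ht
    refine (((((hv.const_mul c00).add (((hv.pow 2).div_const 2).const_mul c01)).add
      (((hv.pow 3).div_const 3).const_mul c02)).add
      (((hv.pow 4).div_const 4).const_mul c03)).const_mul g₂ |>.add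
      ((((((((((hu.const_mul c00).add (((hu.pow 2).div_const 2).const_mul c10)).add
      (((hu.pow 3).div_const 3).const_mul c20)).add
      (((hu.pow 4).div_const 4).const_mul c30)).add
      ((hu.mul hv).const_mul c01)).add ((hu.mul (hv.pow 2)).const_mul c02)).add
      ((hu.mul (hv.pow 3)).const_mul c03)).add
      ((((hu.pow 2).mul hv).div_const 2).const_mul c11)).add
      ((((hu.pow 2).mul (hv.pow 2)).div_const 2).const_mul c12)).add
      ((((hu.pow 3).mul hv).div_const 3).const_mul c21) |>.const_mul g₁)).congr_deriv ?_
    simp only [hF, hR, Pi.pow_apply]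
    push_cast
    ring
  have key := intervalIntegral.integral_eq_sub_of_hasDerivAt hd (hFint.sub hRint)
  rw [intervalIntegral.integral_sub hFint hRint, sub_eq_iff_eq_add] at key
  rw [key, hR,
    intervalIntegral.integral_add (((((((hi 1 0).const_mul _).add ((hi 2 0).const_mul _)).add
      ((hi 1 1).const_mul _)).add ((hi 3 0).const_mul _)).add ((hi 2 1).const_mul _)))
      ((hi 1 2).const_mul _),
    intervalIntegral.integral_add ((((((hi 1 0).const_mul _).add ((hi 2 0).const_mul _)).add
      ((hi 1 1).const_mul _)).add ((hi 3 0).const_mul _))) ((hi 2 1).const_mul _),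
    intervalIntegral.integral_add (((((hi 1 0).const_mul _).add ((hi 2 0).const_mul _)).add
      ((hi 1 1).const_mul _))) ((hi 3 0).const_mul _),
    intervalIntegral.integral_add ((((hi 1 0).const_mul _).add ((hi 2 0).const_mul _)))
      ((hi 1 1).const_mul _),
    intervalIntegral.integral_add ((hi 1 0).const_mul _) ((hi 2 0).const_mul _)]
  simp only [intervalIntegral.integral_const_mul]
  simp only [hH, h.u_zero, h.v_zero, h.u_one, h.v_one, lineMoment]
  ring

end IsLensSide

/-- Twice the signed area of the image of the barycentric triangle under `(f, k)`. -/
def jac (f k : Fin 3 → ℝ) : ℝ := (f 0 - f 2) * (k 1 - k 2) - (f 1 - f 2) * (k 0 - k 2)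

/-- The integral of a product of two affine functions over the lens between a curve and its
chord, in terms of the moments of the lens. -/
def lensForm (m : Fin 6 → ℝ) (f g : Fin 3 → ℝ) : ℝ :=
  m 3 * (f 0 * g 0) + m 5 * (f 1 * g 1) + m 4 * (f 0 * g 1 + f 1 * g 0) +
    (m 1 - m 3 - m 4) * (f 0 * g 2 + f 2 * g 0) + (m 2 - m 4 - m 5) * (f 1 * g 2 + f 2 * g 1) +
    (m 0 - 2 * m 1 - 2 * m 2 + m 3 + 2 * m 4 + m 5) * (f 2 * g 2)

/-- The moments `1, u, v, u², uv, v²` of the lens between a curve and its chord. -/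
noncomputable def lensMoments (u v v' : ℝ → ℝ) : Fin 6 → ℝ :=
  ![lineMoment u v v' 1 0 - 1 / 2, (lineMoment u v v' 2 0 - 1 / 3) / 2,
    lineMoment u v v' 1 1 - 1 / 6, (lineMoment u v v' 3 0 - 1 / 4) / 3,
    (lineMoment u v v' 2 1 - 1 / 12) / 2, lineMoment u v v' 1 2 - 1 / 12]

/-- Green's theorem on the lens between a curve and its chord. -/
theorem IsLensSide.integral_bary {u v u' v' : ℝ → ℝ} (h : IsLensSide u v u' v')
    (f g k l : Fin 3 → ℝ) :
    ∫ t in (0 : ℝ)..1, ((l 0 - l 2) * u' t + (l 1 - l 2) * v' t) *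
        (bary f (u t) (v t) * bary g (u t) (v t) * bary k (u t) (v t)) =
      (l 1 - l 0) / 12 * (3 * (f 0 * g 0 * k 0 + f 1 * g 1 * k 1) + f 0 * g 0 * k 1 +
        f 0 * g 1 * k 0 + f 1 * g 0 * k 0 + f 0 * g 1 * k 1 + f 1 * g 0 * k 1 +
        f 1 * g 1 * k 0) +
      (jac f l * lensForm (lensMoments u v v') g k + jac g l * lensForm (lensMoments u v v') f k +
        jac k l * lensForm (lensMoments u v v') f g) := by
  -- The product of the three affine functions is expanded in `u` and `v` about the third vertex.
  -- The constants subtracted in `lensMoments` are the same moments taken along the chord.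
  have := h.integral_polynomial (f 2 * g 2 * k 2)
    ((f 0 - f 2) * g 2 * k 2 + f 2 * (g 0 - g 2) * k 2 + f 2 * g 2 * (k 0 - k 2))
    ((f 1 - f 2) * g 2 * k 2 + f 2 * (g 1 - g 2) * k 2 + f 2 * g 2 * (k 1 - k 2))
    ((f 0 - f 2) * (g 0 - g 2) * k 2 + (f 0 - f 2) * g 2 * (k 0 - k 2) +
      f 2 * (g 0 - g 2) * (k 0 - k 2))
    ((f 0 - f 2) * (g 1 - g 2) * k 2 + (f 1 - f 2) * (g 0 - g 2) * k 2 +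
      (f 0 - f 2) * g 2 * (k 1 - k 2) + (f 1 - f 2) * g 2 * (k 0 - k 2) +
      f 2 * (g 0 - g 2) * (k 1 - k 2) + f 2 * (g 1 - g 2) * (k 0 - k 2))
    ((f 1 - f 2) * (g 1 - g 2) * k 2 + (f 1 - f 2) * g 2 * (k 1 - k 2) +
      f 2 * (g 1 - g 2) * (k 1 - k 2))
    ((f 0 - f 2) * (g 0 - g 2) * (k 0 - k 2))
    ((f 0 - f 2) * (g 0 - g 2) * (k 1 - k 2) + (f 0 - f 2) * (g 1 - g 2) * (k 0 - k 2) +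
      (f 1 - f 2) * (g 0 - g 2) * (k 0 - k 2))
    ((f 0 - f 2) * (g 1 - g 2) * (k 1 - k 2) + (f 1 - f 2) * (g 0 - g 2) * (k 1 - k 2) +
      (f 1 - f 2) * (g 1 - g 2) * (k 0 - k 2))
    ((f 1 - f 2) * (g 1 - g 2) * (k 1 - k 2)) (l 0 - l 2) (l 1 - l 2)
  refine (intervalIntegral.integral_congr fun t _ => ?_).trans (this.trans ?_)
  · simp only [bary]; ring
  · simp only [lensForm, lensMoments, jac, Matrix.cons_val]
    ring

end CylinderClip

namespace CylinderClip

open Filter Set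

/-! ### Moments of rational Bézier arcs -/

theorem bezierDen_zero (w : ℝ) : bezierDen w 0 = 1 := by simp [bezierDen]

theorem bezierDen_one (w : ℝ) : bezierDen w 1 = 1 := by simp [bezierDen]

theorem hasDerivAt_bezierDen (w t : ℝ) :
    HasDerivAt (bezierDen w) (2 * (w - 1) * (1 - 2 * t)) t := by
  have h := hasDerivAt_id' t
  have h' := h.const_sub 1
  refine (((h'.pow 2).add (((h.const_mul (2 * w)).mul h'))).add (h.pow 2)).congr_deriv ?_
  push_cast; ring

theorem hasDerivAt_artanh {x : ℝ} (hx : x ∈ Ioo (-1 : ℝ) 1) :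
    HasDerivAt Real.artanh (1 / (1 - x ^ 2)) x := by
  have h1 : 0 < 1 + x := by linarith [hx.1]
  have h2 : 0 < 1 - x := by linarith [hx.2]
  have hd : HasDerivAt (fun x : ℝ => 1 / 2 * Real.log ((1 + x) / (1 - x))) (1 / (1 - x ^ 2)) x := by
    refine ((((hasDerivAt_id' x).const_add 1).div ((hasDerivAt_id' x).const_sub 1)
      h2.ne').log (div_pos h1 h2).ne').const_mul (1 / 2 : ℝ) |>.congr_deriv ?_
    have h3 : 1 - x ^ 2 ≠ 0 := by
      have : 1 - x ^ 2 = (1 + x) * (1 - x) := by ring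
      rw [this]; positivity
    simp only [Pi.div_apply]
    field_simp
    ring
  refine hd.congr_of_eventuallyEq ?_
  filter_upwards [Icc_mem_nhds hx.1 hx.2] with y hy using Real.artanh_eq_half_log hy

theorem artanh_neg_eq {x : ℝ} (hx : x ∈ Icc (-1 : ℝ) 1) : Real.artanh (-x) = -Real.artanh x := by
  rw [Real.artanh_eq_half_log hx, Real.artanh_eq_half_log ⟨by linarith [hx.2], by linarith [hx.1]⟩,
    ← sub_eq_add_neg, sub_neg_eq_add, ← inv_div (1 + x) (1 - x), Real.log_inv]
  ring

/-- The reciprocal of the denominator of a rational Bézier curve has an elementary primitive. -/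
theorem exists_primitive_bezierDen {w : ℝ} (hw : 0 < w) (hw1 : w ≠ 1) :
    ∃ G : ℝ → ℝ, (∀ t ∈ Icc (0 : ℝ) 1, HasDerivAt G (1 / bezierDen w t) t) ∧
      G 1 - G 0 = 2 * theta w := by
  have hlin : ∀ κ t : ℝ, HasDerivAt (fun t : ℝ => (2 * t - 1) * κ) (2 * κ) t := by
    intro κ t
    exact ((((hasDerivAt_id' t).const_mul 2).sub_const 1).mul_const κ).congr_deriv (by ring)
  rcases lt_or_gt_of_ne hw1 with h | h
  · have hpos : 0 < 1 - w ^ 2 := by nlinarith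
    set r := √(1 - w ^ 2) with hr
    have hr0 : 0 < r := Real.sqrt_pos.2 hpos
    have hr2 : r ^ 2 = 1 - w ^ 2 := Real.sq_sqrt hpos.le
    -- The denominator is symmetric about `t = 1 / 2`: completing the square, `2 (1 - w)` times it
    -- is `(1 - w²) + (2t - 1)² (1 - w)²`. For `w > 1` the same identity with a minus sign gives
    -- `artanh`.
    refine ⟨fun t => Real.arctan ((2 * t - 1) * ((1 - w) / r)) * (1 / r), fun t ht => ?_, ?_⟩
    · refine ((hlin _ t).arctan.mul_const (1 / r)).congr_deriv ?_
      have hD := bezierDen_pos hw ht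
      have key : (1 + ((2 * t - 1) * ((1 - w) / r)) ^ 2) * r ^ 2 = 2 * (1 - w) * bezierDen w t := by
        have : (1 + ((2 * t - 1) * ((1 - w) / r)) ^ 2) * r ^ 2 =
            r ^ 2 + (2 * t - 1) ^ 2 * (1 - w) ^ 2 := by field_simp
        rw [this, hr2, bezierDen]; ring
      have h0 : 0 < 1 + ((2 * t - 1) * ((1 - w) / r)) ^ 2 := by positivity
      rw [eq_div_iff hD.ne']
      have h1 : (1 - w) * bezierDen w t = (1 + ((2 * t - 1) * ((1 - w) / r)) ^ 2) * r ^ 2 / 2 := by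
        linarith
      calc _ = 2 / (1 + ((2 * t - 1) * ((1 - w) / r)) ^ 2) / r ^ 2 * ((1 - w) * bezierDen w t) := by
            field_simp
        _ = 1 := by rw [h1]; field_simp
    · have e1 : (2 * (1 : ℝ) - 1) * ((1 - w) / r) = (1 - w) / r := by ring
      have e0 : (2 * (0 : ℝ) - 1) * ((1 - w) / r) = -((1 - w) / r) := by ring
      simp only [theta, if_pos h, e1, e0, Real.arctan_neg, ← hr]
      ring
  · have hpos : 0 < w ^ 2 - 1 := by nlinarith
    set r := √(w ^ 2 - 1) with hr
    have hr0 : 0 < r := Real.sqrt_pos.2 hpos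
    have hr2 : r ^ 2 = w ^ 2 - 1 := Real.sq_sqrt hpos.le
    have hκ0 : 0 < (w - 1) / r := div_pos (by linarith) hr0
    have hκ1 : (w - 1) / r < 1 := by
      rw [div_lt_one hr0]; nlinarith
    refine ⟨fun t => Real.artanh ((2 * t - 1) * ((w - 1) / r)) * (1 / r), fun t ht => ?_, ?_⟩
    · have hmem : (2 * t - 1) * ((w - 1) / r) ∈ Ioo (-1 : ℝ) 1 := by
        constructor <;> nlinarith [ht.1, ht.2]
      refine (((hasDerivAt_artanh hmem).comp t (hlin _ t)).mul_const (1 / r)).congr_deriv ?_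
      have hD := bezierDen_pos hw ht
      have key : (1 - ((2 * t - 1) * ((w - 1) / r)) ^ 2) * r ^ 2 = 2 * (w - 1) * bezierDen w t := by
        have : (1 - ((2 * t - 1) * ((w - 1) / r)) ^ 2) * r ^ 2 =
            r ^ 2 - (2 * t - 1) ^ 2 * (w - 1) ^ 2 := by field_simp
        rw [this, hr2, bezierDen]; ring
      have h0 : 0 < 1 - ((2 * t - 1) * ((w - 1) / r)) ^ 2 := by
        have := hmem.1; have := hmem.2; nlinarith
      rw [eq_div_iff hD.ne']
      have h1 : (w - 1) * bezierDen w t = (1 - ((2 * t - 1) * ((w - 1) / r)) ^ 2) * r ^ 2 / 2 := by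
        linarith
      generalize 1 - ((2 * t - 1) * ((w - 1) / r)) ^ 2 = q at *
      calc _ = 2 / q / r ^ 2 * ((w - 1) * bezierDen w t) := by field_simp
        _ = 1 := by rw [h1]; field_simp
    · have e1 : (2 * (1 : ℝ) - 1) * ((w - 1) / r) = (w - 1) / r := by ring
      have e0 : (2 * (0 : ℝ) - 1) * ((w - 1) / r) = -((w - 1) / r) := by ring
      simp only [theta, if_neg (not_lt.2 h.le), e1, e0, ← hr]
      rw [artanh_neg_eq ⟨by linarith, hκ1.le⟩]
      ring

theorem sq_sub_one_ne_zero {w : ℝ} (hw : 0 < w) (hw1 : w ≠ 1) : w ^ 2 - 1 ≠ 0 := by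
  have : w ^ 2 - 1 = (w - 1) * (w + 1) := by ring
  rw [this]
  exact mul_ne_zero (sub_ne_zero.2 hw1) (by positivity)

/-- Hermite reduction for powers of the denominator of a rational Bézier curve. -/
theorem integral_div_bezierDen {w : ℝ} (hw : 0 < w) (hw1 : w ≠ 1) (k : ℕ)
    (p₀ p₁ p₂ p₃ p₄ p₅ p₆ p₇ c : ℝ) {N : ℝ → ℝ} (hN : Continuous N)
    (h : ∀ t, N t = (p₁ + 2 * p₂ * t + 3 * p₃ * t ^ 2 + 4 * p₄ * t ^ 3 + 5 * p₅ * t ^ 4 +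
        6 * p₆ * t ^ 5 + 7 * p₇ * t ^ 6) * bezierDen w t -
      (p₀ + p₁ * t + p₂ * t ^ 2 + p₃ * t ^ 3 + p₄ * t ^ 4 + p₅ * t ^ 5 + p₆ * t ^ 6 +
        p₇ * t ^ 7) * (k * (2 * (w - 1) * (1 - 2 * t))) + c * bezierDen w t ^ k) :
    ∫ t in (0 : ℝ)..1, N t / bezierDen w t ^ (k + 1) =
      p₁ + p₂ + p₃ + p₄ + p₅ + p₆ + p₇ + 2 * c * theta w := by
  obtain ⟨G, hG, hG'⟩ := exists_primitive_bezierDen hw hw1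
  -- The assumption on `N` says that the integrand is the derivative of `P / D ^ k + c G`, where `G`
  -- is a primitive of `1 / D` with increment `2 * theta w`.
  have hd : ∀ t ∈ uIcc (0 : ℝ) 1, HasDerivAt (fun t => (p₀ + p₁ * t + p₂ * t ^ 2 + p₃ * t ^ 3 +
      p₄ * t ^ 4 + p₅ * t ^ 5 + p₆ * t ^ 6 + p₇ * t ^ 7) / bezierDen w t ^ k + c * G t)
      (N t / bezierDen w t ^ (k + 1)) t := by
    intro t ht
    rw [uIcc_of_le zero_le_one] at ht
    have hD := bezierDen_pos hw ht
    have hx := hasDerivAt_id' t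
    have hP := ((((((((hx.const_mul p₁).const_add p₀).add ((hx.pow 2).const_mul p₂)).add
      ((hx.pow 3).const_mul p₃)).add ((hx.pow 4).const_mul p₄)).add
      ((hx.pow 5).const_mul p₅)).add ((hx.pow 6).const_mul p₆)).add ((hx.pow 7).const_mul p₇))
    refine ((hP.div ((hasDerivAt_bezierDen w t).pow k) (pow_ne_zero k hD.ne')).add
      ((hG t ht).const_mul c)).congr_deriv ?_
    rw [h t]
    simp only [Pi.pow_apply, Pi.add_apply]
    rcases k with _ | k
    · simp only [pow_zero, Nat.cast_zero, zero_add, pow_one]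
      field_simp
      push_cast; ring
    · rw [Nat.add_sub_cancel]
      field_simp
      push_cast; ring
  have hc : ContinuousOn (fun t => N t / bezierDen w t ^ (k + 1)) (uIcc 0 1) := by
    rw [uIcc_of_le zero_le_one]
    refine hN.continuousOn.div ?_ fun t ht => pow_ne_zero _ (bezierDen_pos hw ht).ne'
    exact fun t _ => ((hasDerivAt_bezierDen w t).continuousAt.pow _).continuousWithinAt
  rw [intervalIntegral.integral_eq_sub_of_hasDerivAt hd hc.intervalIntegrable]
  simp only [bezierDen_zero, bezierDen_one, one_pow, mul_one, div_one]
  linear_combination c * hG'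

/-- The barycentric coordinates of a rational Bézier curve. -/
noncomputable def bezierU (w t : ℝ) : ℝ := (1 - t) ^ 2 / bezierDen w t

/-- The barycentric coordinates of a rational Bézier curve. -/
noncomputable def bezierV (w t : ℝ) : ℝ := t ^ 2 / bezierDen w t

theorem hasDerivAt_bezierU {w : ℝ} (hw : 0 < w) {t : ℝ} (ht : t ∈ Icc (0 : ℝ) 1) :
    HasDerivAt (bezierU w) (-(2 * (1 - t) * (t + w * (1 - t))) / bezierDen w t ^ 2) t := by
  refine ((((hasDerivAt_id' t).const_sub 1).pow 2).div (hasDerivAt_bezierDen w t)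
    (bezierDen_pos hw ht).ne').congr_deriv ?_
  simp only [Pi.pow_apply]
  congr 1
  rw [bezierDen]; push_cast; ring

theorem hasDerivAt_bezierV {w : ℝ} (hw : 0 < w) {t : ℝ} (ht : t ∈ Icc (0 : ℝ) 1) :
    HasDerivAt (bezierV w) (2 * t * (1 - t + w * t) / bezierDen w t ^ 2) t := by
  refine (((hasDerivAt_id' t).pow 2).div (hasDerivAt_bezierDen w t)
    (bezierDen_pos hw ht).ne').congr_deriv ?_
  simp only [Pi.pow_apply]
  congr 1
  rw [bezierDen]; push_cast; ring

theorem continuous_bezierDen (w : ℝ) : Continuous (bezierDen w) := by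
  unfold bezierDen; fun_prop

theorem isLensSide_bezier {w : ℝ} (hw : 0 < w) :
    IsLensSide (bezierU w) (bezierV w)
      (fun t => -(2 * (1 - t) * (t + w * (1 - t))) / bezierDen w t ^ 2)
      (fun t => 2 * t * (1 - t + w * t) / bezierDen w t ^ 2) where
  deriv_u _ ht := hasDerivAt_bezierU hw ht
  deriv_v _ ht := hasDerivAt_bezierV hw ht
  cont_u' := ContinuousOn.div (by fun_prop) ((continuous_bezierDen w).pow 2).continuousOn
    fun _ ht => pow_ne_zero 2 (bezierDen_pos hw ht).ne'
  cont_v' := ContinuousOn.div (by fun_prop) ((continuous_bezierDen w).pow 2).continuousOn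
    fun _ ht => pow_ne_zero 2 (bezierDen_pos hw ht).ne'
  u_zero := by simp [bezierU, bezierDen]
  v_zero := by simp [bezierV]
  u_one := by simp [bezierU]
  v_one := by simp [bezierV, bezierDen]

theorem lineMoment_bezier {w : ℝ} (hw : 0 < w) (i j : ℕ) :
    lineMoment (bezierU w) (bezierV w) (fun t => 2 * t * (1 - t + w * t) / bezierDen w t ^ 2) i j =
      ∫ t in (0 : ℝ)..1, ((1 - t) ^ 2) ^ i * (t ^ 2) ^ j * (2 * t * (1 - t + w * t)) /
        bezierDen w t ^ (i + j + 1 + 1) := by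
  refine intervalIntegral.integral_congr fun t ht => ?_
  rw [uIcc_of_le zero_le_one] at ht
  have hD := (bezierDen_pos hw ht).ne'
  simp only [bezierU, bezierV, div_pow]
  rw [div_mul_div_comm, div_mul_div_comm, ← pow_add, ← pow_add]

/-- The listed coefficients solve the linear system of the Hermite reduction: they are those of `P`
and finally the multiple of `1 / D` left over. The following five moments are obtained likewise,
with exponent `k = i + j + 1`. -/
theorem lineMoment_bezier_one_zero {w : ℝ} (hw : 0 < w) (hw1 : w ≠ 1) :
    lineMoment (bezierU w) (bezierV w) (fun t => 2 * t * (1 - t + w * t) / bezierDen w t ^ 2)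
      1 0 =
      (-1 / 2 + w * theta w) / (w ^ 2 - 1) := by
  have hW := sq_sub_one_ne_zero hw hw1
  rw [lineMoment_bezier hw, integral_div_bezierDen hw hw1 2
    ((-3 / 8 - 1 / 4 * w + 1 / 8 * w ^ 2) / (w ^ 2 - 1) ^ 2)
    ((-3 / 2) / (w ^ 2 - 1))
    ((2 - w) / (w ^ 2 - 1))
    ((-1 + w) / (w ^ 2 - 1))
    0
    0
    0
    0
    ((1 / 2 * w) / (w ^ 2 - 1)) (by fun_prop)]
  · field_simp
    ring
  · intro t
    rw [bezierDen]
    field_simp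
    push_cast
    ring

theorem lineMoment_bezier_two_zero {w : ℝ} (hw : 0 < w) (hw1 : w ≠ 1) :
    lineMoment (bezierU w) (bezierV w) (fun t => 2 * t * (1 - t + w * t) / bezierDen w t ^ 2)
      2 0 =
      (1 / 3 + 1 / 6 * w ^ 2 - w * theta w) / (w ^ 2 - 1) ^ 2 := by
  have hW := sq_sub_one_ne_zero hw hw1
  rw [lineMoment_bezier hw, integral_div_bezierDen hw hw1 3
    ((7 / 24 + 7 / 24 * w + 1 / 24 * w ^ 2 - 1 / 8 * w ^ 3 - 1 / 6 * w ^ 4) / (w ^ 2 - 1) ^ 3)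
    ((7 / 4 + 1 / 2 * w + 1 / 4 * w ^ 2 - w ^ 3) / (w ^ 2 - 1) ^ 2)
    ((-17 / 4 + w - 1 / 4 * w ^ 2 + 7 / 2 * w ^ 3 - w ^ 4) / (w ^ 2 - 1) ^ 2)
    ((16 / 3 - 4 * w + 5 / 3 * w ^ 2 - 6 * w ^ 3 + 3 * w ^ 4) / (w ^ 2 - 1) ^ 2)
    ((-7 / 2 + 9 / 2 * w - 7 / 2 * w ^ 2 + 11 / 2 * w ^ 3 - 3 * w ^ 4) / (w ^ 2 - 1) ^ 2)
    ((1 - 2 * w + 2 * w ^ 2 - 2 * w ^ 3 + w ^ 4) / (w ^ 2 - 1) ^ 2)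
    0
    0
    ((-1 / 2 * w) / (w ^ 2 - 1) ^ 2) (by fun_prop)]
  · field_simp
    ring
  · intro t
    rw [bezierDen]
    field_simp
    push_cast
    ring

theorem lineMoment_bezier_one_one {w : ℝ} (hw : 0 < w) (hw1 : w ≠ 1) :
    lineMoment (bezierU w) (bezierV w) (fun t => 2 * t * (1 - t + w * t) / bezierDen w t ^ 2)
      1 1 =
      (1 / 6 + 1 / 12 * w ^ 2 + (-1 / 2 * w) * theta w) / (w ^ 2 - 1) ^ 2 := by
  have hW := sq_sub_one_ne_zero hw hw1
  rw [lineMoment_bezier hw, integral_div_bezierDen hw hw1 3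
    ((1 / 12 + 1 / 24 * w + 1 / 12 * w ^ 2 + 1 / 8 * w ^ 3) / (w ^ 2 - 1) ^ 3)
    ((1 / 2 + 3 / 4 * w ^ 2) / (w ^ 2 - 1) ^ 2)
    ((-3 / 2 + 1 / 2 * w - 3 / 2 * w ^ 2 + 3 / 2 * w ^ 3) / (w ^ 2 - 1) ^ 2)
    ((8 / 3 - 3 / 2 * w + 4 / 3 * w ^ 2 - 7 / 2 * w ^ 3 + w ^ 4) / (w ^ 2 - 1) ^ 2)
    ((-5 / 2 + 2 * w - 1 / 2 * w ^ 2 + 3 * w ^ 3 - 2 * w ^ 4) / (w ^ 2 - 1) ^ 2)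
    ((1 - w - w ^ 3 + w ^ 4) / (w ^ 2 - 1) ^ 2)
    0
    0
    ((-1 / 4 * w) / (w ^ 2 - 1) ^ 2) (by fun_prop)]
  · field_simp
    ring
  · intro t
    rw [bezierDen]
    field_simp
    push_cast
    ring

theorem lineMoment_bezier_three_zero {w : ℝ} (hw : 0 < w) (hw1 : w ≠ 1) :
    lineMoment (bezierU w) (bezierV w) (fun t => 2 * t * (1 - t + w * t) / bezierDen w t ^ 2)
      3 0 =
      (-1 / 4 - 9 / 32 * w ^ 2 + 1 / 16 * w ^ 4 + (15 / 16 * w) * theta w) / (w ^ 2 - 1) ^ 3 := by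
  have hW := sq_sub_one_ne_zero hw hw1
  rw [lineMoment_bezier hw, integral_div_bezierDen hw hw1 4
    ((-15 / 64 - 5 / 16 * w - 13 / 64 * w ^ 2 + 3 / 16 * w ^ 3 + 3 / 8 * w ^ 4 - 1 / 16 * w ^ 6)
      / (w ^ 2 - 1) ^ 4)
    ((-15 / 8 - 35 / 32 * w - w ^ 2 + 5 / 2 * w ^ 3 + 1 / 2 * w ^ 4 - 1 / 2 * w ^ 5) / (w ^
      2 - 1) ^ 3)
    ((13 / 2 + 5 / 32 * w + 59 / 32 * w ^ 2 - 13 * w ^ 3 + 5 / 2 * w ^ 4 + 7 / 2 * w ^ 5 - 1 / 2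
      * w ^ 6) / (w ^ 2 - 1) ^ 3)
    ((-51 / 4 + 103 / 16 * w - 113 / 16 * w ^ 2 + 275 / 8 * w ^ 3 - 16 * w ^ 4 - 8 * w ^ 5 + 3 *
      w ^ 6) / (w ^ 2 - 1) ^ 3)
    ((123 / 8 - 65 / 4 * w + 333 / 16 * w ^ 2 - 459 / 8 * w ^ 3 + 583 / 16 * w ^ 4 + 8 * w ^ 5 -
      7 * w ^ 6) / (w ^ 2 - 1) ^ 3)
    ((-23 / 2 + 157 / 8 * w - 63 / 2 * w ^ 2 + 501 / 8 * w ^ 3 - 175 / 4 * w ^ 4 - 7 / 2 * w ^ 5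
      + 8 * w ^ 6) / (w ^ 2 - 1) ^ 3)
    ((5 - 101 / 8 * w + 199 / 8 * w ^ 2 - 323 / 8 * w ^ 3 + 217 / 8 * w ^ 4 + 1 / 2 * w ^ 5 - 9
      / 2 * w ^ 6) / (w ^ 2 - 1) ^ 3)
    ((-1 + 15 / 4 * w - 33 / 4 * w ^ 2 + 45 / 4 * w ^ 3 - 27 / 4 * w ^ 4 + w ^ 6) / (w ^ 2 -
      1) ^ 3)
    ((15 / 32 * w) / (w ^ 2 - 1) ^ 3) (by fun_prop)]
  · field_simp
    ring
  · intro t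
    rw [bezierDen]
    field_simp
    push_cast
    ring

theorem lineMoment_bezier_two_one {w : ℝ} (hw : 0 < w) (hw1 : w ≠ 1) :
    lineMoment (bezierU w) (bezierV w) (fun t => 2 * t * (1 - t + w * t) / bezierDen w t ^ 2)
      2 1 =
      (-1 / 12 - 11 / 48 * w ^ 2 + (3 / 8 * w + 1 / 4 * w ^ 3) * theta w) / (w ^ 2 - 1) ^ 3 := by
  have hW := sq_sub_one_ne_zero hw hw1
  rw [lineMoment_bezier hw, integral_div_bezierDen hw hw1 4
    ((-11 / 192 - 1 / 16 * w - 1 / 6 * w ^ 2 - 1 / 16 * w ^ 3 + 19 / 192 * w ^ 4) / (w ^ 2 - 1)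
      ^ 4)
    ((-11 / 24 - 11 / 48 * w - 31 / 24 * w ^ 2 + 2 / 3 * w ^ 3) / (w ^ 2 - 1) ^ 3)
    ((11 / 6 + 5 / 48 * w + 179 / 48 * w ^ 2 - 37 / 6 * w ^ 3 + 3 / 2 * w ^ 4) / (w ^ 2 - 1) ^
      3)
    ((-55 / 12 + 11 / 8 * w - 151 / 24 * w ^ 2 + 39 / 2 * w ^ 3 - 11 * w ^ 4 + w ^ 5) / (w ^
      2 - 1) ^ 3)
    ((175 / 24 - 53 / 12 * w + 173 / 24 * w ^ 2 - 100 / 3 * w ^ 3 + 117 / 4 * w ^ 4 - 6 * w ^ 5)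
      / (w ^ 2 - 1) ^ 3)
    ((-43 / 6 + 77 / 12 * w - 19 / 3 * w ^ 2 + 409 / 12 * w ^ 3 - 39 * w ^ 4 + 12 * w ^ 5) / (w
      ^ 2 - 1) ^ 3)
    ((4 - 19 / 4 * w + 17 / 4 * w ^ 2 - 81 / 4 * w ^ 3 + 107 / 4 * w ^ 4 - 10 * w ^ 5) / (w ^ 2
      - 1) ^ 3)
    ((-1 + 3 / 2 * w - 3 / 2 * w ^ 2 + 11 / 2 * w ^ 3 - 15 / 2 * w ^ 4 + 3 * w ^ 5) / (w ^ 2 -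
      1) ^ 3)
    ((3 / 16 * w + 1 / 8 * w ^ 3) / (w ^ 2 - 1) ^ 3) (by fun_prop)]
  · field_simp
    ring
  · intro t
    rw [bezierDen]
    field_simp
    push_cast
    ring

theorem lineMoment_bezier_one_two {w : ℝ} (hw : 0 < w) (hw1 : w ≠ 1) :
    lineMoment (bezierU w) (bezierV w) (fun t => 2 * t * (1 - t + w * t) / bezierDen w t ^ 2)
      1 2 =
      (-1 / 12 - 3 / 32 * w ^ 2 + 1 / 48 * w ^ 4 + (5 / 16 * w) * theta w) / (w ^ 2 - 1) ^ 3 := by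
  have hW := sq_sub_one_ne_zero hw hw1
  rw [lineMoment_bezier hw, integral_div_bezierDen hw hw1 4
    ((-5 / 192 + 1 / 48 * w - 13 / 192 * w ^ 2 - 7 / 48 * w ^ 3 - 1 / 32 * w ^ 4) / (w ^ 2 - 1)
      ^ 4)
    ((-5 / 24 + 7 / 32 * w - 11 / 12 * w ^ 2 - 1 / 4 * w ^ 3) / (w ^ 2 - 1) ^ 3)
    ((5 / 6 - 33 / 32 * w + 355 / 96 * w ^ 2 - 7 / 4 * w ^ 3 - 3 / 4 * w ^ 4) / (w ^ 2 - 1) ^ 3)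
    ((-25 / 12 + 45 / 16 * w - 139 / 16 * w ^ 2 + 73 / 8 * w ^ 3 - 1 / 6 * w ^ 4 - w ^ 5) /
      (w ^ 2 - 1) ^ 3)
    ((85 / 24 - 59 / 12 * w + 199 / 16 * w ^ 2 - 157 / 8 * w ^ 3 + 307 / 48 * w ^ 4 + 8 / 3 * w
      ^ 5 - 1 / 2 * w ^ 6) / (w ^ 2 - 1) ^ 3)
    ((-25 / 6 + 133 / 24 * w - 21 / 2 * w ^ 2 + 183 / 8 * w ^ 3 - 163 / 12 * w ^ 4 - 13 / 6 * w
      ^ 5 + 2 * w ^ 6) / (w ^ 2 - 1) ^ 3)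
    ((3 - 31 / 8 * w + 37 / 8 * w ^ 2 - 113 / 8 * w ^ 3 + 99 / 8 * w ^ 4 + 1 / 2 * w ^ 5 - 5 / 2
      * w ^ 6) / (w ^ 2 - 1) ^ 3)
    ((-1 + 5 / 4 * w - 3 / 4 * w ^ 2 + 15 / 4 * w ^ 3 - 17 / 4 * w ^ 4 + w ^ 6) / (w ^ 2 -
      1) ^ 3)
    ((5 / 32 * w) / (w ^ 2 - 1) ^ 3) (by fun_prop)]
  · field_simp
    ring
  · intro t
    rw [bezierDen]
    field_simp
    push_cast
    ring

end CylinderClip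

namespace CylinderClip

open Filter Set

/-! ### Integrals along rational Bézier arcs -/

/-- The values of the `i`-th coordinate at three points. -/
def coord (a b c : Point) (i : Fin 3) : Fin 3 → ℝ := ![a i, b i, c i]

/-- The integrals of `x, x² / 2, xy, xz` over a lens with the given moments. -/
noncomputable def lensVec (m : Fin 6 → ℝ) (a b c : Point) : Fin 4 → ℝ :=
  ![lensForm m (coord a b c 0) 1, 1 / 2 * lensForm m (coord a b c 0) (coord a b c 0),
    lensForm m (coord a b c 0) (coord a b c 1), lensForm m (coord a b c 0) (coord a b c 2)]

/-- The moments of the lens between a rational Bézier arc and its chord. -/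
noncomputable def bezierMoments (w : ℝ) : Fin 6 → ℝ :=
  lensMoments (bezierU w) (bezierV w) fun t => 2 * t * (1 - t + w * t) / bezierDen w t ^ 2

/-- The columns of `matK` collect the six moments over common powers of `w ^ 2 - 1`. The factor `-2`
compensates that `jac` of `z` and `y` is `-2` times `areaYZ`. -/
theorem B3_eq {w : ℝ} (hw : 0 < w) (hw1 : w ≠ 1) (a b c : Point) :
    B3 w a b c = (-2 : ℝ) • lensVec (bezierMoments w) a b c := by
  have hW := sq_sub_one_ne_zero hw hw1
  have hl : lambda w = 1 / (w ^ 2 - 1) := by rw [lambda]; congr 1; ring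
  have hK : matK *ᵥ vecD w = ![theta w * w - 5 / 6 * w ^ 2 + 1 / 3 * w ^ 4,
      2 / 3 * w ^ 2 - 2 * theta w * w ^ 3 + 1 / 3 * w ^ 4,
      -3 / 16 * theta w * w + 23 / 96 * w ^ 2 - 1 / 8 * theta w * w ^ 3 - 1 / 8 * w ^ 4 +
        1 / 24 * w ^ 6,
      -1 / 8 * theta w * w + 5 / 48 * w ^ 2 + 1 / 8 * theta w * w ^ 3 - 7 / 48 * w ^ 4 +
        1 / 24 * w ^ 6,
      -1 / 3 * w ^ 2 + 5 / 4 * theta w * w ^ 3 - 3 / 8 * w ^ 4 + 1 / 12 * w ^ 6,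
      -1 / 4 * theta w * w ^ 3 + 13 / 24 * w ^ 4 - theta w * w ^ 5 + 1 / 12 * w ^ 6] := by
    ext k
    fin_cases k <;>
      simp [matK, vecD, Matrix.mulVec, dotProduct, Fin.sum_univ_six] <;> ring
  rw [B3, ← Matrix.mulVec_mulVec, hK, bezierMoments, lensMoments, lineMoment_bezier_one_zero hw hw1,
    lineMoment_bezier_two_zero hw hw1, lineMoment_bezier_one_one hw hw1,
    lineMoment_bezier_three_zero hw hw1, lineMoment_bezier_two_one hw hw1,
    lineMoment_bezier_one_two hw hw1]
  generalize theta w = θ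
  ext k
  rw [Matrix.mulVec_diagonal]
  fin_cases k <;>
    simp [vecE, hl, matC, lensVec, lensForm, coord, Matrix.mulVec, dotProduct,
      Fin.sum_univ_six] <;> field_simp <;> ring

theorem bezier_eq_bary {w : ℝ} (hw : 0 < w) (a b c : Point) {t : ℝ} (ht : t ∈ Icc (0 : ℝ) 1)
    (i : Fin 3) : bezier w a b c t i = bary (coord a b c i) (bezierU w t) (bezierV w t) := by
  have hD := (bezierDen_pos hw ht).ne'
  rw [bezier_apply]
  simp only [bary, coord, bezierU, bezierV, Matrix.cons_val]
  rw [div_eq_iff hD]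
  field_simp
  rw [bezierDen]
  ring

theorem bary_one (u v : ℝ) : bary 1 u v = 1 := by simp [bary]

theorem deriv_bezier_eq {w : ℝ} (hw : 0 < w) (a b c : Point) {t : ℝ} (ht : t ∈ Icc (0 : ℝ) 1)
    (i : Fin 3) (hd : DifferentiableAt ℝ (fun t => bezier w a b c t i) t) :
    deriv (fun t => bezier w a b c t i) t =
      (a i - c i) * (-(2 * (1 - t) * (t + w * (1 - t))) / bezierDen w t ^ 2) +
      (b i - c i) * (2 * t * (1 - t + w * t) / bezierDen w t ^ 2) := by
  have hu := hasDerivAt_bezierU hw ht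
  have hv := hasDerivAt_bezierV hw ht
  have h1 : HasDerivAt (fun t => bary (coord a b c i) (bezierU w t) (bezierV w t)) _ t :=
    ((hu.const_mul _).add (hv.const_mul _)).add (((hu.const_sub 1).sub hv).const_mul _)
  have h2 := h1.hasDerivWithinAt (s := Icc 0 1) |>.congr
    (fun s hs => bezier_eq_bary hw a b c hs i) (bezier_eq_bary hw a b c ht i)
  rw [(uniqueDiffOn_Icc zero_lt_one t ht).eq_deriv _ hd.hasDerivAt.hasDerivWithinAt h2]
  simp only [coord, Matrix.cons_val]
  ring

/-- The integrand `f g k dl` for affine functions along a rational Bézier curve. -/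
noncomputable def tripleForm (w : ℝ) (f g k l : Fin 3 → ℝ) (t : ℝ) : ℝ :=
  ((l 0 - l 2) * (-(2 * (1 - t) * (t + w * (1 - t))) / bezierDen w t ^ 2) +
    (l 1 - l 2) * (2 * t * (1 - t + w * t) / bezierDen w t ^ 2)) *
  (bary f (bezierU w t) (bezierV w t) * bary g (bezierU w t) (bezierV w t) *
    bary k (bezierU w t) (bezierV w t))

theorem intervalIntegrable_tripleForm {w : ℝ} (hw : 0 < w) (f g k l : Fin 3 → ℝ) :
    IntervalIntegrable (tripleForm w f g k l) volume 0 1 := by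
  have h := isLensSide_bezier hw
  have := h.cont_u; have := h.cont_v; have := h.cont_u'; have := h.cont_v'
  refine ContinuousOn.intervalIntegrable ?_
  rw [uIcc_of_le zero_le_one]
  unfold tripleForm bary
  fun_prop

theorem integral_apply_of_eqOn {F : ℝ → Fin 4 → ℝ} {G : Fin 4 → ℝ → ℝ}
    (h : ∀ k, ∀ t ∈ Icc (0 : ℝ) 1, F t k = G k t) (hG : ∀ k, IntervalIntegrable (G k) volume 0 1)
    (k : Fin 4) : (∫ t in (0 : ℝ)..1, F t) k = ∫ t in (0 : ℝ)..1, G k t := by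
  have hF : IntervalIntegrable (fun t i => G i t) volume 0 1 := by
    rw [intervalIntegrable_iff] at *
    refine Integrable.of_eval fun i => ?_
    exact (intervalIntegrable_iff.1 (hG i))
  have h1 : ∫ t in (0 : ℝ)..1, F t = ∫ t in (0 : ℝ)..1, fun i => G i t :=
    intervalIntegral.integral_congr fun t ht => by
      rw [uIcc_of_le zero_le_one] at ht
      exact funext fun i => h i t ht
  rw [h1]
  exact ((ContinuousLinearMap.proj (R := ℝ) (φ := fun _ : Fin 4 => ℝ) k).intervalIntegral_comp_comm
    hF).symm

/-- The case of a vertical plane: `x` and `y` are affinely dependent, so among the Jacobians with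
`y` only that of `z` survives. The chord part is `B2`. -/
theorem integral_bezier_psiR {w : ℝ} (hw : 0 < w) {a b c : Point}
    (hJ : jac (coord a b c 0) (coord a b c 1) = 0) :
    ∫ t in (0 : ℝ)..1, deriv (fun t => bezier w a b c t 1) t • psiR (bezier w a b c t) =
      (b 1 - a 1) • B2 a b + jac (coord a b c 2) (coord a b c 1) •
        lensVec (bezierMoments w) a b c := by
  set x := coord a b c 0 with hx
  set y := coord a b c 1 with hy
  set z := coord a b c 2 with hz
  have hi := fun f g k => intervalIntegrable_tripleForm hw f g k y
  have hI := fun f g k => (isLensSide_bezier hw).integral_bary f g k y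
  set G : Fin 4 → ℝ → ℝ := ![tripleForm w x z 1 y, fun t => 1 / 2 * tripleForm w x x z y t,
    tripleForm w x y z y, fun t => 1 / 2 * tripleForm w x z z y t] with hG
  have hF : ∀ k, ∀ t ∈ Icc (0 : ℝ) 1, (deriv (fun t => bezier w a b c t 1) t •
      psiR (bezier w a b c t)) k = G k t := by
    intro k t ht
    rw [deriv_bezier_eq hw a b c ht 1
      ((tame_bezier hw a b c 1).hasDerivAt t ht).differentiableAt]
    fin_cases k <;> simp [hG, psiR, tripleForm, bezier_eq_bary hw a b c ht, bary_one, hx, hy, hz,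
      coord] <;> ring
  have hGi : ∀ k, IntervalIntegrable (G k) volume 0 1 := by
    intro k
    fin_cases k
    · exact hi x z 1
    · exact (hi x x z).const_mul _
    · exact hi x y z
    · exact (hi x z z).const_mul _
  ext k
  rw [integral_apply_of_eqOn hF hGi]
  have hJ' : jac y y = 0 := by simp [jac]; ring
  have hJ1 : jac 1 y = 0 := by simp [jac]
  rw [← bezierMoments] at hI
  fin_cases k
  · refine (hI x z 1).trans ?_
    rw [hJ, hJ1]
    simp [B2, lensVec, hx, hy, hz, coord]
    ring
  · change ∫ t in (0 : ℝ)..1, 1 / 2 * tripleForm w x x z y t = _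
    rw [intervalIntegral.integral_const_mul]
    refine (congrArg _ (hI x x z)).trans ?_
    rw [hJ]
    simp [B2, lensVec, hx, hy, hz, coord]
    ring
  · refine (hI x y z).trans ?_
    rw [hJ, hJ']
    simp [B2, lensVec, hx, hy, hz, coord]
    ring
  · change ∫ t in (0 : ℝ)..1, 1 / 2 * tripleForm w x z z y t = _
    rw [intervalIntegral.integral_const_mul]
    refine (congrArg _ (hI x z z)).trans ?_
    rw [hJ]
    simp [B2, lensVec, hx, hy, hz, coord]
    ring

/-- Every component of `psiR - psiF` is `s` times a cubic divisible by `x²`. The relation between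
the Jacobians absorbs the slope `s`, and the same lens term as for a vertical plane results. -/
theorem integral_bezier_psiR_sub_psiF {w : ℝ} (hw : 0 < w) {a b c : Point} {s : ℝ}
    (hJ : jac (coord a b c 2) (coord a b c 1) = s * jac (coord a b c 0) (coord a b c 1)) :
    ∫ t in (0 : ℝ)..1, deriv (fun t => bezier w a b c t 1) t •
        (psiR (bezier w a b c t) - psiF s (bezier w a b c t)) =
      (b 1 - a 1) • B2 a b - chordF s a b + jac (coord a b c 2) (coord a b c 1) •
        lensVec (bezierMoments w) a b c := by
  set x := coord a b c 0 with hx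
  set y := coord a b c 1 with hy
  set z := coord a b c 2 with hz
  have hi := fun f g k => intervalIntegrable_tripleForm hw f g k y
  have hI := fun f g k => (isLensSide_bezier hw).integral_bary f g k y
  set G : Fin 4 → ℝ → ℝ := ![fun t => s / 2 * tripleForm w x x 1 y t,
    fun t => s / 6 * tripleForm w x x x y t, fun t => s / 2 * tripleForm w x x y y t,
    fun t => s / 2 * tripleForm w x x z y t - s ^ 2 / 6 * tripleForm w x x x y t] with hG
  have hF : ∀ k, ∀ t ∈ Icc (0 : ℝ) 1, (deriv (fun t => bezier w a b c t 1) t •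
      (psiR (bezier w a b c t) - psiF s (bezier w a b c t))) k = G k t := by
    intro k t ht
    rw [deriv_bezier_eq hw a b c ht 1
      ((tame_bezier hw a b c 1).hasDerivAt t ht).differentiableAt]
    fin_cases k <;> simp [hG, psiR, psiF, tripleForm, bezier_eq_bary hw a b c ht, bary_one, hx, hy,
      hz, coord] <;> ring
  have hGi : ∀ k, IntervalIntegrable (G k) volume 0 1 := by
    intro k
    fin_cases k
    · exact (hi x x 1).const_mul _
    · exact (hi x x x).const_mul _
    · exact (hi x x y).const_mul _
    · exact ((hi x x z).const_mul _).sub ((hi x x x).const_mul _)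
  ext k
  rw [integral_apply_of_eqOn hF hGi]
  have hJ' : jac y y = 0 := by simp [jac]; ring
  have hJ1 : jac 1 y = 0 := by simp [jac]
  rw [← bezierMoments] at hI
  fin_cases k
  · change ∫ t in (0 : ℝ)..1, s / 2 * tripleForm w x x 1 y t = _
    rw [intervalIntegral.integral_const_mul]
    refine (congrArg _ (hI x x 1)).trans ?_
    rw [hJ, hJ1]
    simp [B2, chordF, psiF, lensVec, hx, hy, coord]
    ring
  · change ∫ t in (0 : ℝ)..1, s / 6 * tripleForm w x x x y t = _
    rw [intervalIntegral.integral_const_mul]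
    refine (congrArg _ (hI x x x)).trans ?_
    rw [hJ]
    simp [B2, chordF, psiF, lensVec, hx, hy, coord]
    ring
  · change ∫ t in (0 : ℝ)..1, s / 2 * tripleForm w x x y y t = _
    rw [intervalIntegral.integral_const_mul]
    refine (congrArg _ (hI x x y)).trans ?_
    rw [hJ, hJ']
    simp [B2, chordF, psiF, lensVec, hx, hy, coord]
    ring
  · change ∫ t in (0 : ℝ)..1, (s / 2 * tripleForm w x x z y t -
      s ^ 2 / 6 * tripleForm w x x x y t) = _
    rw [intervalIntegral.integral_sub ((hi x x z).const_mul _) ((hi x x x).const_mul _),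
      intervalIntegral.integral_const_mul, intervalIntegral.integral_const_mul]
    refine (congrArg₂ (fun p q => s / 2 * p - s ^ 2 / 6 * q) (hI x x z) (hI x x x)).trans ?_
    simp only []
    rw [hJ]
    simp [B2, chordF, psiF, lensVec, hx, hy, hz, coord]
    ring

theorem areaYZ_smul_B3 {w : ℝ} (hw : 0 < w) {a b c : Point} (h : w = 1 → areaYZ a b c = 0) :
    areaYZ a b c • B3 w a b c =
      jac (coord a b c 2) (coord a b c 1) • lensVec (bezierMoments w) a b c := by
  have hJ : jac (coord a b c 2) (coord a b c 1) = -2 * areaYZ a b c := by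
    simp [jac, coord, areaYZ]; ring
  rw [hJ]
  by_cases hw1 : w = 1
  · rw [h hw1]; simp
  · rw [B3_eq hw hw1, smul_smul, mul_comm]

end CylinderClip

namespace CylinderClip

open Filter Set

/-! ### The contributions of a face -/

/-- A polynomial parametrization of an arc of the cylinder is degenerate. -/
theorem areaYZ_eq_zero_of_bezier_one {α β : ℝ} (hβ : β ≠ 0) {a b c : Point}
    (h : ∀ t ∈ Icc (0 : ℝ) 1, bezier 1 a b c t ∈ surface α β) : areaYZ a b c = 0 := by
  have hF : ∀ t ∈ Icc (0 : ℝ) 1, β * ((1 - t) ^ 2 * a 1 + 2 * t * (1 - t) * c 1 + t ^ 2 * b 1) ^ 2 +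
      ((1 - t) ^ 2 * a 2 + 2 * t * (1 - t) * c 2 + t ^ 2 * b 2) ^ 2 = α ^ 2 := by
    intro t ht
    have h1 : phi α β (bezier 1 a b c t) = 0 := h t ht
    have hD : bezierDen 1 t = 1 := by rw [bezierDen]; ring
    simp only [phi, bezier_apply, hD, div_one, mul_one] at h1
    linarith
  have h0 := hF 0 (by norm_num)
  have h1 := hF (1 / 4) (by norm_num)
  have h2 := hF (1 / 2) (by norm_num)
  have h3 := hF (3 / 4) (by norm_num)
  have h4 := hF 1 (by norm_num)
  set p := a 1 - 2 * c 1 + b 1 with hp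
  set q := a 2 - 2 * c 2 + b 2 with hq
  set e := c 1 - a 1 with he
  set f := c 2 - a 2 with hf
  -- The cylinder equation along the curve is a constant polynomial of formal degree four in `t`.
  -- Its values at five nodes give the vanishing of the coefficients of `t⁴` and, in the next step,
  -- of `t³`.
  have hA : β * p ^ 2 + q ^ 2 = 0 := by
    rw [hp, hq]
    linear_combination (32 / 3) * (h0 - 4 * h1 + 6 * h2 - 4 * h3 + h4)
  have hB : β * p * e + q * f = 0 := by
    rw [hp, hq, he, hf]
    linear_combination 16 * (-(10 / 24) * h0 + 9 / 6 * h1 - 2 * h2 + 7 / 6 * h3 - 1 / 4 * h4)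
  -- Second and first order directions `(p, q)` and `(e, f)` are parallel: `(p, q)` is isotropic and
  -- orthogonal to `(e, f)` for the form `β y² + z²`.
  have hpf : p * f - q * e = 0 := by
    by_cases hq0 : q = 0
    · rw [hq0] at hA
      have : p = 0 := by
        have : β * p ^ 2 = 0 := by linarith
        simpa [hβ] using this
      rw [this, hq0]; ring
    · refine (mul_eq_zero.1 (?_ : q * (p * f - q * e) = 0)).resolve_left hq0
      linear_combination p * hB - e * hA
  rw [areaYZ]
  rw [hp, hq, he, hf] at hpf
  linear_combination (1 / 2) * hpf

namespace Edge

theorem curve_of_onSurface {e : Edge} (h : e.onSurface = true) :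
    e.curve = bezier e.weight e.source e.target e.control := if_pos h

theorem curve_of_not_onSurface {e : Edge} (h : ¬ e.onSurface = true) : e.curve = e.chord :=
  if_neg h

theorem intervalIntegrable_curve {e : Edge} (hw : e.onSurface = true → 0 < e.weight)
    {ψ : Point → Fin 4 → ℝ} (hψ : Continuous ψ) :
    IntervalIntegrable (fun t => deriv (fun s => e.curve s 1) t • ψ (e.curve t)) volume 0 1 := by
  refine ContinuousOn.intervalIntegrable ?_
  rw [uIcc_of_le zero_le_one]
  exact (tame_curve hw 1).continuousOn_deriv.smul (hψ.comp_continuousOn (continuousOn_curve hw))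

theorem intervalIntegrable_chord (e : Edge) {ψ : Point → Fin 4 → ℝ} (hψ : Continuous ψ) :
    IntervalIntegrable (fun t => deriv (fun s => e.chord s 1) t • ψ (e.chord t)) volume 0 1 := by
  refine ContinuousOn.intervalIntegrable ?_
  rw [uIcc_of_le zero_le_one]
  refine (tame_linearCurve e.source e.target 1).continuousOn_deriv.smul
    (hψ.comp_continuousOn (continuousOn_pi.2 fun i => ?_))
  exact fun t ht => ((tame_linearCurve e.source e.target i).hasDerivAt t
    ht).continuousAt.continuousWithinAt

end Edge

namespace ClippedEdges

variable {α β : ℝ} {P : Polyhedron}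

/-- At `t = 1 / 2` the curve is a weighted mean of source, target and control point, the last with a
positive coefficient. All but the control point are known to lie in the plane. -/
theorem control_mem (E : ClippedEdges α β P) {i : Fin P.numFaces} {j : Fin (E.numEdges i)}
    (h : (E.edge i j).onSurface = true) :
    P.normal i ⬝ᵥ (E.edge i j).control = P.offset i := by
  have hw := E.weight_pos i j h
  have hm := E.dotProduct_curve i j (t := 1 / 2) (by norm_num)
  have ha := E.source_mem i j
  have hb := E.target_mem i j
  rw [Edge.curve_of_onSurface h] at hm
  rw [dotProduct_three] at *
  have hD : bezierDen (E.edge i j).weight (1 / 2) = (1 + (E.edge i j).weight) / 2 := by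
    rw [bezierDen]; ring
  have h1 : (0 : ℝ) < (1 + (E.edge i j).weight) / 2 := by linarith
  simp only [bezier_apply, hD] at hm
  have key : P.offset i * ((1 + (E.edge i j).weight) / 2) = _ :=
    (congrArg (· * ((1 + (E.edge i j).weight) / 2)) hm).symm
  simp only [add_mul, mul_assoc, div_mul_cancel₀ _ h1.ne'] at key
  refine mul_left_cancel₀ hw.ne' ?_
  linear_combination -2 * key - 1 / 2 * ha - 1 / 2 * hb

theorem areaYZ_smul_B3_eq (E : ClippedEdges α β P) (hβ : β ≠ 0) {i : Fin P.numFaces}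
    {j : Fin (E.numEdges i)} (h : (E.edge i j).onSurface = true) :
    areaYZ (E.edge i j).source (E.edge i j).target (E.edge i j).control •
      B3 (E.edge i j).weight (E.edge i j).source (E.edge i j).target (E.edge i j).control =
      jac (coord (E.edge i j).source (E.edge i j).target (E.edge i j).control 2)
        (coord (E.edge i j).source (E.edge i j).target (E.edge i j).control 1) •
        lensVec (bezierMoments (E.edge i j).weight) (E.edge i j).source (E.edge i j).target
          (E.edge i j).control :=
  areaYZ_smul_B3 (E.weight_pos i j h) fun hw =>
    areaYZ_eq_zero_of_bezier_one (α := α) hβ fun t ht => by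
    rw [← hw, ← Edge.curve_of_onSurface h]
    exact E.curve_mem_surface h ht

theorem integral_curve_psiR (E : ClippedEdges α β P) (hβ : β ≠ 0) {i : Fin P.numFaces}
    (hn : P.normal i 2 = 0) {j : Fin (E.numEdges i)} (h : (E.edge i j).onSurface = true) :
    ∫ t in (0 : ℝ)..1, deriv (fun s => (E.edge i j).curve s 1) t • psiR ((E.edge i j).curve t) =
      ((E.edge i j).target 1 - (E.edge i j).source 1) •
        B2 (E.edge i j).source (E.edge i j).target +
      areaYZ (E.edge i j).source (E.edge i j).target (E.edge i j).control •
      B3 (E.edge i j).weight (E.edge i j).source (E.edge i j).target (E.edge i j).control := by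
  have harea := areaXY_eq_zero (P.normal_ne_zero i) hn (E.source_mem i j) (E.target_mem i j)
    (E.control_mem h)
  rw [E.areaYZ_smul_B3_eq hβ h, Edge.curve_of_onSurface h,
    integral_bezier_psiR (E.weight_pos i j h)]
  simp only [jac, coord, Matrix.cons_val]
  rw [areaXY] at harea
  linear_combination 2 * harea

/-- The plane equation for source, target and control point yields the proportionality of Jacobians
that the lens formula needs. -/
theorem integral_curve_psiR_sub_psiF (E : ClippedEdges α β P) (hβ : β ≠ 0) {i : Fin P.numFaces}
    (hn : P.normal i 2 ≠ 0) {j : Fin (E.numEdges i)} (h : (E.edge i j).onSurface = true) :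
    ∫ t in (0 : ℝ)..1, deriv (fun s => (E.edge i j).curve s 1) t • (psiR ((E.edge i j).curve t) -
        psiF (-P.normal i 0 / P.normal i 2) ((E.edge i j).curve t)) =
      ((E.edge i j).target 1 - (E.edge i j).source 1) •
        B2 (E.edge i j).source (E.edge i j).target -
      chordF (-P.normal i 0 / P.normal i 2) (E.edge i j).source (E.edge i j).target +
      areaYZ (E.edge i j).source (E.edge i j).target (E.edge i j).control •
      B3 (E.edge i j).weight (E.edge i j).source (E.edge i j).target (E.edge i j).control := by
  have ha := E.source_mem i j
  have hb := E.target_mem i j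
  have hc := E.control_mem h
  rw [E.areaYZ_smul_B3_eq hβ h, Edge.curve_of_onSurface h,
    integral_bezier_psiR_sub_psiF (E.weight_pos i j h)]
  rw [dotProduct_three] at ha hb hc
  simp only [jac, coord, Matrix.cons_val]
  generalize (E.edge i j).source = a at *
  generalize (E.edge i j).target = b at *
  generalize (E.edge i j).control = c at *
  generalize P.normal i = n at *
  rw [div_mul_eq_mul_div, eq_div_iff hn]
  linear_combination (b 1 - c 1) * (ha - hc) - (a 1 - c 1) * (hb - hc)

/-- Curve and chord stay in the plane of the face, and the curve of a marked edge also on the upper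
sheet, so both `bigPsi` have their closed forms. The chord terms then cancel the chord part of the
integral along the arc. -/
theorem M3_eq (hP : ∀ p ∈ P.carrier, 0 ≤ p 2) (hβ : β ≠ 0) (E : ClippedEdges α β P)
    {i : Fin P.numFaces} (hn : P.normal i 2 ≠ 0) :
    E.M3 i = ∑ j, (-(E.edge i j).indicator) • ∫ t in (0 : ℝ)..1,
      (deriv (fun s => (E.edge i j).chord s 1) t •
          (bigPsi (P.zFace i) ((E.edge i j).chord t 0) ((E.edge i j).chord t 1) -
            psiR ((E.edge i j).chord t)) +
        deriv (fun s => (E.edge i j).curve s 1) t •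
          (bigPsi (zSurface α β) ((E.edge i j).curve t 0) ((E.edge i j).curve t 1) -
            bigPsi (P.zFace i) ((E.edge i j).curve t 0) ((E.edge i j).curve t 1))) := by
  refine Finset.sum_congr rfl fun j _ => ?_
  by_cases h : (E.edge i j).onSurface = true
  · have hR : Continuous psiR := contDiff_psiR.continuous
    have hF : Continuous (psiF (-P.normal i 0 / P.normal i 2)) :=
      (contDiff_psiF (m := 1) _).continuous
    have h1 := (E.edge i j).intervalIntegrable_chord (hF.sub hR)
    have h2 := Edge.intervalIntegrable_curve (E.weight_pos i j) (hR.sub hF)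
    have h3 := (E.edge i j).intervalIntegrable_chord hF
    have h4 := (E.edge i j).intervalIntegrable_chord hR
    have hint : ∫ t in (0 : ℝ)..1, (deriv (fun s => (E.edge i j).chord s 1) t •
          (bigPsi (P.zFace i) ((E.edge i j).chord t 0) ((E.edge i j).chord t 1) -
            psiR ((E.edge i j).chord t)) +
        deriv (fun s => (E.edge i j).curve s 1) t •
          (bigPsi (zSurface α β) ((E.edge i j).curve t 0) ((E.edge i j).curve t 1) -
            bigPsi (P.zFace i) ((E.edge i j).curve t 0) ((E.edge i j).curve t 1))) =
        ∫ t in (0 : ℝ)..1, (deriv (fun s => (E.edge i j).chord s 1) t •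
          (psiF (-P.normal i 0 / P.normal i 2) - psiR) ((E.edge i j).chord t) +
          deriv (fun s => (E.edge i j).curve s 1) t •
          (psiR - psiF (-P.normal i 0 / P.normal i 2)) ((E.edge i j).curve t)) := by
      refine intervalIntegral.integral_congr fun t ht => ?_
      rw [uIcc_of_le zero_le_one] at ht
      simp only [bigPsi_zFace hn (E.chord_mem i j t), bigPsi_zFace hn (E.dotProduct_curve i j ht),
        bigPsi_zSurface_of_mem (E.curve_mem_surface h ht)
          (hP _ (P.face_subset_carrier i (E.curve_mem_face i j ht))), Pi.sub_apply]
    have hchord : ∫ t in (0 : ℝ)..1, deriv (fun s => (E.edge i j).chord s 1) t •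
          (psiF (-P.normal i 0 / P.normal i 2) - psiR) ((E.edge i j).chord t) =
        chordF (-P.normal i 0 / P.normal i 2) (E.edge i j).source (E.edge i j).target -
        ((E.edge i j).target 1 - (E.edge i j).source 1) •
          B2 (E.edge i j).source (E.edge i j).target := by
      simp only [Pi.sub_apply, smul_sub]
      rw [intervalIntegral.integral_sub h3 h4]
      simp only [Edge.chord]
      rw [integral_chord_psiF, integral_chord_psiR]
    rw [hint, intervalIntegral.integral_add h1 h2, hchord]
    simp only [Pi.sub_apply]
    rw [E.integral_curve_psiR_sub_psiF hβ hn h, neg_mul, neg_smul, neg_smul, mul_smul]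
    congr 2
    abel
  · simp [Edge.indicator, h]

/-- The chord integrals in the first two contributions are what the third lacks to give integrals
along the true edges. An unmarked edge is its own chord; a vertical face has zero sign on the right
and no first contribution on the left. -/
theorem M_eq (hβ : β ≠ 0) (E : ClippedEdges α β P) (i : Fin P.numFaces) :
    E.M1 i + E.M2 i + E.M3 i =
      (Real.sign (P.normal i 2) •
        ∫ q in planeLift (P.normal i) (P.offset i) ⁻¹' clippedFace α β P i,
          phiVec (planeLift (P.normal i) (P.offset i) q)) +
      ∑ j, (-(E.edge i j).indicator) • ∫ t in (0 : ℝ)..1,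
        deriv (fun s => (E.edge i j).curve s 1) t • psiR ((E.edge i j).curve t) := by
  by_cases hn : P.normal i 2 = 0
  · rw [E.M1_eq_zero hn, hn, Real.sign_zero, zero_smul, M2, M3, zero_add, zero_add,
      ← Finset.sum_add_distrib]
    refine Finset.sum_congr rfl fun j _ => ?_
    by_cases h : (E.edge i j).onSurface = true
    · rw [E.integral_curve_psiR hβ hn h, Edge.indicator, if_pos h]
      module
    · simp [Edge.indicator, h]
  · rw [integral_clippedFace E hn, E.M1_eq_sum_chordF hn, M2, M3, ← Finset.sum_add_distrib,
      ← Finset.sum_add_distrib, ← Finset.sum_add_distrib]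
    refine Finset.sum_congr rfl fun j _ => ?_
    by_cases h : (E.edge i j).onSurface = true
    · have key := E.integral_curve_psiR_sub_psiF hβ hn h
      simp only [smul_sub] at key
      rw [intervalIntegral.integral_sub
        (Edge.intervalIntegrable_curve (E.weight_pos i j) contDiff_psiR.continuous)
        (Edge.intervalIntegrable_curve (E.weight_pos i j) (contDiff_psiF (m := 1) _).continuous),
        sub_eq_iff_eq_add] at key
      rw [key, Edge.indicator, if_pos h]
      module
    · rw [Edge.curve_of_not_onSurface h]
      simp only [Edge.chord]
      rw [integral_chord_psiF]
      simp [Edge.indicator, h]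

theorem moments_eq_total (hα : 0 < α) (hβ : β ≠ 0) (hP : ∀ p ∈ P.carrier, 0 ≤ p 2)
    (E : ClippedEdges α β P) : moments (P.carrier ∩ region α β) = E.total := by
  rw [moments_eq hα hβ hP, integral_surfaceShadow hα hβ hP E, total, ← Finset.sum_add_distrib]
  exact Finset.sum_congr rfl fun i _ => (E.M_eq hβ i).symm

end ClippedEdges

end CylinderClip

namespace CylinderClip

open Filter Set

/-! ### Conic arcs -/

/-- For positive weight the rational Bernstein functions are non-negative and sum to one on `[0,
1]`. -/
theorem bezier_convex {w : ℝ} (hw : 0 < w) {t : ℝ} (ht : t ∈ Icc (0 : ℝ) 1) {s : Set ℝ}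
    (hs : Convex ℝ s) {a b c : Point} {i : Fin 3} (ha : a i ∈ s) (hb : b i ∈ s) (hc : c i ∈ s) :
    bezier w a b c t i ∈ s := by
  have hD := bezierDen_pos hw ht
  have h1 : 0 ≤ 1 - t := by linarith [ht.2]
  have h0 := ht.1
  have h := hs.sum_mem (t := Finset.univ) (w := ![(1 - t) ^ 2 / bezierDen w t,
    2 * w * t * (1 - t) / bezierDen w t, t ^ 2 / bezierDen w t]) (z := ![a i, c i, b i])
    (by intro k _; fin_cases k <;> simp <;> positivity)
    (by
      rw [Fin.sum_univ_three]
      simp only [Matrix.cons_val]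
      field_simp
      rw [bezierDen]
      ring)
    (by intro k _; fin_cases k <;> simpa)
  rw [Fin.sum_univ_three] at h
  simp only [Matrix.cons_val, smul_eq_mul] at h
  rw [bezier_apply]
  convert h using 1
  field_simp

/-- The polar form of the quadratic form of the cylinder is large on the upper sheet. -/
theorem polar_pos {α β : ℝ} (hα : 0 < α) {a b : Point} (ha : a ∈ surface α β)
    (hb : b ∈ surface α β) (ha0 : 0 ≤ a 2) (hb0 : 0 ≤ b 2) (hab : 0 < a 2 + b 2) :
    0 < α ^ 2 + (β * a 1 * b 1 + a 2 * b 2) := by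
  have ha' : β * a 1 ^ 2 + a 2 ^ 2 - α ^ 2 = 0 := ha
  have hb' : β * b 1 ^ 2 + b 2 ^ 2 - α ^ 2 = 0 := hb
  rcases le_or_gt 0 β with hβ | hβ
  -- Twice the quantity is `β (a 1 + b 1)² + (a 2 + b 2)²`. For negative `β` the polar form itself
  -- is non-negative, since each `|z|` dominates `√(-β) |y|`.
  · nlinarith [mul_nonneg hβ (sq_nonneg (a 1 + b 1)), mul_pos hab hab]
  · have h1 : -β * a 1 ^ 2 ≤ a 2 ^ 2 := by nlinarith
    have h2 : -β * b 1 ^ 2 ≤ b 2 ^ 2 := by nlinarith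
    have h3 : (β * a 1 * b 1) ^ 2 ≤ (a 2 * b 2) ^ 2 := by
      have := mul_le_mul h1 h2 (mul_nonneg (by linarith) (sq_nonneg _)) (sq_nonneg _)
      nlinarith
    have h4 := (abs_le_of_sq_le_sq' h3 (mul_nonneg ha0 hb0)).1
    nlinarith [mul_pos hα hα]

/-- In the coordinates `y, z` the control point is the pole of the chord, where the tangents at `a`
and `b` meet. The curve fills the arc by the intermediate value theorem for `y`: on the upper sheet
`y` determines `z`, and the plane then determines `x`. -/
theorem exists_bezier_eq_arc {α β : ℝ} (hα : 0 < α) {n : Point} {d : ℝ} {a b : Point}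
    (hn : n 0 ≠ 0) (han : n ⬝ᵥ a = d) (hbn : n ⬝ᵥ b = d) (ha : a ∈ surface α β)
    (hb : b ∈ surface α β) (ha0 : 0 ≤ a 2) (hb0 : 0 ≤ b 2) (hab : 0 < a 2 + b 2) :
    ∃ (w : ℝ) (c : Point), 0 < w ∧ bezier w a b c '' Icc 0 1 =
      {p | n ⬝ᵥ p = d ∧ p ∈ surface α β ∧ 0 ≤ p 2 ∧ p 1 ∈ uIcc (a 1) (b 1)} := by
  have hs := polar_pos hα ha hb ha0 hb0 hab
  have ha' : β * a 1 ^ 2 + a 2 ^ 2 - α ^ 2 = 0 := ha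
  have hb' : β * b 1 ^ 2 + b 2 ^ 2 - α ^ 2 = 0 := hb
  set s := α ^ 2 + (β * a 1 * b 1 + a 2 * b 2) with hsdef
  -- Forced by the coefficient of `t² (1 - t)²` when the cylinder equation is expanded along the
  -- curve.
  set w := √(s / (2 * α ^ 2)) with hwdef
  have hq : 0 < s / (2 * α ^ 2) := by positivity
  have hw : 0 < w := Real.sqrt_pos.2 hq
  have hw2 : 2 * α ^ 2 * w ^ 2 = s := by
    rw [hwdef, Real.sq_sqrt hq.le]; field_simp
  set c1 := α ^ 2 * (a 1 + b 1) / s with hc1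
  set c2 := α ^ 2 * (a 2 + b 2) / s with hc2
  set c : Point := ![(d - n 1 * c1 - n 2 * c2) / n 0, c1, c2] with hc
  have hcn : n ⬝ᵥ c = d := by
    rw [dotProduct_three]; simp only [hc, Matrix.cons_val]; field_simp; ring
  have hcs1 : c1 * s = α ^ 2 * (a 1 + b 1) := div_mul_cancel₀ _ hs.ne'
  have hcs2 : c2 * s = α ^ 2 * (a 2 + b 2) := div_mul_cancel₀ _ hs.ne'
  have hQac : β * a 1 * c1 + a 2 * c2 = α ^ 2 := by
    refine mul_right_cancel₀ hs.ne' ?_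
    linear_combination β * a 1 * hcs1 + a 2 * hcs2 + α ^ 2 * ha'
  have hQbc : β * b 1 * c1 + b 2 * c2 = α ^ 2 := by
    refine mul_right_cancel₀ hs.ne' ?_
    linear_combination β * b 1 * hcs1 + b 2 * hcs2 + α ^ 2 * hb'
  have hQcc : w ^ 2 * (β * c1 ^ 2 + c2 ^ 2) = α ^ 2 := by
    refine mul_right_cancel₀ hs.ne' ?_
    linear_combination w ^ 2 * β * c1 * hcs1 + w ^ 2 * c2 * hcs2 +
      w ^ 2 * α ^ 2 * (hQac + hQbc) + α ^ 2 * hw2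
  have hplane : ∀ t ∈ Icc (0 : ℝ) 1, n ⬝ᵥ bezier w a b c t = d := by
    intro t ht
    have hD := bezierDen_pos hw ht
    rw [dotProduct_three] at *
    simp only [bezier_apply]
    field_simp
    have : bezierDen w t = (1 - t) ^ 2 + 2 * w * t * (1 - t) + t ^ 2 := rfl
    rw [this]
    linear_combination (1 - t) ^ 2 * han + 2 * w * t * (1 - t) * hcn + t ^ 2 * hbn
  have hsurf : ∀ t ∈ Icc (0 : ℝ) 1, bezier w a b c t ∈ surface α β := by
    intro t ht
    have hD := bezierDen_pos hw ht
    change β * bezier w a b c t 1 ^ 2 + bezier w a b c t 2 ^ 2 - α ^ 2 = 0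
    have e1 : c 1 = c1 := rfl
    have e2 : c 2 = c2 := rfl
    rw [bezier_apply, bezier_apply, e1, e2]
    field_simp
    have : bezierDen w t = (1 - t) ^ 2 + 2 * w * t * (1 - t) + t ^ 2 := rfl
    rw [this]
    linear_combination (1 - t) ^ 4 * ha' + t ^ 4 * hb' + 4 * w * t * (1 - t) ^ 3 * hQac +
      4 * w * t ^ 3 * (1 - t) * hQbc + 4 * t ^ 2 * (1 - t) ^ 2 * hQcc -
      2 * t ^ 2 * (1 - t) ^ 2 * hw2
  have hpos : ∀ t ∈ Icc (0 : ℝ) 1, 0 ≤ bezier w a b c t 2 := fun t ht =>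
    bezier_convex hw ht (convex_Ici 0) ha0 hb0 (show 0 ≤ c2 by positivity)
  -- The control ordinate is the mean of `a 1` and `b 1` with the crossed weights `b 2` and `a 2`.
  have hc1mem : c1 ∈ uIcc (a 1) (b 1) := by
    have h := (convex_uIcc (a 1) (b 1)) left_mem_uIcc right_mem_uIcc
      (a := b 2 / (a 2 + b 2)) (b := a 2 / (a 2 + b 2)) (by positivity) (by positivity)
      (by field_simp; ring)
    convert h using 1
    rw [smul_eq_mul, smul_eq_mul, hc1]
    field_simp
    rw [hsdef]
    linear_combination -(a 1 * a 2) * hb' - b 1 * b 2 * ha'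
  have hy : ∀ t ∈ Icc (0 : ℝ) 1, bezier w a b c t 1 ∈ uIcc (a 1) (b 1) := fun t ht =>
    bezier_convex hw ht (convex_uIcc _ _) left_mem_uIcc right_mem_uIcc hc1mem
  refine ⟨w, c, hw, Subset.antisymm ?_ ?_⟩
  · rintro p ⟨t, ht, rfl⟩
    exact ⟨hplane t ht, hsurf t ht, hpos t ht, hy t ht⟩
  · rintro p ⟨hp, hpS, hp0, hpy⟩
    have hcont : ContinuousOn (fun t => bezier w a b c t 1) (uIcc 0 1) := by
      rw [uIcc_of_le zero_le_one]
      exact fun t ht => ((tame_bezier hw a b c 1).hasDerivAt t ht).continuousAt.continuousWithinAt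
    have hivt := intermediate_value_uIcc hcont
    simp only [bezier_zero, bezier_one] at hivt
    obtain ⟨t, ht, hty⟩ := hivt hpy
    rw [uIcc_of_le zero_le_one] at ht
    have hty' : bezier w a b c t 1 = p 1 := hty
    have htz : bezier w a b c t 2 = p 2 := by
      rw [← zSurface_of_mem (hsurf t ht) (hpos t ht) 0, hty', zSurface_of_mem hpS hp0]
    refine ⟨t, ht, ?_⟩
    have h1 := hplane t ht
    rw [dotProduct_three, hty', htz] at h1
    rw [dotProduct_three] at hp
    ext k
    fin_cases k
    · change bezier w a b c t 0 = p 0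
      exact mul_left_cancel₀ hn (by linarith)
    · exact hty'
    · exact htz

end CylinderClip

namespace CylinderClip

open Filter Set

/-! ### Splitting by the `xy`-plane -/

theorem volume_plane {n : Point} (hn : n ≠ 0) (d : ℝ) : volume {q : Point | n ⬝ᵥ q = d} = 0 := by
  rcases eq_empty_or_nonempty {q : Point | n ⬝ᵥ q = d} with h | ⟨p, hp⟩
  · rw [h, measure_empty]
  · have hp' : n ⬝ᵥ p = d := hp
    set S : AffineSubspace ℝ Point := AffineSubspace.mk' p (LinearMap.ker (dotProductBilin ℝ ℝ n))
      with hS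
    have hmem : ∀ q, q ∈ S ↔ n ⬝ᵥ q = d := by
      intro q
      rw [hS, AffineSubspace.mem_mk', LinearMap.mem_ker]
      change n ⬝ᵥ (q - p) = 0 ↔ _
      rw [dotProduct_sub, hp', sub_eq_zero]
    have hne : S ≠ ⊤ := by
      intro htop
      have h0 := (hmem (p + n)).1 (htop ▸ AffineSubspace.mem_top ℝ Point _)
      rw [dotProduct_add, hp', add_eq_left, dotProduct_self_eq_zero] at h0
      exact hn h0
    have : {q : Point | n ⬝ᵥ q = d} = S := by ext q; exact (hmem q).symm
    rw [this]
    exact Measure.addHaar_affineSubspace volume S hne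

theorem Polyhedron.volume_frontier (P : Polyhedron) : volume (frontier P.carrier) = 0 := by
  rw [P.frontier_eq]
  exact measure_iUnion_null fun i =>
    measure_mono_null (P.face_subset_plane i) (volume_plane (P.normal_ne_zero i) _)

theorem volume_horizontal : volume {p : Point | p 2 = 0} = 0 := by
  have h : (![0, 0, 1] : Point) ≠ 0 := fun h => by simpa using congrFun h 2
  have h1 := volume_plane h 0
  have h2 : ∀ q : Point, ![0, 0, 1] ⬝ᵥ q = q 2 := fun q => by
    rw [dotProduct_three]; simp only [Matrix.cons_val]; ring
  simpa only [h2] using h1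

theorem topHalf_subset {s : Set Point} (hs : IsClosed s) : topHalf s ⊆ s ∩ {p | 0 ≤ p 2} :=
  closure_minimal interior_subset
    (hs.inter (isClosed_le continuous_const (continuous_apply 2)))

theorem bottomHalf_subset {s : Set Point} (hs : IsClosed s) : bottomHalf s ⊆ s ∩ {p | p 2 ≤ 0} :=
  closure_minimal interior_subset
    (hs.inter (isClosed_le (continuous_apply 2) continuous_const))

/-- Apart from the frontier and the plane `z = 0`, both null, each point of the solid is interior to
one of the two halves, so taking closures of interiors loses no volume. -/
theorem moments_eq_topHalf_add_bottomHalf (α β : ℝ) (P : Polyhedron) :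
    moments (P.carrier ∩ region α β) =
      moments (topHalf P.carrier ∩ region α β) + moments (bottomHalf P.carrier ∩ region α β) := by
  have hcl := P.isCompact_carrier.isClosed
  have hr := isClosed_region α β
  have htop := topHalf_subset hcl
  have hbot := bottomHalf_subset hcl
  have hint : ∀ s ⊆ P.carrier, IntegrableOn upsilon (s ∩ region α β) := fun s hs =>
    (continuous_upsilon.continuousOn.integrableOn_compact P.isCompact_carrier).mono_set
      (inter_subset_left.trans hs)
  have hdisj : AEDisjoint volume (topHalf P.carrier ∩ region α β)
      (bottomHalf P.carrier ∩ region α β) := by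
    refine measure_mono_null ?_ volume_horizontal
    rintro p ⟨⟨h1, _⟩, h2, _⟩
    exact le_antisymm (hbot h2).2 (htop h1).2
  rw [moments, moments, moments, ← setIntegral_union₀ hdisj
    ((isClosed_closure.inter hr).measurableSet.nullMeasurableSet)
    (hint _ (htop.trans inter_subset_left)) (hint _ (hbot.trans inter_subset_left))]
  refine setIntegral_congr_set ?_
  have hN : ∀ᵐ p : Point, p ∉ frontier P.carrier ∧ p 2 ≠ 0 :=
    (measure_eq_zero_iff_ae_notMem.1 P.volume_frontier).and
      (measure_eq_zero_iff_ae_notMem.1 volume_horizontal)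
  filter_upwards [hN] with p hp
  refine propext ⟨?_, ?_⟩
  · rintro ⟨h1, h2⟩
    have hi : p ∈ interior P.carrier := by
      by_contra h
      exact hp.1 ⟨subset_closure h1, h⟩
    rcases lt_or_gt_of_ne hp.2 with h3 | h3
    · refine Or.inr ⟨subset_closure ?_, h2⟩
      rw [interior_inter]
      exact ⟨hi, mem_interior.2 ⟨{q | q 2 < 0}, fun _ h => le_of_lt (mem_ofPred_eq ▸ h),
        isOpen_lt (continuous_apply 2) continuous_const, h3⟩⟩
    · refine Or.inl ⟨subset_closure ?_, h2⟩
      rw [interior_inter]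
      exact ⟨hi, mem_interior.2 ⟨{q | 0 < q 2}, fun _ h => le_of_lt (mem_ofPred_eq ▸ h),
        isOpen_lt continuous_const (continuous_apply 2), h3⟩⟩
  · rintro (⟨h1, h2⟩ | ⟨h1, h2⟩)
    · exact ⟨(htop h1).1, h2⟩
    · exact ⟨(hbot h1).1, h2⟩

theorem rotX_rotX (p : Point) : rotX (rotX p) = p := by
  ext k; fin_cases k <;> simp [rotX]

theorem rotX_mem_region {α β : ℝ} {p : Point} : rotX p ∈ region α β ↔ p ∈ region α β := by
  simp [region, phi, rotX]

theorem measurePreserving_rotX : MeasurePreserving rotX := by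
  have h : ∀ i : Fin 3, MeasurePreserving ((![id, Neg.neg, Neg.neg] : Fin 3 → ℝ → ℝ) i) := by
    intro i
    fin_cases i
    · exact MeasurePreserving.id _
    · exact Measure.measurePreserving_neg _
    · exact Measure.measurePreserving_neg _
  convert volume_preserving_pi h using 1
  ext p k
  fin_cases k <;> rfl

/-- `rotMoments` as a continuous linear map. -/
noncomputable def rotMomentsL : (Fin 4 → ℝ) →L[ℝ] (Fin 4 → ℝ) :=
  LinearMap.toContinuousLinearMap
    { toFun := rotMoments
      map_add' := fun x y => by
        ext k; fin_cases k <;> simp [rotMoments] <;> ring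
      map_smul' := fun r x => by
        ext k; fin_cases k <;> simp [rotMoments] }

/-- The rotation preserves volume and the cylinder, and acts on the integrand by the linear map
`rotMomentsL`, which commutes with the integral. -/
theorem moments_rotX_image {α β : ℝ} {s : Set Point} (hs : IsCompact s) :
    moments (s ∩ region α β) = rotMoments (moments (rotX '' s ∩ region α β)) := by
  have hemb : MeasurableEmbedding rotX :=
    (MeasurableEquiv.ofInvolutive rotX rotX_rotX
      measurePreserving_rotX.measurable).measurableEmbedding
  have hc : IsCompact (rotX '' s) := by
    refine hs.image ?_
    unfold rotX
    exact continuous_vec (continuous_apply 0) (continuous_apply 1).neg (continuous_apply 2).neg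
  have hint : IntegrableOn upsilon (rotX '' s ∩ region α β) :=
    (continuous_upsilon.continuousOn.integrableOn_compact hc).mono_set inter_subset_left
  have hpre : rotX ⁻¹' (rotX '' s ∩ region α β) = s ∩ region α β := by
    ext p
    constructor
    · rintro ⟨⟨q, hq, hqp⟩, hr⟩
      have : q = p := by rw [← rotX_rotX q, hqp, rotX_rotX]
      exact ⟨this ▸ hq, rotX_mem_region.1 hr⟩
    · rintro ⟨h1, h2⟩
      exact ⟨mem_image_of_mem _ h1, rotX_mem_region.2 h2⟩
  have hval : ∀ p, rotMomentsL (upsilon (rotX p)) = upsilon p := by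
    intro p
    change rotMoments (upsilon (rotX p)) = upsilon p
    ext k; fin_cases k <;> simp [rotMoments, upsilon, rotX]
  have h1 := rotMomentsL.integral_comp_comm hint
  have h2 := measurePreserving_rotX.setIntegral_preimage_emb hemb
    (fun p => rotMomentsL (upsilon p)) (rotX '' s ∩ region α β)
  rw [hpre] at h2
  simp only [hval] at h2
  exact h2.trans h1

theorem moments_eq_total_add_rotMoments_total {α β : ℝ} (hα : 0 < α) (hβ : β ≠ 0)
    (P T B : Polyhedron)
    (hT : T.carrier = topHalf P.carrier) (hB : B.carrier = rotX '' bottomHalf P.carrier)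
    (E : ClippedEdges α β T) (E' : ClippedEdges α β B) :
    moments (P.carrier ∩ region α β) = E.total + rotMoments E'.total := by
  have hcl := P.isCompact_carrier.isClosed
  have hbot := bottomHalf_subset hcl
  have hT0 : ∀ p ∈ T.carrier, 0 ≤ p 2 := fun p hp => (topHalf_subset hcl (hT ▸ hp)).2
  have hB0 : ∀ p ∈ B.carrier, 0 ≤ p 2 := by
    intro p hp
    rw [hB] at hp
    obtain ⟨q, hq, rfl⟩ := hp
    have : q 2 ≤ 0 := (hbot hq).2
    simpa [rotX] using this
  have hcpt : IsCompact (bottomHalf P.carrier) :=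
    P.isCompact_carrier.of_isClosed_subset isClosed_closure
      (hbot.trans inter_subset_left)
  rw [moments_eq_topHalf_add_bottomHalf, moments_rotX_image hcpt, ← hT, ← hB,
    E.moments_eq_total hα hβ hT0, E'.moments_eq_total hα hβ hB0]

end CylinderClip

theorem mainTheorem1 (α β : ℝ) (hα : 0 < α) (hβ : β ≠ 0) :
    -- polyhedra in the half-space `z ≥ 0`
    (∀ P : Polyhedron, (∀ p ∈ P.carrier, 0 ≤ p 2) → ∀ E : ClippedEdges α β P,
      moments (P.carrier ∩ region α β) = ∑ i, (E.M1 i + E.M2 i + E.M3 i) ∧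
      -- the closed forms are the integrals which the three contributions stand for
      (∀ i, P.normal i 2 ≠ 0 →
        E.M1 i = ∑ j, ∫ t in (0 : ℝ)..1,
          deriv (fun s => (E.edge i j).chord s 1) t •
            bigPsi (P.zFace i) ((E.edge i j).chord t 0) ((E.edge i j).chord t 1)) ∧
      (∀ i, E.M2 i = ∑ j, (-(E.edge i j).indicator) • ∫ t in (0 : ℝ)..1,
          deriv (fun s => (E.edge i j).chord s 1) t • psiR ((E.edge i j).chord t)) ∧
      (∀ i, P.normal i 2 ≠ 0 →
        E.M3 i = ∑ j, (-(E.edge i j).indicator) • ∫ t in (0 : ℝ)..1,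
          (deriv (fun s => (E.edge i j).chord s 1) t •
              (bigPsi (P.zFace i) ((E.edge i j).chord t 0) ((E.edge i j).chord t 1) -
                psiR ((E.edge i j).chord t)) +
            deriv (fun s => (E.edge i j).curve s 1) t •
              (bigPsi (zSurface α β) ((E.edge i j).curve t 0) ((E.edge i j).curve t 1) -
                bigPsi (P.zFace i) ((E.edge i j).curve t 0) ((E.edge i j).curve t 1))))) ∧
    -- conic arcs are reproduced exactly by rational Bézier curves
    (∀ (n : Point) (d : ℝ) (a b : Point), n 0 ≠ 0 →
      n ⬝ᵥ a = d → n ⬝ᵥ b = d → a ∈ surface α β → b ∈ surface α β →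
      0 ≤ a 2 → 0 ≤ b 2 → 0 < a 2 + b 2 →
      ∃ (w : ℝ) (c : Point), 0 < w ∧
        bezier w a b c '' Set.Icc 0 1 =
          {p | n ⬝ᵥ p = d ∧ p ∈ surface α β ∧ 0 ≤ p 2 ∧ p 1 ∈ Set.uIcc (a 1) (b 1)}) ∧
    -- arbitrary polyhedra: split by the `xy`-plane and rotate the lower half
    (∀ P T B : Polyhedron, T.carrier = topHalf P.carrier →
      B.carrier = rotX '' bottomHalf P.carrier →
      ∀ (E : ClippedEdges α β T) (E' : ClippedEdges α β B),
        moments (P.carrier ∩ region α β) = E.total + rotMoments E'.total) := by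
  refine ⟨fun P hP E => ⟨?_, fun i hn => E.M1_eq hn, E.M2_eq, fun i hn => E.M3_eq hP hβ hn⟩,
    fun n d a b hn han hbn ha hb ha0 hb0 hab =>
      exists_bezier_eq_arc hα hn han hbn ha hb ha0 hb0 hab,
    fun P T B hT hB E E' => moments_eq_total_add_rotMoments_total hα hβ P T B hT hB E E'⟩
  exact E.moments_eq_total hα hβ hP
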